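/- Fix constants $0<c\le 1\le C$ with $c<C$; for a positive integer $N$ write $n\sim N$ for integers $n$ with $cN\le n\le CN$. Let $e(x)=e^{2\pi i x}$. For integers $K,L$ and real $\eta>0$ with $$1\le L<K\le \frac1\eta\le KL,$$ and complex coefficients $a=(a_{kl})$ with $|a_{kl}|\le 1$ for $k\sim K$, $l\sim L$, let $$G_4(a)=\left(\frac1{|B|}\int_{B}\Big|\sum_{k\sim K}\sum_{l\sim L}a_{kl}\,e\big(lx_1+klx_2+l\sqrt k\,x_3\big)\Big|^4dx\right)^{1/4},$$ where $$B=\Big\{x\in\mathbb R^3:\ |x_1|\le 1,\ |x_2|\le 1,\ |x_3|\le \frac1{\eta L\sqrt K}\Big\}.$$ Then for every $\epsilon>0$ there is a constant $M>0$, depending only on $\epsilon,c,C$, such that for all such $K,L,\eta$ and $a$ $$G_4(a)\le M\,K^{\frac12+\epsilon}L^{\frac12}.$$ This is essentially sharp: there is a constant $m>0$, depending only on $c,C$, such that for all such $K,L,\eta$, when all $a_{kl}=1$, $$G_4(a)\ge m\,K^{\frac12}L^{\frac12}.$$ -/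

import Mathlib

open MeasureTheory

noncomputable section

namespace FirstSpacing

/-- `e(x) = exp(2 π i x)`. -/
def e (x : ℝ) : ℂ := Complex.exp (2 * Real.pi * Complex.I * x)

/-- The natural numbers `n` with `c N ≤ n ≤ C N`, i.e. `n ∼ N` with implicit constants `c`, `C`. -/
def sim (c C : ℝ) (N : ℕ) : Finset ℕ := Finset.Icc ⌈c * N⌉₊ ⌊C * N⌋₊

theorem mem_sim {c C : ℝ} (hC : 0 ≤ C) {N n : ℕ} :
    n ∈ sim c C N ↔ c * N ≤ n ∧ (n : ℝ) ≤ C * N := by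
  rw [sim, Finset.mem_Icc, Nat.ceil_le, Nat.le_floor_iff (by positivity)]

/-- The averaged norm `(|B|⁻¹ ∫_B |f|^p)^(1/p)` over a subset `B` of `ℝ³` with Lebesgue measure. -/
def avgNorm (p : ℝ) (B : Set (ℝ × ℝ × ℝ)) (f : ℝ × ℝ × ℝ → ℂ) : ℝ :=
  (⨍ x in B, ‖f x‖ ^ p) ^ (1 / p)

/-- The box `|x₁| ≤ A₁`, `|x₂| ≤ A₂`, `|x₃| ≤ A₃`. -/
def box (A₁ A₂ A₃ : ℝ) : Set (ℝ × ℝ × ℝ) :=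
  {x | |x.1| ≤ A₁ ∧ |x.2.1| ≤ A₂ ∧ |x.2.2| ≤ A₃}

/-- The exponential sum `∑_{k ∼ K} ∑_{l ∼ L} a_{kl} e(l x₁ + k l x₂ + l √k x₃)`. -/
def expSum (c C : ℝ) (K L : ℕ) (a : ℕ → ℕ → ℂ) (x : ℝ × ℝ × ℝ) : ℂ :=
  ∑ k ∈ sim c C K, ∑ l ∈ sim c C L,
    a k l * e (l * x.1 + k * l * x.2.1 + l * √(k : ℝ) * x.2.2)

/-- The first-spacing mean value `G_q`. -/
def G (q c C : ℝ) (K L : ℕ) (η : ℝ) (a : ℕ → ℕ → ℂ) : ℝ :=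
  avgNorm q (box 1 1 (1 / (η * L * √(K : ℝ)))) (expSum c C K L a)

/-- The standing relations `1 ≤ L < K ≤ 1/η ≤ K L` with `η > 0`. -/
def Admissible (K L : ℕ) (η : ℝ) : Prop :=
  0 < η ∧ 1 ≤ L ∧ L < K ∧ (K : ℝ) ≤ 1 / η ∧ 1 / η ≤ (K : ℝ) * L

end FirstSpacing

end

noncomputable section
namespace FirstSpacing

lemma card_divisors_le_rpow {ε : ℝ} (hε : 0 < ε) :
    ∃ C : ℝ, 1 ≤ C ∧ ∀ n : ℕ, 1 ≤ n → (n.divisors.card : ℝ) ≤ C * (n : ℝ) ^ ε := by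
  have hl2 : 0 < Real.log 2 := Real.log_pos one_lt_two
  set D : ℝ := 1 + 1 / (ε * Real.log 2) with hD
  have hD1 : 1 ≤ D := by rw [hD]; have : 0 < 1 / (ε * Real.log 2) := by positivity
                         linarith
  set P : ℕ := ⌈(2 : ℝ) ^ (1 / ε)⌉₊ with hP
  refine ⟨D ^ P, one_le_pow₀ hD1, fun n hn => ?_⟩
  have hn0 : n ≠ 0 := by omega
  have key : ∀ p ∈ n.primeFactors, ((n.factorization p + 1 : ℕ) : ℝ) ≤
      (if p < P then D else 1) * ((p : ℝ) ^ n.factorization p) ^ ε := by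
    intro p hp
    have hp2 : 2 ≤ p := (Nat.prime_of_mem_primeFactors hp).two_le
    have hp2' : (2 : ℝ) ≤ p := by exact_mod_cast hp2
    set v := n.factorization p
    rw [← Real.rpow_natCast, ← Real.rpow_mul (by positivity), mul_comm (v : ℝ) ε]
    split_ifs with h
    · have h1 : (2 : ℝ) ^ (ε * v) ≤ (p : ℝ) ^ (ε * v) :=
        Real.rpow_le_rpow (by norm_num) hp2' (by positivity)
      have h2 : 1 + ε * v * Real.log 2 ≤ (2 : ℝ) ^ (ε * v) := by
        rw [Real.rpow_def_of_pos (by norm_num)]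
        have := Real.add_one_le_exp (Real.log 2 * (ε * v))
        linarith
      have h3 : D * (1 + ε * v * Real.log 2) = 1 + v + (ε * v * Real.log 2)
          + 1 / (ε * Real.log 2) := by
        rw [hD]; field_simp; ring
      have h4 : 0 ≤ ε * v * Real.log 2 := by positivity
      have h5 : 0 < 1 / (ε * Real.log 2) := by positivity
      push_cast
      nlinarith [mul_le_mul_of_nonneg_left (h2.trans h1) (by linarith : 0 ≤ D)]
    · have hPp : (2 : ℝ) ^ (1 / ε) ≤ p := by
        calc (2 : ℝ) ^ (1 / ε) ≤ P := Nat.le_ceil _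
          _ ≤ p := by exact_mod_cast not_lt.mp h
      have h1 : (2 : ℝ) ≤ (p : ℝ) ^ ε := by
        calc (2 : ℝ) = ((2 : ℝ) ^ (1 / ε)) ^ ε := by
              rw [← Real.rpow_mul (by norm_num), one_div_mul_cancel hε.ne', Real.rpow_one]
          _ ≤ _ := Real.rpow_le_rpow (by positivity) hPp hε.le
      rw [one_mul, Real.rpow_mul (by positivity), Real.rpow_natCast]
      calc ((v + 1 : ℕ) : ℝ) ≤ (2 : ℝ) ^ v := by exact_mod_cast Nat.lt_two_pow_self
        _ ≤ _ := by gcongr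
  rw [Nat.card_divisors hn0]
  push_cast
  calc ∏ p ∈ n.primeFactors, ((n.factorization p : ℝ) + 1)
      ≤ ∏ p ∈ n.primeFactors, ((if p < P then D else 1) * ((p : ℝ) ^ n.factorization p) ^ ε) := by
        apply Finset.prod_le_prod
        · intros; positivity
        · intro p hp; simpa using key p hp
    _ = (∏ p ∈ n.primeFactors, (if p < P then D else 1)) *
          (∏ p ∈ n.primeFactors, (p : ℝ) ^ n.factorization p) ^ ε := by
        rw [Finset.prod_mul_distrib, Real.finsetProd_rpow _ _ (fun i _ => by positivity)]
    _ = (∏ p ∈ n.primeFactors, (if p < P then D else 1)) * (n : ℝ) ^ ε := by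
        congr 2
        conv_rhs => rw [← Nat.prod_factorization_pow_eq_self hn0]
        rw [Finsupp.prod, Nat.support_factorization]; push_cast; rfl
    _ ≤ D ^ P * (n : ℝ) ^ ε := by
        gcongr
        rw [Finset.prod_ite, Finset.prod_const_one, mul_one, Finset.prod_const]
        apply pow_le_pow_right₀ hD1
        calc _ ≤ (Finset.range P).card := Finset.card_le_card (fun p hp => by
              simp at hp ⊢; exact hp.2)
          _ = P := Finset.card_range P

/-- `T` bounds the divisor function, the harmonic sums and the binary logarithm up to `N`. -/
structure SubpolyBound (T N : ℝ) : Prop where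
  one_le : 1 ≤ T
  divisors : ∀ n : ℕ, 1 ≤ n → (n : ℝ) ≤ N → (n.divisors.card : ℝ) ≤ T
  harmonic : ∀ n : ℕ, (n : ℝ) ≤ N → ∑ j ∈ Finset.Icc 1 n, 1 / (j : ℝ) ≤ T
  log : ∀ n : ℕ, (n : ℝ) ≤ N → (Nat.log 2 n + 1 : ℝ) ≤ T

lemma one_add_log_le {ε x : ℝ} (hε : 0 < ε) (hx : 1 ≤ x) :
    1 + Real.log x ≤ (1 + 1 / ε) * x ^ ε := by
  have h1 : Real.log x ≤ x ^ ε / ε := Real.log_le_rpow_div (by linarith) hε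
  have h2 : 1 ≤ x ^ ε := Real.one_le_rpow hx hε.le
  have : (1 + 1 / ε) * x ^ ε = x ^ ε + x ^ ε / ε := by ring
  linarith

lemma exists_subpolyBound {ε : ℝ} (hε : 0 < ε) {B : ℝ} (hB : 1 ≤ B) :
    ∃ C : ℝ, 1 ≤ C ∧ ∀ K : ℝ, 1 ≤ K → SubpolyBound (C * K ^ ε) (B * K ^ 2) := by
  obtain ⟨D, hD1, hD⟩ := card_divisors_le_rpow (half_pos hε)
  set E : ℝ := 2 * (1 + 1 / (ε / 2)) with hE
  have hE1 : 2 ≤ E := by rw [hE]; have : 0 < 1 / (ε / 2) := by positivity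
                         linarith
  have hBe : 1 ≤ B ^ (ε / 2) := Real.one_le_rpow hB (by positivity)
  have hDE : 1 ≤ D * E := by nlinarith
  have hDE' : D ≤ D * E := by nlinarith
  have hDE'' : E ≤ D * E := by nlinarith
  refine ⟨D * E * B ^ (ε / 2), by nlinarith, fun K hK => ?_⟩
  have hKe : 1 ≤ K ^ ε := Real.one_le_rpow hK hε.le
  have hN1 : 1 ≤ B * K ^ 2 := by nlinarith
  have hNe : (B * K ^ 2) ^ (ε / 2) = B ^ (ε / 2) * K ^ ε := by
    rw [Real.mul_rpow (by linarith) (by positivity), ← Real.rpow_natCast K 2,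
      ← Real.rpow_mul (by linarith)]
    congr 2; push_cast; ring
  have hBK : 1 ≤ B ^ (ε / 2) * K ^ ε := by nlinarith
  have hmono : ∀ x : ℝ, 0 ≤ x → x ≤ B * K ^ 2 → x ^ (ε / 2) ≤ B ^ (ε / 2) * K ^ ε :=
    fun x hx hxN => hNe ▸ Real.rpow_le_rpow hx hxN (by positivity)
  have hlog : ∀ n : ℕ, 1 ≤ n → (n : ℝ) ≤ B * K ^ 2 →
      2 * (1 + Real.log n) ≤ D * E * B ^ (ε / 2) * K ^ ε := by
    intro n hn hnN
    have h1 := one_add_log_le (half_pos hε) (by exact_mod_cast hn : (1 : ℝ) ≤ n)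
    have h2 := hmono n (by positivity) hnN
    calc 2 * (1 + Real.log n) ≤ E * (n : ℝ) ^ (ε / 2) := by rw [hE]; linarith
      _ ≤ E * (B ^ (ε / 2) * K ^ ε) := by gcongr
      _ ≤ D * E * (B ^ (ε / 2) * K ^ ε) := by gcongr
      _ = _ := by ring
  have hone : 1 ≤ D * E * B ^ (ε / 2) * K ^ ε := by
    rw [mul_assoc]; nlinarith
  refine ⟨hone, fun n hn hnN => ?_, fun n hnN => ?_, fun n hnN => ?_⟩
  · calc (n.divisors.card : ℝ) ≤ D * (n : ℝ) ^ (ε / 2) := hD n hn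
      _ ≤ D * (B ^ (ε / 2) * K ^ ε) := by gcongr; exact hmono n (by positivity) hnN
      _ ≤ D * E * (B ^ (ε / 2) * K ^ ε) := by gcongr
      _ = _ := by ring
  · rcases Nat.eq_zero_or_pos n with rfl | hn
    · simp; linarith
    · have h := harmonic_le_one_add_log n
      have h0 := Real.log_nonneg (by exact_mod_cast hn : (1 : ℝ) ≤ n)
      rw [harmonic_eq_sum_Icc] at h
      push_cast at h
      simp only [one_div]
      linarith [hlog n hn hnN]
  · rcases Nat.eq_zero_or_pos n with rfl | hn
    · simpa using hone
    · have h1 : (Nat.log 2 n : ℝ) * Real.log 2 ≤ Real.log n := by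
        rw [← Real.log_pow]
        apply Real.log_le_log (by positivity)
        exact_mod_cast Nat.pow_log_le_self 2 (by omega)
      have h2 := Real.log_two_gt_d9
      have h0 := Real.log_nonneg (by exact_mod_cast hn : (1 : ℝ) ≤ n)
      have h3 : (0 : ℝ) ≤ Nat.log 2 n := by positivity
      nlinarith [hlog n hn hnN]

section Tools
open Classical

lemma card_le_sum_of_fiber {α β : Type*} (s : Finset α) (f : α → β) (t : Finset β)
    (hf : ∀ x ∈ s, f x ∈ t) (n : β → ℝ)
    (hn : ∀ y ∈ t, ∀ u ⊆ s, (∀ x ∈ u, f x = y) → (u.card : ℝ) ≤ n y) :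
    (s.card : ℝ) ≤ ∑ y ∈ t, n y := by
  rw [Finset.card_eq_sum_card_fiberwise (f := f) (t := t) (fun x hx => hf x hx)]
  push_cast
  exact Finset.sum_le_sum fun y hy =>
    hn y hy _ (Finset.filter_subset _ _) fun x hx => (Finset.mem_filter.mp hx).2

lemma card_le_mul_of_fiber {α β : Type*} (s : Finset α) (f : α → β) (t : Finset β)
    (hf : ∀ x ∈ s, f x ∈ t) (n : ℝ)
    (hn : ∀ y ∈ t, ∀ u ⊆ s, (∀ x ∈ u, f x = y) → (u.card : ℝ) ≤ n) :
    (s.card : ℝ) ≤ t.card * n := by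
  simpa using card_le_sum_of_fiber s f t hf (fun _ => n) hn

lemma card_le_one_add_of_separated {α : Type*} (s : Finset α) (f : α → ℝ) {lo W σ : ℝ}
    (hσ : 0 < σ) (hW : 0 ≤ W) (hlo : ∀ x ∈ s, lo ≤ f x) (hhi : ∀ x ∈ s, f x ≤ lo + W)
    (hsep : ∀ x ∈ s, ∀ y ∈ s, x ≠ y → σ ≤ |f x - f y|) :
    (s.card : ℝ) ≤ 1 + W / σ := by
  have hmap : ∀ x ∈ s, ⌊(f x - lo) / σ⌋₊ ∈ Finset.range (⌊W / σ⌋₊ + 1) := by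
    intro x hx
    rw [Finset.mem_range, Nat.lt_succ_iff]
    apply Nat.floor_le_floor
    have := hhi x hx
    gcongr; linarith
  have hinj : Set.InjOn (fun x => ⌊(f x - lo) / σ⌋₊) (s : Set α) := by
    intro x hx y hy hxy
    by_contra hne
    have h := hsep x hx y hy hne
    have hx0 : 0 ≤ (f x - lo) / σ := div_nonneg (by linarith [hlo x hx]) hσ.le
    have hy0 : 0 ≤ (f y - lo) / σ := div_nonneg (by linarith [hlo y hy]) hσ.le
    have hxy' : (⌊(f x - lo) / σ⌋₊ : ℝ) = ⌊(f y - lo) / σ⌋₊ := by exact_mod_cast hxy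
    have h1 := Nat.floor_le hx0
    have h2 := Nat.lt_floor_add_one ((f x - lo) / σ)
    have h3 := Nat.floor_le hy0
    have h4 := Nat.lt_floor_add_one ((f y - lo) / σ)
    have h5 : |(f x - lo) / σ - (f y - lo) / σ| < 1 := by rw [abs_lt]; constructor <;> linarith
    rw [← sub_div, abs_div, abs_of_pos hσ, div_lt_one hσ] at h5
    have : f x - lo - (f y - lo) = f x - f y := by ring
    rw [this] at h5; linarith
  have hc := Finset.card_le_card_of_injOn _ hmap hinj
  rw [Finset.card_range] at hc
  have h6 := Nat.floor_le (div_nonneg hW hσ.le)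
  have : (s.card : ℝ) ≤ (⌊W / σ⌋₊ : ℝ) + 1 := by exact_mod_cast hc
  linarith

/-- The positive integers up to `x`. -/
def upTo (x : ℝ) : Finset ℤ := Finset.Icc 1 ⌊x⌋

lemma mem_upTo {x : ℝ} {n : ℤ} : n ∈ upTo x ↔ 1 ≤ n ∧ (n : ℝ) ≤ x := by
  rw [upTo, Finset.mem_Icc, Int.le_floor]

lemma card_upTo {x : ℝ} (hx : 0 ≤ x) : ((upTo x).card : ℝ) ≤ x := by
  rw [upTo, Int.card_Icc]
  have h0 : 0 ≤ ⌊x⌋ := Int.floor_nonneg.mpr hx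
  have h1 : (⌊x⌋ + 1 - 1).toNat = ⌊x⌋.toNat := by simp
  rw [h1]
  have h2 : ((⌊x⌋.toNat : ℤ) : ℝ) = (⌊x⌋ : ℝ) := by rw [Int.toNat_of_nonneg h0]
  have h3 : ((⌊x⌋.toNat : ℕ) : ℝ) = (⌊x⌋ : ℝ) := by exact_mod_cast h2
  rw [h3]; exact Int.floor_le x

lemma card_le_of_dvd {T N : ℝ} (hT : SubpolyBound T N) {α : Type*} (s : Finset α) (f : α → ℤ)
    {n : ℤ} (hn : n ≠ 0) (hnN : |(n : ℝ)| ≤ N) (hpos : ∀ x ∈ s, 0 < f x) (hdvd : ∀ x ∈ s, f x ∣ n)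
    (hinj : Set.InjOn f (s : Set α)) : (s.card : ℝ) ≤ T := by
  have h1 : (n.natAbs.divisors.card : ℝ) ≤ T := by
    apply hT.divisors
    · exact Int.natAbs_pos.mpr hn
    · rwa [Nat.cast_natAbs, Int.cast_abs]
  refine le_trans ?_ h1
  have : s.card ≤ n.natAbs.divisors.card := by
    apply Finset.card_le_card_of_injOn (fun x => (f x).natAbs)
    · intro x hx
      simp only [Finset.mem_coe, Nat.mem_divisors]
      exact ⟨Int.natAbs_dvd_natAbs.mpr (hdvd x hx), Int.natAbs_ne_zero.mpr hn⟩
    · intro x hx y hy hxy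
      apply hinj hx hy
      have hx' := hpos x hx
      have hy' := hpos y hy
      simp only at hxy
      omega
  exact_mod_cast this

lemma card_upTo_filter_dvd {x : ℝ} (hx : 0 ≤ x) {g : ℕ} (hg : 0 < g) :
    (((upTo x).filter (fun b => (g : ℤ) ∣ b)).card : ℝ) ≤ x / g := by
  have hg' : (0 : ℝ) < g := by exact_mod_cast hg
  refine le_trans ?_ (card_upTo (x := x / g) (by positivity))
  have : ((upTo x).filter (fun b => (g : ℤ) ∣ b)).card ≤ (upTo (x / g)).card := by
    apply Finset.card_le_card_of_injOn (fun b : ℤ => b / (g : ℤ))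
    · intro b hb
      simp only [Finset.coe_filter, Set.mem_ofPred_eq, mem_upTo] at hb
      obtain ⟨⟨h1, h2⟩, c, rfl⟩ := hb
      simp only [Finset.mem_coe, mem_upTo]
      rw [Int.mul_ediv_cancel_left _ (by omega)]
      constructor
      · by_contra hc
        have : (g : ℤ) * c ≤ 0 := by nlinarith
        omega
      · rw [le_div_iff₀ hg']; push_cast at h2; linarith
    · intro b hb b' hb' h
      simp only [Finset.coe_filter, Set.mem_ofPred_eq] at hb hb'
      obtain ⟨-, c, rfl⟩ := hb
      obtain ⟨-, c', rfl⟩ := hb'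
      simp only at h
      rw [Int.mul_ediv_cancel_left _ (by omega), Int.mul_ediv_cancel_left _ (by omega)] at h
      rw [h]
  exact_mod_cast this

lemma sum_gcd_le {T N : ℝ} (hT : SubpolyBound T N) {x : ℝ} (hx : 0 ≤ x) {e : ℤ} (he : e ≠ 0)
    (heN : |(e : ℝ)| ≤ N) : ∑ b ∈ upTo x, (Int.gcd e b : ℝ) ≤ x * T := by
  have h1 : (e.natAbs.divisors.card : ℝ) ≤ T := by
    apply hT.divisors
    · exact Int.natAbs_pos.mpr he
    · rwa [Nat.cast_natAbs, Int.cast_abs]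
  calc ∑ b ∈ upTo x, (Int.gcd e b : ℝ)
      ≤ ∑ b ∈ upTo x, ∑ g ∈ e.natAbs.divisors, if (g : ℤ) ∣ b then (g : ℝ) else 0 := by
        apply Finset.sum_le_sum
        intro b _
        have hm : Int.gcd e b ∈ e.natAbs.divisors := by
          rw [Nat.mem_divisors]
          refine ⟨?_, Int.natAbs_ne_zero.mpr he⟩
          exact Int.natCast_dvd.mp (Int.gcd_dvd_left e b)
        refine le_trans ?_ (Finset.single_le_sum (f := fun g : ℕ =>
          if (g : ℤ) ∣ b then (g : ℝ) else 0) (fun g _ => by split_ifs <;> positivity) hm)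
        simp only [Int.gcd_dvd_right, if_true, le_refl]
    _ = ∑ g ∈ e.natAbs.divisors, ((upTo x).filter (fun b => (g : ℤ) ∣ b)).card * (g : ℝ) := by
        rw [Finset.sum_comm]
        apply Finset.sum_congr rfl
        intro g _
        rw [← Finset.sum_filter, Finset.sum_const, nsmul_eq_mul]
    _ ≤ ∑ g ∈ e.natAbs.divisors, x := by
        apply Finset.sum_le_sum
        intro g hg
        have hg0 : 0 < g := Nat.pos_of_mem_divisors hg
        have hg' : (0 : ℝ) < g := by exact_mod_cast hg0
        have := card_upTo_filter_dvd hx hg0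
        rwa [le_div_iff₀ hg'] at this
    _ = x * e.natAbs.divisors.card := by rw [Finset.sum_const, nsmul_eq_mul, mul_comm]
    _ ≤ x * T := by gcongr

lemma sum_upTo_inv_le {T N : ℝ} (hT : SubpolyBound T N) {x : ℝ} (hx : 0 ≤ x) (hxN : x ≤ N) :
    ∑ j ∈ upTo x, 1 / (j : ℝ) ≤ T := by
  refine le_trans (le_of_eq ?_) (hT.harmonic ⌊x⌋₊ ((Nat.floor_le hx).trans hxN))
  apply Finset.sum_bij' (fun (j : ℤ) _ => j.toNat) (fun (n : ℕ) _ => (n : ℤ))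
  · intro j hj
    rw [mem_upTo] at hj
    rw [Finset.mem_Icc]
    refine ⟨by omega, Nat.le_floor ?_⟩
    have : ((j.toNat : ℤ) : ℝ) = j := by rw [Int.toNat_of_nonneg (by omega)]
    have h2 : ((j.toNat : ℕ) : ℝ) = j := by exact_mod_cast this
    rw [h2]; exact hj.2
  · intro n hn
    rw [Finset.mem_Icc] at hn
    rw [mem_upTo]
    refine ⟨by omega, ?_⟩
    have := (Nat.le_floor_iff hx).mp hn.2
    exact_mod_cast this
  · intro j hj
    rw [mem_upTo] at hj
    exact Int.toNat_of_nonneg (by omega)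
  · intro n hn; simp
  · intro j hj
    rw [mem_upTo] at hj
    have : ((j.toNat : ℤ) : ℝ) = j := by rw [Int.toNat_of_nonneg (by omega)]
    have h2 : ((j.toNat : ℕ) : ℝ) = j := by exact_mod_cast this
    rw [h2]

end Tools

/-- Eight integers `kᵢ`, `lᵢ`, indexing a term in the fourth moment. -/
@[ext] structure Quad where
  (k₁ k₂ k₃ k₄ l₁ l₂ l₃ l₄ : ℤ)

/-- A quadruple with `k ∼ R²`, `l ∼ lam` counted by the fourth moment. -/
structure Good (r R lam : ℝ) (q : Quad) : Prop where
  k₁ge : R ^ 2 ≤ r ^ 2 * q.k₁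
  k₁le : q.k₁ ≤ r ^ 2 * R ^ 2
  k₂ge : R ^ 2 ≤ r ^ 2 * q.k₂
  k₂le : q.k₂ ≤ r ^ 2 * R ^ 2
  k₃ge : R ^ 2 ≤ r ^ 2 * q.k₃
  k₃le : q.k₃ ≤ r ^ 2 * R ^ 2
  k₄ge : R ^ 2 ≤ r ^ 2 * q.k₄
  k₄le : q.k₄ ≤ r ^ 2 * R ^ 2
  l₁ge : lam ≤ r * q.l₁
  l₁le : q.l₁ ≤ r * lam
  l₂ge : lam ≤ r * q.l₂
  l₂le : q.l₂ ≤ r * lam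
  l₃ge : lam ≤ r * q.l₃
  l₃le : q.l₃ ≤ r * lam
  l₄ge : lam ≤ r * q.l₄
  l₄le : q.l₄ ≤ r * lam
  sum : q.l₁ + q.l₂ = q.l₃ + q.l₄
  mom : q.l₁ * q.k₁ + q.l₂ * q.k₂ = q.l₃ * q.k₃ + q.l₄ * q.k₄
  root : |q.l₁ * √(q.k₁ : ℝ) + q.l₂ * √(q.k₂ : ℝ) - q.l₃ * √(q.k₃ : ℝ) - q.l₄ * √(q.k₄ : ℝ)| * R
    ≤ lam

/-- The real-variable form of `Good`, with `tᵢ = √kᵢ`. -/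
structure RGood (r R lam t₁ t₂ t₃ t₄ l₁ l₂ l₃ l₄ : ℝ) : Prop where
  one_le : 1 ≤ r
  R_pos : 0 < R
  lam_pos : 0 < lam
  t₁ge : R ≤ r * t₁
  t₁le : t₁ ≤ r * R
  t₂ge : R ≤ r * t₂
  t₂le : t₂ ≤ r * R
  t₃ge : R ≤ r * t₃
  t₃le : t₃ ≤ r * R
  t₄ge : R ≤ r * t₄
  t₄le : t₄ ≤ r * R
  l₁ge : lam ≤ r * l₁
  l₁le : l₁ ≤ r * lam
  l₂ge : lam ≤ r * l₂
  l₂le : l₂ ≤ r * lam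
  l₃ge : lam ≤ r * l₃
  l₃le : l₃ ≤ r * lam
  l₄ge : lam ≤ r * l₄
  l₄le : l₄ ≤ r * lam
  sum : l₁ + l₂ = l₃ + l₄
  mom : l₁ * t₁ ^ 2 + l₂ * t₂ ^ 2 = l₃ * t₃ ^ 2 + l₄ * t₄ ^ 2
  root : |l₁ * t₁ + l₂ * t₂ - l₃ * t₃ - l₄ * t₄| * R ≤ lam

lemma pos_of_le_mul {r x y : ℝ} (hr : 1 ≤ r) (hx : 0 < x) (h : x ≤ r * y) : 0 < y := by
  by_contra hc
  nlinarith

lemma Good.rgood {r R lam : ℝ} {q : Quad} (hr : 1 ≤ r) (hR : 0 < R) (hl : 0 < lam)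
    (h : Good r R lam q) :
    RGood r R lam √(q.k₁ : ℝ) √(q.k₂ : ℝ) √(q.k₃ : ℝ) √(q.k₄ : ℝ) q.l₁ q.l₂ q.l₃ q.l₄ := by
  have hr0 : 0 ≤ r := by linarith
  have up : ∀ k : ℝ, k ≤ r ^ 2 * R ^ 2 → √k ≤ r * R := fun k hk =>
    Real.sqrt_le_iff.mpr ⟨by positivity, by linarith [mul_pow r R 2]⟩
  have lo : ∀ k : ℝ, R ^ 2 ≤ r ^ 2 * k → R ≤ r * √k := fun k hk => by
    have : √(r ^ 2 * k) = r * √k := by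
      rw [Real.sqrt_mul (by positivity), Real.sqrt_sq hr0]
    rw [← this]; exact Real.le_sqrt_of_sq_le hk
  have pos : ∀ k : ℝ, R ^ 2 ≤ r ^ 2 * k → √k ^ 2 = k := fun k hk =>
    Real.sq_sqrt (by
      by_contra hc
      have : 0 < R ^ 2 := by positivity
      nlinarith [sq_nonneg r])
  refine ⟨hr, hR, hl, lo _ h.k₁ge, up _ h.k₁le, lo _ h.k₂ge, up _ h.k₂le, lo _ h.k₃ge, up _ h.k₃le,
    lo _ h.k₄ge, up _ h.k₄le, h.l₁ge, h.l₁le, h.l₂ge, h.l₂le, h.l₃ge, h.l₃le, h.l₄ge, h.l₄le,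
    by exact_mod_cast h.sum, ?_, h.root⟩
  rw [pos _ h.k₁ge, pos _ h.k₂ge, pos _ h.k₃ge, pos _ h.k₄ge]
  exact_mod_cast h.mom

namespace RGood
variable {r R lam t₁ t₂ t₃ t₄ l₁ l₂ l₃ l₄ : ℝ}

lemma swap (h : RGood r R lam t₁ t₂ t₃ t₄ l₁ l₂ l₃ l₄) :
    RGood r R lam t₃ t₄ t₁ t₂ l₃ l₄ l₁ l₂ :=
  ⟨h.one_le, h.R_pos, h.lam_pos, h.t₃ge, h.t₃le, h.t₄ge, h.t₄le, h.t₁ge, h.t₁le, h.t₂ge, h.t₂le,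
    h.l₃ge, h.l₃le, h.l₄ge, h.l₄le, h.l₁ge, h.l₁le, h.l₂ge, h.l₂le, h.sum.symm, h.mom.symm, by
    have : l₃ * t₃ + l₄ * t₄ - l₁ * t₁ - l₂ * t₂ = -(l₁ * t₁ + l₂ * t₂ - l₃ * t₃ - l₄ * t₄) := by
      ring
    rw [this, abs_neg]; exact h.root⟩

lemma t₁pos (h : RGood r R lam t₁ t₂ t₃ t₄ l₁ l₂ l₃ l₄) : 0 < t₁ :=
  pos_of_le_mul h.one_le h.R_pos h.t₁ge
lemma t₂pos (h : RGood r R lam t₁ t₂ t₃ t₄ l₁ l₂ l₃ l₄) : 0 < t₂ :=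
  pos_of_le_mul h.one_le h.R_pos h.t₂ge
lemma t₃pos (h : RGood r R lam t₁ t₂ t₃ t₄ l₁ l₂ l₃ l₄) : 0 < t₃ :=
  pos_of_le_mul h.one_le h.R_pos h.t₃ge
lemma t₄pos (h : RGood r R lam t₁ t₂ t₃ t₄ l₁ l₂ l₃ l₄) : 0 < t₄ :=
  pos_of_le_mul h.one_le h.R_pos h.t₄ge
lemma l₁pos (h : RGood r R lam t₁ t₂ t₃ t₄ l₁ l₂ l₃ l₄) : 0 < l₁ :=
  pos_of_le_mul h.one_le h.lam_pos h.l₁ge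
lemma l₂pos (h : RGood r R lam t₁ t₂ t₃ t₄ l₁ l₂ l₃ l₄) : 0 < l₂ :=
  pos_of_le_mul h.one_le h.lam_pos h.l₂ge
lemma l₃pos (h : RGood r R lam t₁ t₂ t₃ t₄ l₁ l₂ l₃ l₄) : 0 < l₃ :=
  pos_of_le_mul h.one_le h.lam_pos h.l₃ge
lemma l₄pos (h : RGood r R lam t₁ t₂ t₃ t₄ l₁ l₂ l₃ l₄) : 0 < l₄ :=
  pos_of_le_mul h.one_le h.lam_pos h.l₄ge

lemma discr (h : RGood r R lam t₁ t₂ t₃ t₄ l₁ l₂ l₃ l₄) :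
    |l₁ * l₂ * (t₁ - t₂) ^ 2 - l₃ * l₄ * (t₃ - t₄) ^ 2| ≤ 4 * r ^ 2 * lam ^ 2 := by
  have hr := h.one_le
  have hl := h.lam_pos
  have hR := h.R_pos
  have e : l₁ * l₂ * (t₁ - t₂) ^ 2 - l₃ * l₄ * (t₃ - t₄) ^ 2 =
      -((l₁ * t₁ + l₂ * t₂ - l₃ * t₃ - l₄ * t₄) *
        (l₁ * t₁ + l₂ * t₂ + l₃ * t₃ + l₄ * t₄)) := by
    have hs : l₄ = l₁ + l₂ - l₃ := by linarith [h.sum]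
    have hm := h.mom
    rw [hs] at hm ⊢
    linear_combination (l₁ + l₂) * hm
  rw [e, abs_neg, abs_mul]
  have b : ∀ l t : ℝ, 0 < l → l ≤ r * lam → 0 < t → t ≤ r * R → l * t ≤ r ^ 2 * lam * R :=
    fun l t h1 h2 h3 h4 => by
      calc l * t ≤ (r * lam) * (r * R) := by gcongr
        _ = _ := by ring
  have p1 := mul_pos h.l₁pos h.t₁pos
  have p2 := mul_pos h.l₂pos h.t₂pos
  have p3 := mul_pos h.l₃pos h.t₃pos
  have p4 := mul_pos h.l₄pos h.t₄pos
  have hb : |l₁ * t₁ + l₂ * t₂ + l₃ * t₃ + l₄ * t₄| ≤ R * (4 * r ^ 2 * lam) := by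
    rw [abs_of_pos (by linarith)]
    linarith [b _ _ h.l₁pos h.l₁le h.t₁pos h.t₁le, b _ _ h.l₂pos h.l₂le h.t₂pos h.t₂le,
      b _ _ h.l₃pos h.l₃le h.t₃pos h.t₃le, b _ _ h.l₄pos h.l₄le h.t₄pos h.t₄le]
  calc _ ≤ |l₁ * t₁ + l₂ * t₂ - l₃ * t₃ - l₄ * t₄| * (R * (4 * r ^ 2 * lam)) := by gcongr
    _ = (|l₁ * t₁ + l₂ * t₂ - l₃ * t₃ - l₄ * t₄| * R) * (4 * r ^ 2 * lam) := by ring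
    _ ≤ lam * (4 * r ^ 2 * lam) := by gcongr; exact h.root
    _ = _ := by ring

lemma cross (h : RGood r R lam t₁ t₂ t₃ t₄ l₁ l₂ l₃ l₄) :
    |l₂ * (t₁ - t₂) * (t₂ - t₄) - l₃ * (t₁ - t₃) * (t₃ - t₄)| ≤ 2 * r * lam := by
  have hr := h.one_le
  have hl := h.lam_pos
  have hR := h.R_pos
  have e : l₂ * (t₁ - t₂) * (t₂ - t₄) - l₃ * (t₁ - t₃) * (t₃ - t₄) =
      (l₁ * t₁ + l₂ * t₂ - l₃ * t₃ - l₄ * t₄) * (t₁ + t₄) := by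
    have hs : l₄ = l₁ + l₂ - l₃ := by linarith [h.sum]
    have hm := h.mom
    rw [hs] at hm ⊢
    linear_combination -hm
  rw [e, abs_mul]
  have hb : |t₁ + t₄| ≤ R * (2 * r) := by
    rw [abs_of_pos (by linarith [h.t₁pos, h.t₄pos])]
    linarith [h.t₁le, h.t₄le]
  calc _ ≤ |l₁ * t₁ + l₂ * t₂ - l₃ * t₃ - l₄ * t₄| * (R * (2 * r)) := by gcongr
    _ = (|l₁ * t₁ + l₂ * t₂ - l₃ * t₃ - l₄ * t₄| * R) * (2 * r) := by ring
    _ ≤ lam * (2 * r) := by gcongr; exact h.root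
    _ = _ := by ring

/-- Coincidence of the weights forces the spacings `t₁ - t₃` and `t₁ - t₂` to be small. -/
lemma degenerate (h : RGood r R lam t₁ t₂ t₃ t₄ l₁ l₂ l₃ l₄) (h13 : l₁ = l₃)
    (h12 : t₂ ≤ t₁) (h34 : t₄ ≤ t₃) (h31 : t₃ ≤ t₁) :
    (t₁ ^ 2 - t₃ ^ 2) * (t₁ ^ 2 - t₂ ^ 2) ≤ 8 * r ^ 4 * R ^ 2 := by
  have hr := h.one_le
  have hl := h.lam_pos
  have hR := h.R_pos
  subst h13
  have h24 : l₂ = l₄ := by linarith [h.sum]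
  subst h24
  have hm : l₁ * (t₁ - t₃) * (t₁ + t₃) = -(l₂ * (t₂ - t₄) * (t₂ + t₄)) := by
    linear_combination h.mom
  have e : (l₁ * t₁ + l₂ * t₂ - l₁ * t₃ - l₂ * t₄) * (t₂ + t₄) =
      -(l₁ * (t₁ - t₃) * (t₁ + t₃ - t₂ - t₄)) := by linear_combination hm
  have hb : |l₁ * t₁ + l₂ * t₂ - l₁ * t₃ - l₂ * t₄| * (t₂ + t₄) ≤ 2 * r * lam := by
    calc _ ≤ |l₁ * t₁ + l₂ * t₂ - l₁ * t₃ - l₂ * t₄| * (2 * r * R) := by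
            gcongr; linarith [h.t₂le, h.t₄le]
      _ = (|l₁ * t₁ + l₂ * t₂ - l₁ * t₃ - l₂ * t₄| * R) * (2 * r) := by ring
      _ ≤ lam * (2 * r) := by gcongr; exact h.root
      _ = _ := by ring
  have p24 : 0 < t₂ + t₄ := by linarith [h.t₂pos, h.t₄pos]
  have e2 : |l₁ * t₁ + l₂ * t₂ - l₁ * t₃ - l₂ * t₄| * (t₂ + t₄) =
      l₁ * (t₁ - t₃) * (t₁ + t₃ - t₂ - t₄) := by
    have e3 := abs_mul (l₁ * t₁ + l₂ * t₂ - l₁ * t₃ - l₂ * t₄) (t₂ + t₄)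
    rw [abs_of_pos p24] at e3
    rw [← e3, e, abs_neg, abs_of_nonneg]
    apply mul_nonneg (mul_nonneg h.l₁pos.le (by linarith)) (by linarith)
  have h3 : lam * ((t₁ - t₃) * (t₁ - t₂)) ≤ lam * (2 * r ^ 2) := by
    have s1 : 0 ≤ (t₁ - t₃) * (t₁ - t₂) := mul_nonneg (by linarith) (by linarith)
    have s2 : (t₁ - t₃) * (t₁ - t₂) ≤ (t₁ - t₃) * (t₁ + t₃ - t₂ - t₄) := by
      apply mul_le_mul_of_nonneg_left (by linarith) (by linarith)
    calc lam * ((t₁ - t₃) * (t₁ - t₂)) ≤ r * l₁ * ((t₁ - t₃) * (t₁ + t₃ - t₂ - t₄)) :=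
          mul_le_mul h.l₁ge s2 s1 (mul_nonneg (by linarith) h.l₁pos.le)
      _ = r * (l₁ * (t₁ - t₃) * (t₁ + t₃ - t₂ - t₄)) := by ring
      _ ≤ r * (2 * r * lam) := by rw [← e2]; gcongr
      _ = _ := by ring
  have h4 := le_of_mul_le_mul_left h3 hl
  have hb1 : t₁ + t₃ ≤ 2 * r * R := by linarith [h.t₁le, h.t₃le]
  have hb2 : t₁ + t₂ ≤ 2 * r * R := by linarith [h.t₁le, h.t₂le]
  calc _ = ((t₁ - t₃) * (t₁ - t₂)) * ((t₁ + t₃) * (t₁ + t₂)) := by ring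
    _ ≤ (2 * r ^ 2) * ((2 * r * R) * (2 * r * R)) := by
        apply mul_le_mul h4 _ (by nlinarith [h.t₁pos, h.t₂pos, h.t₃pos]) (by positivity)
        exact mul_le_mul hb1 hb2 (by linarith [h.t₁pos, h.t₂pos]) (by positivity)
    _ = _ := by ring

lemma diff_bounds {r R x y : ℝ} (hr : 1 ≤ r) (hR : 0 < R) (hx : R ≤ r * x) (hx' : x ≤ r * R)
    (hy : R ≤ r * y) (hy' : y ≤ r * R) :
    |x ^ 2 - y ^ 2| ≤ 2 * r * R * |x - y| ∧ 2 * R * |x - y| ≤ r * |x ^ 2 - y ^ 2| := by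
  have hx0 := pos_of_le_mul hr hR hx
  have hy0 := pos_of_le_mul hr hR hy
  have e : |x ^ 2 - y ^ 2| = (x + y) * |x - y| := by
    rw [← abs_of_pos (by linarith : 0 < x + y), ← abs_mul]
    congr 1; ring
  have := abs_nonneg (x - y)
  constructor
  · rw [e]; gcongr; linarith
  · rw [e, ← mul_assoc]; exact mul_le_mul_of_nonneg_right (by linarith) this

lemma spacing_le (h : RGood r R lam t₁ t₂ t₃ t₄ l₁ l₂ l₃ l₄) (h12 : t₂ ≤ t₁) (h34 : t₄ ≤ t₃)
    (hbig : 3 * r ^ 2 ≤ max (t₁ - t₂) (t₃ - t₄)) : t₁ - t₂ ≤ 2 * r ^ 2 * (t₃ - t₄) := by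
  have hr := h.one_le
  have hl := h.lam_pos
  have hr2 : 1 ≤ r ^ 2 := one_le_pow₀ hr
  rcases le_total (t₁ - t₂) (t₃ - t₄) with hc | hc
  · nlinarith
  rw [max_eq_left hc] at hbig
  set x := t₁ - t₂
  set y := t₃ - t₄
  have hy : 0 ≤ y := by linarith
  have hd := (abs_le.mp h.discr).2
  have h1 : lam ^ 2 * x ^ 2 ≤ r ^ 2 * (l₁ * l₂ * x ^ 2) := by
    have : lam * lam ≤ (r * l₁) * (r * l₂) :=
      mul_le_mul h.l₁ge h.l₂ge hl.le (by nlinarith [h.l₁pos])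
    nlinarith [sq_nonneg x]
  have h2 : l₃ * l₄ * y ^ 2 ≤ r ^ 2 * lam ^ 2 * y ^ 2 := by
    have : l₃ * l₄ ≤ (r * lam) * (r * lam) :=
      mul_le_mul h.l₃le h.l₄le h.l₄pos.le (by positivity)
    nlinarith [sq_nonneg y]
  have h3 : lam ^ 2 * x ^ 2 ≤ lam ^ 2 * (r ^ 4 * (y ^ 2 + 4)) := by
    calc lam ^ 2 * x ^ 2 ≤ r ^ 2 * (l₁ * l₂ * x ^ 2) := h1
      _ ≤ r ^ 2 * (r ^ 2 * lam ^ 2 * y ^ 2 + 4 * r ^ 2 * lam ^ 2) := by gcongr; linarith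
      _ = _ := by ring
  have h4 := le_of_mul_le_mul_left h3 (by positivity)
  have h5 : 9 * r ^ 4 ≤ x ^ 2 := by
    calc 9 * r ^ 4 = (3 * r ^ 2) ^ 2 := by ring
      _ ≤ x ^ 2 := by gcongr
  have h6 : x ^ 2 ≤ (2 * r ^ 2 * y) ^ 2 := by nlinarith
  exact abs_le_of_sq_le_sq' h6 (by positivity) |>.2

lemma main_range (h : RGood r R lam t₁ t₂ t₃ t₄ l₁ l₂ l₃ l₄) (h12 : t₂ ≤ t₁) (h34 : t₄ ≤ t₃)
    (h31 : t₃ ≤ t₁)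
    (hbig' : 3 * r ^ 2 ≤ max (t₁ - t₂) (t₃ - t₄))
    (hbig : 3 * r ^ 2 ≤ max (t₁ - t₃) |t₂ - t₄|) :
    0 < t₁ - t₃ ∧ 0 < t₂ - t₄ ∧ t₁ - t₃ ≤ 4 * r ^ 4 * (t₂ - t₄) ∧
      t₂ - t₄ ≤ 4 * r ^ 4 * (t₁ - t₃) := by
  have hr := h.one_le
  have hl := h.lam_pos
  have hr2 : 1 ≤ r ^ 2 := one_le_pow₀ hr
  have hr4 : 1 ≤ r ^ 4 := one_le_pow₀ hr
  have d1 := h.spacing_le h12 h34 hbig'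
  have d2 := h.swap.spacing_le h34 h12 (by rwa [max_comm])
  have hc := abs_le.mp h.cross
  set x := t₁ - t₂
  set y := t₃ - t₄
  set a := t₁ - t₃
  set b := t₂ - t₄
  have ha : 0 ≤ a := by simp only [a]; linarith
  have hx : 3 / 2 ≤ x := by
    rcases max_cases x y with ⟨h1, h2⟩ | ⟨h1, h2⟩ <;> rw [h1] at hbig' <;> nlinarith
  have hy : 3 / 2 ≤ y := by
    rcases max_cases x y with ⟨h1, h2⟩ | ⟨h1, h2⟩ <;> rw [h1] at hbig' <;> nlinarith
  have q2 := h.l₂ge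
  have q2' := h.l₂le
  have q3 := h.l₃ge
  have q3' := h.l₃le
  have p2 := h.l₂pos
  have p3 := h.l₃pos
  have hrl : 0 < r * lam := by positivity
  -- comparison of `a` and `b` when both products are comparable
  have cmp : ∀ {u v m n p w : ℝ}, 0 ≤ u → 0 < p → 0 < w → lam ≤ r * m → 0 < m → n ≤ r * lam → 0 < n →
      p ≤ 2 * r ^ 2 * w → m * w * u ≤ 2 * (n * p * v) → u ≤ 4 * r ^ 4 * v := by
    intro u v m n p w hu hp hw hm hm0 hn hn0 hpw hle
    have hv : 0 ≤ v := by
      by_contra hv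
      have : n * p * v < 0 := mul_neg_of_pos_of_neg (by positivity) (by linarith)
      have : 0 ≤ m * w * u := by positivity
      linarith
    have h1 : lam * w * u ≤ lam * w * (4 * r ^ 4 * v) := by
      calc lam * w * u ≤ r * m * w * u := by gcongr
        _ = r * (m * w * u) := by ring
        _ ≤ r * (2 * (n * p * v)) := by gcongr
        _ ≤ r * (2 * ((r * lam) * (2 * r ^ 2 * w) * v)) := by gcongr
        _ = _ := by ring
    exact le_of_mul_le_mul_left h1 (by positivity)
  rcases le_total |b| a with hab | hab
  · rw [max_eq_left hab] at hbig
    have h1 : 4 * r * lam ≤ l₃ * a * y := by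
      have : lam * (3 * r ^ 2) * (3 / 2) ≤ r * l₃ * a * y := by gcongr
      have : r * (4 * r * lam) ≤ r * (l₃ * a * y) := by nlinarith
      exact le_of_mul_le_mul_left this (by linarith)
    have h2 : l₃ * y * a ≤ 2 * (l₂ * x * b) := by nlinarith [hc.1, hc.2]
    have r1 := cmp ha (by linarith) (by linarith) q3 p3 q2' p2 d1 h2
    have hb : 0 < b := by
      by_contra hb
      nlinarith
    have : b ≤ a := (le_abs_self b).trans hab
    exact ⟨by linarith, hb, r1, this.trans (le_mul_of_one_le_left ha (by linarith))⟩
  · rw [max_eq_right hab] at hbig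
    have h1 : 4 * r * lam ≤ l₂ * |b| * x := by
      have : lam * (3 * r ^ 2) * (3 / 2) ≤ r * l₂ * |b| * x := by gcongr
      have : r * (4 * r * lam) ≤ r * (l₂ * |b| * x) := by nlinarith
      exact le_of_mul_le_mul_left this (by linarith)
    have hay : 0 ≤ l₃ * a * y := by positivity
    have hb : 0 < b := by
      by_contra hb
      rw [abs_of_nonpos (by linarith)] at h1
      nlinarith [hc.1, hc.2]
    rw [abs_of_pos hb] at h1 hab
    have h2 : l₂ * x * b ≤ 2 * (l₃ * y * a) := by nlinarith [hc.1, hc.2]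
    have r1 := cmp hb.le (by linarith) (by linarith) q2 p2 q3' p3 d2 h2
    refine ⟨pos_of_mul_pos_right (hb.trans_le r1) (by positivity), hb,
      hab.trans (le_mul_of_one_le_left hb.le (by linarith)), r1⟩

end RGood

/-- Spacings of size `H` between the two nodes of a pair and of size `A` between the pairs. -/
structure Box (r R lam κ H A : ℝ) (q : Quad) : Prop extends Good r R lam q where
  k₁₂ge : H ≤ κ * (q.k₁ - q.k₂)
  k₁₂le : q.k₁ - q.k₂ ≤ κ * H
  k₃₄ge : H ≤ κ * (q.k₃ - q.k₄)
  k₃₄le : q.k₃ - q.k₄ ≤ κ * H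
  k₁₄ge : H ≤ κ * (q.k₁ - q.k₄)
  k₁₄le : q.k₁ - q.k₄ ≤ κ * H
  k₁₃ge : A ≤ κ * (q.k₁ - q.k₃)
  k₁₃le : q.k₁ - q.k₃ ≤ κ * A
  k₂₄ge : A ≤ κ * (q.k₂ - q.k₄)
  k₂₄le : q.k₂ - q.k₄ ≤ κ * A

/-- The weights are coprime (in Bézout form). -/
def Quad.Primitive (q : Quad) : Prop :=
  ∃ c₁ c₂ c₃ c₄ : ℤ, c₁ * q.l₁ + c₂ * q.l₂ + c₃ * q.l₃ + c₄ * q.l₄ = 1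

lemma Good.node_rel {r R lam : ℝ} {q : Quad} (h : Good r R lam q) :
    (q.l₁ - q.l₃) * (q.k₁ - q.k₄) = -(q.l₃ * (q.k₁ - q.k₃) + q.l₂ * (q.k₂ - q.k₄)) := by
  linear_combination h.mom - q.k₄ * h.sum

lemma Good.weight_rel {r R lam : ℝ} {q : Quad} (h : Good r R lam q) :
    q.l₃ * (q.k₃ - q.k₄) - q.l₁ * (q.k₁ - q.k₂) = (q.l₁ + q.l₂) * (q.k₂ - q.k₄) := by
  linear_combination -h.mom + q.k₄ * h.sum

lemma int_pos_of_le_mul {r x : ℝ} {y : ℤ} (hr : 1 ≤ r) (hx : 0 < x) (h : x ≤ r * y) : 0 < y := by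
  exact_mod_cast pos_of_le_mul hr hx h

lemma one_le_of_le_sq_mul {r R : ℝ} {k : ℤ} (hr : 1 ≤ r) (hR : 0 < R) (h : R ^ 2 ≤ r ^ 2 * k) :
    1 ≤ k := int_pos_of_le_mul (one_le_pow₀ hr) (by positivity) h

/-- Two primitive weight vectors on the same nodes have well separated slopes. -/
lemma primitive_separated {r R lam : ℝ} {q q' : Quad} (h : Good r R lam q) (h' : Good r R lam q')
    (hp : q.Primitive) (hp' : q'.Primitive) (hl : 0 < q.l₃) (hl' : 0 < q'.l₃)
    (e1 : q.k₁ = q'.k₁) (e2 : q.k₂ = q'.k₂) (e3 : q.k₃ = q'.k₃) (e4 : q.k₄ = q'.k₄)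
    (he : 0 < q.k₁ - q.k₄) (hne : q ≠ q') :
    q.k₁ - q.k₄ ≤ |q.l₂ * q'.l₃ - q'.l₂ * q.l₃| * (Int.gcd (q.k₁ - q.k₄) (q.k₂ - q.k₄)) := by
  have hn := h.node_rel
  have hn' := h'.node_rel
  rw [← e1, ← e2, ← e3, ← e4] at hn'
  set e := q.k₁ - q.k₄
  set b := q.k₂ - q.k₄
  set a := q.k₁ - q.k₃
  have hD : q.l₂ * q'.l₃ - q'.l₂ * q.l₃ ≠ 0 := by
    intro hD
    have p1 : q.l₁ * q'.l₃ = q'.l₁ * q.l₃ := by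
      apply mul_left_cancel₀ he.ne'
      linear_combination q'.l₃ * hn - q.l₃ * hn' - b * hD
    have p2 : q.l₂ * q'.l₃ = q'.l₂ * q.l₃ := by linarith
    have p4 : q.l₄ * q'.l₃ = q'.l₄ * q.l₃ := by
      linear_combination p1 + p2 - q'.l₃ * h.sum + q.l₃ * h'.sum
    obtain ⟨c1, c2, c3, c4, hc⟩ := hp
    obtain ⟨d1, d2, d3, d4, hd⟩ := hp'
    have dv : q.l₃ ∣ q'.l₃ := ⟨c1 * q'.l₁ + c2 * q'.l₂ + c3 * q'.l₃ + c4 * q'.l₄, by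
      linear_combination -q'.l₃ * hc + c1 * p1 + c2 * p2 + c4 * p4⟩
    have dv' : q'.l₃ ∣ q.l₃ := ⟨d1 * q.l₁ + d2 * q.l₂ + d3 * q.l₃ + d4 * q.l₄, by
      linear_combination -q.l₃ * hd - d1 * p1 - d2 * p2 - d4 * p4⟩
    have e3' : q.l₃ = q'.l₃ := Int.dvd_antisymm hl.le hl'.le dv dv'
    rw [← e3'] at p1 p2 p4
    have p1' := mul_right_cancel₀ hl.ne' p1
    have p2' := mul_right_cancel₀ hl.ne' p2
    have p4' := mul_right_cancel₀ hl.ne' p4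
    exact hne (Quad.ext e1 e2 e3 e4 p1' p2' e3' p4')
  have hdvd : e ∣ (q.l₂ * q'.l₃ - q'.l₂ * q.l₃) * (Int.gcd e b) := by
    have h1 : e ∣ (q.l₂ * q'.l₃ - q'.l₂ * q.l₃) * b :=
      ⟨-((q.l₁ - q.l₃) * q'.l₃) + (q'.l₁ - q'.l₃) * q.l₃, by
        linear_combination q'.l₃ * hn - q.l₃ * hn'⟩
    rw [Int.gcd_eq_gcd_ab, mul_add]
    exact dvd_add (Dvd.intro _ (by ring : e * ((q.l₂ * q'.l₃ - q'.l₂ * q.l₃) * e.gcdA b) = _))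
      (by rw [← mul_assoc]; exact Dvd.dvd.mul_right h1 _)
  have hg : (0 : ℤ) < Int.gcd e b := by exact_mod_cast Int.gcd_pos_of_ne_zero_left _ he.ne'
  have := Int.le_of_dvd (by positivity) ((dvd_abs _ _).mpr hdvd)
  rwa [abs_mul, abs_of_pos hg] at this

lemma slope_bound {r R lam κ H A : ℝ} {q : Quad} (hr : 1 ≤ r) (hR : 0 < R) (hl : 0 < lam)
    (hκ : 1 ≤ κ) (hH : 0 < H) (hA : 0 < A) (h : Box r R lam κ H A q) :
    |(q.l₂ : ℝ) / q.l₃ - (√(q.k₁ : ℝ) - √(q.k₃ : ℝ)) * (√(q.k₃ : ℝ) - √(q.k₄ : ℝ)) /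
      ((√(q.k₁ : ℝ) - √(q.k₂ : ℝ)) * (√(q.k₂ : ℝ) - √(q.k₄ : ℝ)))|
      ≤ 8 * r ^ 4 * κ ^ 2 * R ^ 2 / (H * A) := by
  have g := h.toGood.rgood hr hR hl
  have sq : ∀ k : ℤ, R ^ 2 ≤ r ^ 2 * k → √(k : ℝ) ^ 2 = k := fun k hk =>
    Real.sq_sqrt (by exact_mod_cast (one_le_of_le_sq_mul hr hR hk).trans' zero_le_one)
  have s1 := sq _ h.k₁ge
  have s2 := sq _ h.k₂ge
  have s3 := sq _ h.k₃ge
  have s4 := sq _ h.k₄ge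
  have c := g.cross
  set t₁ := √(q.k₁ : ℝ)
  set t₂ := √(q.k₂ : ℝ)
  set t₃ := √(q.k₃ : ℝ)
  set t₄ := √(q.k₄ : ℝ)
  have hκ0 : 0 < κ := by linarith
  have hr0 : 0 < r := by linarith
  have gap : ∀ {x y B : ℝ}, 0 < x → 0 < y → x ≤ r * R → y ≤ r * R → 0 < B →
      B ≤ κ * (x ^ 2 - y ^ 2) → B / (2 * r * κ * R) ≤ x - y := by
    intro x y B hx hy hx' hy' hB hle
    have hpos : 0 < x - y := by
      by_contra hc
      have : κ * (x ^ 2 - y ^ 2) ≤ 0 := by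
        apply mul_nonpos_of_nonneg_of_nonpos hκ0.le; nlinarith
      linarith
    rw [div_le_iff₀ (by positivity)]
    calc B ≤ κ * (x ^ 2 - y ^ 2) := hle
      _ = κ * ((x - y) * (x + y)) := by ring
      _ ≤ κ * ((x - y) * (2 * r * R)) := by gcongr; linarith
      _ = _ := by ring
  have g1 : H / (2 * r * κ * R) ≤ t₁ - t₂ :=
    gap g.t₁pos g.t₂pos g.t₁le g.t₂le hH (by rw [s1, s2]; exact h.k₁₂ge)
  have g2 : A / (2 * r * κ * R) ≤ t₂ - t₄ :=
    gap g.t₂pos g.t₄pos g.t₂le g.t₄le hA (by rw [s2, s4]; exact h.k₂₄ge)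
  have p1 : 0 < t₁ - t₂ := lt_of_lt_of_le (by positivity) g1
  have p2 : 0 < t₂ - t₄ := lt_of_lt_of_le (by positivity) g2
  have hX : H * A / (4 * r ^ 2 * κ ^ 2 * R ^ 2) ≤ (t₁ - t₂) * (t₂ - t₄) := by
    calc _ = (H / (2 * r * κ * R)) * (A / (2 * r * κ * R)) := by field_simp; ring
      _ ≤ _ := by gcongr
  set X := (t₁ - t₂) * (t₂ - t₄)
  have hX0 : 0 < X := mul_pos p1 p2
  have hl3 := g.l₃pos
  have e : (q.l₂ : ℝ) / q.l₃ - (t₁ - t₃) * (t₃ - t₄) / X =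
      (q.l₂ * (t₁ - t₂) * (t₂ - t₄) - q.l₃ * (t₁ - t₃) * (t₃ - t₄)) / (q.l₃ * X) := by
    field_simp
    simp only [X]; ring
  rw [e, abs_div, abs_of_pos (by positivity : 0 < q.l₃ * X), div_le_iff₀ (by positivity)]
  refine c.trans ?_
  calc 2 * r * lam ≤ 2 * r * (r * q.l₃) := by gcongr; exact g.l₃ge
    _ = 8 * r ^ 4 * κ ^ 2 * R ^ 2 / (H * A) * (q.l₃ * (H * A / (4 * r ^ 2 * κ ^ 2 * R ^ 2))) := by
        field_simp; ring
    _ ≤ _ := by gcongr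

section
open Classical

/-- Counting primitive weights node by node. -/
lemma card_le_of_fixed_nodes {r R lam κ H A T N : ℝ} (hr : 1 ≤ r) (hR : 0 < R) (hl : 0 < lam)
    (hκ : 1 ≤ κ) (hH : 0 < H) (hA : 0 < A) (hT : SubpolyBound T N) (hN : κ * H ≤ N)
    (hAH : A ≤ κ * H) (hHR : H ≤ κ * R ^ 2) (hAl : A ≤ lam)
    (s : Finset Quad) (hs : ∀ q ∈ s, Box r R lam κ H A q ∧ q.Primitive) :
    (s.card : ℝ) ≤ 17 * r ^ 8 * κ ^ 7 * T * R ^ 4 * lam ^ 2 := by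
  have hκ0 : 0 < κ := by linarith
  have hr0 : 0 < r := by linarith
  have hT1 := hT.one_le
  set c : ℝ := 16 * r ^ 6 * κ ^ 3 * R ^ 2 * lam ^ 2 / (H ^ 2 * A) with hc
  have hc0 : 0 ≤ c := by positivity
  have posE : ∀ {q}, Box r R lam κ H A q → 0 < q.k₁ - q.k₄ := fun {q} h =>
    int_pos_of_le_mul hκ hH (by push_cast; exact h.k₁₄ge)
  have key := card_le_sum_of_fiber s
    (fun q => (q.k₄, q.k₁ - q.k₃, q.k₁ - q.k₄, q.k₂ - q.k₄))
    (upTo (r ^ 2 * R ^ 2) ×ˢ upTo (κ * A) ×ˢ upTo (κ * H) ×ˢ upTo (κ * A))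
    (fun q hq => by
      have h := (hs q hq).1
      simp only [Finset.mem_product, mem_upTo]
      push_cast
      exact ⟨⟨one_le_of_le_sq_mul hr hR h.k₄ge, h.k₄le⟩,
        ⟨int_pos_of_le_mul hκ hA (by push_cast; exact h.k₁₃ge), h.k₁₃le⟩,
        ⟨posE h, h.k₁₄le⟩,
        ⟨int_pos_of_le_mul hκ hA (by push_cast; exact h.k₂₄ge), h.k₂₄le⟩⟩)
    (fun y => 1 + c * (Int.gcd y.2.2.1 y.2.2.2 : ℝ))
    (by
      rintro ⟨k, a, e, b⟩ - u hus hu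
      rcases Finset.eq_empty_or_nonempty u with rfl | ⟨q₀, hq₀⟩
      · simp; positivity
      have mem : ∀ {q}, q ∈ u →
          q ∈ s ∧ q.k₄ = k ∧ q.k₁ - q.k₃ = a ∧ q.k₁ - q.k₄ = e ∧ q.k₂ - q.k₄ = b := by
        intro q hq
        simpa only [Prod.mk.injEq] using (⟨hus hq, hu q hq⟩ : q ∈ s ∧ _)
      obtain ⟨hs0, f1, f2, f3, f4⟩ := mem hq₀
      have hb0 := (hs _ hs0).1
      have he : 0 < e := f3 ▸ posE hb0
      have hg : (0 : ℝ) < (Int.gcd e b : ℝ) := by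
        exact_mod_cast Int.gcd_pos_of_ne_zero_left _ he.ne'
      have heH : H ≤ κ * e := by
        have := hb0.k₁₄ge
        rw [← f3]; push_cast; exact this
      have eq : ∀ {q}, q ∈ u →
          q.k₁ = q₀.k₁ ∧ q.k₂ = q₀.k₂ ∧ q.k₃ = q₀.k₃ ∧ q.k₄ = q₀.k₄ := by
        intro q hq
        obtain ⟨-, g1, g2, g3, g4⟩ := mem hq
        refine ⟨?_, ?_, ?_, ?_⟩ <;> omega
      set w := 8 * r ^ 4 * κ ^ 2 * R ^ 2 / (H * A) with hw
      have hw0 : 0 ≤ w := by positivity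
      set z := (√(q₀.k₁ : ℝ) - √(q₀.k₃ : ℝ)) * (√(q₀.k₃ : ℝ) - √(q₀.k₄ : ℝ)) /
        ((√(q₀.k₁ : ℝ) - √(q₀.k₂ : ℝ)) * (√(q₀.k₂ : ℝ) - √(q₀.k₄ : ℝ)))
      have sl : ∀ {q}, q ∈ u →
          |(q.l₂ : ℝ) / q.l₃ - z| ≤ w := by
        intro q hq
        have := slope_bound hr hR hl hκ hH hA (hs q (mem hq).1).1
        obtain ⟨g1, g2, g3, g4⟩ := eq hq
        rwa [g1, g2, g3, g4] at this
      have hσ : 0 < H / (κ * (Int.gcd e b : ℝ) * (r ^ 2 * lam ^ 2)) := by positivity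
      have := card_le_one_add_of_separated u
        (fun q => (q.l₂ : ℝ) / q.l₃) (lo := z - w) (W := 2 * w) hσ (by positivity)
        (fun q hq => by linarith [(abs_le.mp (sl hq)).1])
        (fun q hq => by linarith [(abs_le.mp (sl hq)).2])
        (by
          intro q hq q' hq' hne
          have hB := (hs q (mem hq).1)
          have hB' := (hs q' (mem hq').1)
          have G := hB.1.toGood.rgood hr hR hl
          have G' := hB'.1.toGood.rgood hr hR hl
          obtain ⟨g1, g2, g3, g4⟩ := eq hq
          obtain ⟨g1', g2', g3', g4'⟩ := eq hq'
          have sep := primitive_separated hB.1.toGood hB'.1.toGood hB.2 hB'.2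
            (by exact_mod_cast G.l₃pos) (by exact_mod_cast G'.l₃pos)
            (g1.trans g1'.symm) (g2.trans g2'.symm) (g3.trans g3'.symm) (g4.trans g4'.symm)
            (posE hB.1) hne
          obtain ⟨-, -, -, i3, i4⟩ := mem hq
          rw [i3, i4] at sep
          have sep' : (e : ℝ) ≤ |(q.l₂ : ℝ) * q'.l₃ - q'.l₂ * q.l₃| * (Int.gcd e b : ℝ) := by
            exact_mod_cast sep
          have h3 := G.l₃pos
          have h3' := G'.l₃pos
          have e1 : (q.l₂ : ℝ) / q.l₃ - q'.l₂ / q'.l₃ =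
              (q.l₂ * q'.l₃ - q'.l₂ * q.l₃) / (q.l₃ * q'.l₃) := by
            field_simp
          rw [e1, abs_div, abs_of_pos (by positivity : (0 : ℝ) < q.l₃ * q'.l₃),
            div_le_div_iff₀ (by positivity) (by positivity)]
          calc H * (q.l₃ * q'.l₃) ≤ (κ * e) * ((r * lam) * (r * lam)) := by
                gcongr
                · exact G.l₃le
                · exact G'.l₃le
            _ ≤ (κ * (|(q.l₂ : ℝ) * q'.l₃ - q'.l₂ * q.l₃| * (Int.gcd e b : ℝ))) *
                ((r * lam) * (r * lam)) := by gcongr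
            _ = _ := by ring)
      refine this.trans (le_of_eq ?_)
      simp only [hc, hw]
      field_simp
      ring)
  refine key.trans ?_
  simp only [Finset.sum_product]
  have hup : ((upTo (r ^ 2 * R ^ 2)).card : ℝ) ≤ r ^ 2 * R ^ 2 := card_upTo (by positivity)
  have hupA : ((upTo (κ * A)).card : ℝ) ≤ κ * A := card_upTo (by positivity)
  have hupH : ((upTo (κ * H)).card : ℝ) ≤ κ * H := card_upTo (by positivity)
  have inner : ∀ e ∈ upTo (κ * H), ∑ b ∈ upTo (κ * A), (1 + c * (Int.gcd e b : ℝ)) ≤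
      κ * A * (1 + c * T) := by
    intro e he
    rw [mem_upTo] at he
    have he0 : (1 : ℝ) ≤ e := by exact_mod_cast he.1
    rw [Finset.sum_add_distrib, ← Finset.mul_sum]
    have := sum_gcd_le hT (x := κ * A) (by positivity) (e := e) (by omega)
      (by rw [abs_of_pos (by linarith)]; linarith [he.2])
    simp only [Finset.sum_const, nsmul_eq_mul, mul_one]
    calc _ ≤ κ * A + c * (κ * A * T) := by gcongr
      _ = _ := by ring
  calc _ ≤ ∑ _x ∈ upTo (r ^ 2 * R ^ 2), ∑ _a ∈ upTo (κ * A), ∑ _e ∈ upTo (κ * H),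
        κ * A * (1 + c * T) := by
        gcongr with x _ a _ e he
        exact inner e he
    _ = ((upTo (r ^ 2 * R ^ 2)).card : ℝ) * (((upTo (κ * A)).card : ℝ) *
          (((upTo (κ * H)).card : ℝ) * (κ * A * (1 + c * T)))) := by
        simp only [Finset.sum_const, nsmul_eq_mul]
    _ ≤ (r ^ 2 * R ^ 2) * ((κ * A) * ((κ * H) * (κ * A * (1 + c * T)))) := by
        have : 0 ≤ κ * A * (1 + c * T) := by positivity
        gcongr
    _ = r ^ 2 * κ ^ 3 * R ^ 2 * H * A ^ 2 + 16 * r ^ 8 * κ ^ 6 * T * R ^ 4 * lam ^ 2 * (A / H) := by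
        rw [hc]; field_simp
    _ ≤ r ^ 2 * κ ^ 3 * R ^ 2 * (κ * R ^ 2) * lam ^ 2 +
          16 * r ^ 8 * κ ^ 6 * T * R ^ 4 * lam ^ 2 * κ := by
        gcongr
        rwa [div_le_iff₀ hH]
    _ = (1 * r ^ 2 * κ ^ 4 * 1 + 16 * r ^ 8 * κ ^ 7 * T) * (R ^ 4 * lam ^ 2) := by ring
    _ ≤ (1 * r ^ 8 * κ ^ 7 * T + 16 * r ^ 8 * κ ^ 7 * T) * (R ^ 4 * lam ^ 2) := by
        gcongr <;> first | assumption | norm_num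
    _ = _ := by ring

end

/-- The weights and the relative positions of a quadruple, forgetting its translation. -/
@[ext] structure Six where
  (l₁ l₃ S d d' b : ℤ)

structure SixGood (r lam κ H M : ℝ) (p : Six) : Prop where
  l₁ge : lam ≤ r * p.l₁
  l₁le : p.l₁ ≤ r * lam
  l₃ge : lam ≤ r * p.l₃
  l₃le : p.l₃ ≤ r * lam
  l₂ge : lam ≤ r * (p.S - p.l₁)
  l₄ge : lam ≤ r * (p.S - p.l₃)
  S_le : p.S ≤ 2 * r * lam
  dge : H ≤ κ * p.d
  dle : p.d ≤ κ * H
  d'ge : H ≤ κ * p.d'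
  d'le : p.d' ≤ κ * H
  b_pos : 0 < p.b
  rel : p.l₃ * p.d' - p.l₁ * p.d = p.S * p.b
  discr : |(p.l₁ * (p.S - p.l₁) * p.d ^ 2 - p.l₃ * (p.S - p.l₃) * p.d' ^ 2 : ℝ)| ≤ M

/-- The greatest common divisor of the relative positions. -/
def Six.content (p : Six) : ℕ := Int.gcd (Int.gcd p.d p.d') p.b

namespace Six

lemma content_dvd (p : Six) : (p.content : ℤ) ∣ p.d ∧ (p.content : ℤ) ∣ p.d' ∧
    (p.content : ℤ) ∣ p.b :=
  ⟨(Int.gcd_dvd_left _ _).trans (Int.gcd_dvd_left _ _),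
    (Int.gcd_dvd_left _ _).trans (Int.gcd_dvd_right _ _), Int.gcd_dvd_right _ _⟩

lemma content_bezout (p : Six) : ∃ c₁ c₂ c₃ : ℤ,
    (p.content : ℤ) = c₁ * p.d + c₂ * p.d' + c₃ * p.b :=
  ⟨p.d.gcdA p.d' * Int.gcdA (Int.gcd p.d p.d') p.b,
    p.d.gcdB p.d' * Int.gcdA (Int.gcd p.d p.d') p.b, Int.gcdB (Int.gcd p.d p.d') p.b, by
      rw [content, Int.gcd_eq_gcd_ab]
      nth_rw 1 [Int.gcd_eq_gcd_ab p.d p.d']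
      ring⟩

end Six

namespace SixGood
variable {r lam κ H M : ℝ}

lemma S_pos {p : Six} (hr : 1 ≤ r) (hl : 0 < lam) (h : SixGood r lam κ H M p) : 0 < p.S := by
  have h1 : 0 < p.l₁ := int_pos_of_le_mul hr hl h.l₁ge
  have h2 : 0 < p.S - p.l₁ := int_pos_of_le_mul hr hl (by push_cast; exact h.l₂ge)
  omega

lemma separated {p p' : Six} {j : ℕ} (h : SixGood r lam κ H M p) (h' : SixGood r lam κ H M p')
    (hr : 1 ≤ r) (hl : 0 < lam) (hd : 0 < p.d) (hd' : 0 < p'.d)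
    (e1 : p.l₁ = p'.l₁) (e3 : p.l₃ = p'.l₃) (eS : p.S = p'.S)
    (hj : p.content = j) (hj' : p'.content = j) (hne : p ≠ p') :
    (j : ℤ) ^ 2 * p.S ≤ |p.d * p'.d' - p'.d * p.d'| * Int.gcd p.S p.l₁ := by
  have hS := h.S_pos hr hl
  obtain ⟨⟨x, hx⟩, ⟨y, hy⟩, ⟨z, hz⟩⟩ := p.content_dvd
  obtain ⟨⟨x', hx'⟩, ⟨y', hy'⟩, ⟨z', hz'⟩⟩ := p'.content_dvd
  obtain ⟨c1, c2, c3, hc⟩ := p.content_bezout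
  obtain ⟨d1, d2, d3, hd'c⟩ := p'.content_bezout
  rw [hj] at hx hy hz hc
  rw [hj'] at hx' hy' hz' hd'c
  have hj0 : (j : ℤ) ≠ 0 := by
    rintro h0; rw [h0] at hx; simp at hx; omega
  have R := h.rel
  have R' := h'.rel
  rw [hx, hy, hz] at R hc
  rw [hx', hy', hz', ← e1, ← e3, ← eS] at R'
  rw [hx', hy', hz'] at hd'c
  have r1 : p.l₃ * y - p.l₁ * x = p.S * z := by
    apply mul_left_cancel₀ hj0; linear_combination R
  have r2 : p.l₃ * y' - p.l₁ * x' = p.S * z' := by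
    apply mul_left_cancel₀ hj0; linear_combination R'
  have b1 : c1 * x + c2 * y + c3 * z = 1 := by
    apply mul_left_cancel₀ hj0; linear_combination -hc
  have b2 : d1 * x' + d2 * y' + d3 * z' = 1 := by
    apply mul_left_cancel₀ hj0; linear_combination -hd'c
  have hjpos : (0 : ℤ) < j := by positivity
  have hx0 : 0 < x := by
    rw [hx] at hd; exact pos_of_mul_pos_right hd hjpos.le
  have hx0' : 0 < x' := by
    rw [hx'] at hd'; exact pos_of_mul_pos_right hd' hjpos.le
  have hD : x * y' - x' * y ≠ 0 := by
    intro hD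
    have pz : x * z' = x' * z := by
      apply mul_left_cancel₀ hS.ne'
      linear_combination x' * r1 - x * r2 + p.l₃ * hD
    have v1 : x ∣ x' := ⟨c1 * x' + c2 * y' + c3 * z', by
      linear_combination -x' * b1 - c2 * hD - c3 * pz⟩
    have v2 : x' ∣ x := ⟨d1 * x + d2 * y + d3 * z, by
      linear_combination -x * b2 + d2 * hD + d3 * pz⟩
    have ex : x = x' := Int.dvd_antisymm hx0.le hx0'.le v1 v2
    rw [← ex] at hD pz
    have ey : y = y' := by
      apply mul_left_cancel₀ hx0.ne'; linarith
    have ez : z = z' := by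
      apply mul_left_cancel₀ hx0.ne'; linarith
    exact hne (Six.ext e1 e3 eS (by rw [hx, hx', ex]) (by rw [hy, hy', ey]) (by rw [hz, hz', ez]))
  have hdvd : p.S ∣ (x * y' - x' * y) * Int.gcd p.S p.l₁ := by
    have h1 : p.S ∣ (x * y' - x' * y) * p.l₁ :=
      ⟨y * z' - z * y', by linear_combination y * r2 - y' * r1⟩
    rw [Int.gcd_eq_gcd_ab, mul_add]
    exact dvd_add (Dvd.intro _ (by ring : p.S * ((x * y' - x' * y) * p.S.gcdA p.l₁) = _))
      (by rw [← mul_assoc]; exact Dvd.dvd.mul_right h1 _)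
  have hg : (0 : ℤ) < Int.gcd p.S p.l₁ := by exact_mod_cast Int.gcd_pos_of_ne_zero_left _ hS.ne'
  have := Int.le_of_dvd (by positivity) ((dvd_abs _ _).mpr hdvd)
  rw [abs_mul, abs_of_pos hg] at this
  have e : p.d * p'.d' - p'.d * p.d' = (j : ℤ) ^ 2 * (x * y' - x' * y) := by
    rw [hx, hy', hx', hy]; ring
  rw [e, abs_mul, abs_of_pos (by positivity : (0 : ℤ) < (j : ℤ) ^ 2), mul_assoc]
  gcongr

lemma slope {p : Six} (hr : 1 ≤ r) (hl : 0 < lam) (hκ : 1 ≤ κ) (hH : 0 < H)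
    (h : SixGood r lam κ H M p) :
    |(p.d : ℝ) / p.d' - √((p.l₃ * (p.S - p.l₃) : ℝ) / (p.l₁ * (p.S - p.l₁)))| ≤
      r ^ 2 * κ ^ 4 * M / (lam ^ 2 * H ^ 2) := by
  have hκ0 : 0 < κ := by linarith
  have hr0 : 0 < r := by linarith
  have hl1 : (0 : ℝ) < p.l₁ := pos_of_le_mul hr hl h.l₁ge
  have hl2 : (0 : ℝ) < p.S - p.l₁ := pos_of_le_mul hr hl h.l₂ge
  have hl3 : (0 : ℝ) < p.l₃ := pos_of_le_mul hr hl h.l₃ge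
  have hl4 : (0 : ℝ) < p.S - p.l₃ := pos_of_le_mul hr hl h.l₄ge
  have hd : (0 : ℝ) < p.d := pos_of_le_mul hκ hH h.dge
  have hd' : (0 : ℝ) < p.d' := pos_of_le_mul hκ hH h.d'ge
  have hD := h.discr
  have hM : 0 ≤ M := (abs_nonneg _).trans hD
  set α : ℝ := p.l₁ * (p.S - p.l₁)
  set β : ℝ := p.l₃ * (p.S - p.l₃)
  have hα : 0 < α := mul_pos hl1 hl2
  have hβ : 0 < β := mul_pos hl3 hl4
  set z := √(β / α)
  have hz : 0 ≤ z := Real.sqrt_nonneg _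
  have hz2 : z ^ 2 = β / α := Real.sq_sqrt (by positivity)
  set x : ℝ := (p.d : ℝ) / p.d' with hx
  have hx0 : 0 < x := by positivity
  have hαl : lam ^ 2 ≤ r ^ 2 * α := by
    calc lam ^ 2 = lam * lam := by ring
      _ ≤ (r * p.l₁) * (r * (p.S - p.l₁)) := by
        gcongr
        · exact h.l₁ge
        · exact h.l₂ge
      _ = _ := by simp only [α]; ring
  have h1 : |x ^ 2 - z ^ 2| * (α * p.d' ^ 2) ≤ M := by
    rw [← abs_of_pos (by positivity : 0 < α * (p.d' : ℝ) ^ 2), ← abs_mul]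
    have e : (x ^ 2 - z ^ 2) * (α * p.d' ^ 2) = α * p.d ^ 2 - β * p.d' ^ 2 := by
      rw [hz2, hx]; field_simp
    rw [e]; exact hD
  have h2 : |x ^ 2 - z ^ 2| = |x - z| * (x + z) := by
    have : x ^ 2 - z ^ 2 = (x - z) * (x + z) := by ring
    rw [this, abs_mul, abs_of_pos (by linarith : 0 < x + z)]
  have h3 : |x - z| * x ≤ |x ^ 2 - z ^ 2| := by
    rw [h2]; gcongr; linarith
  rw [le_div_iff₀ (by positivity)]
  have hH2 : H ^ 2 ≤ κ ^ 2 * (p.d * p.d') := by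
    calc H ^ 2 = H * H := by ring
      _ ≤ (κ * p.d) * (κ * p.d') := by
        gcongr
        · exact h.dge
        · exact h.d'ge
      _ = _ := by ring
  have hκ24 : κ ^ 2 ≤ κ ^ 4 := pow_le_pow_right₀ hκ (by norm_num)
  calc |x - z| * (lam ^ 2 * H ^ 2) ≤ |x - z| * ((r ^ 2 * α) * (κ ^ 2 * (p.d * p.d'))) := by gcongr
    _ = r ^ 2 * κ ^ 2 * ((|x - z| * x) * (α * p.d' ^ 2)) := by rw [hx]; field_simp
    _ ≤ r ^ 2 * κ ^ 2 * (|x ^ 2 - z ^ 2| * (α * p.d' ^ 2)) := by gcongr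
    _ ≤ r ^ 2 * κ ^ 2 * M := by gcongr
    _ ≤ r ^ 2 * κ ^ 4 * M := by gcongr

end SixGood

/-- Counting by slopes, for fixed weights. -/
lemma SixGood.card_le_slopes {r lam κ H M T N : ℝ} (hr : 1 ≤ r) (hl : 0 < lam)
    (hκ : 1 ≤ κ) (hH : 0 < H) (hM : 0 ≤ M) (hT : SubpolyBound T N) (hN : 2 * r * lam ≤ N)
    {j : ℕ} (hj : 0 < j) (s : Finset Six)
    (hs : ∀ p ∈ s, SixGood r lam κ H M p ∧ p.content = j) :
    (s.card : ℝ) ≤ 2 * r ^ 3 * lam ^ 3 + 4 * r ^ 6 * κ ^ 6 * T * M / j ^ 2 := by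
  have hκ0 : 0 < κ := by linarith
  have hr0 : 0 < r := by linarith
  have hT1 := hT.one_le
  have hj0 : (0 : ℝ) < j := by exact_mod_cast hj
  set c : ℝ := 2 * r ^ 3 * κ ^ 6 * M / (j ^ 2 * lam ^ 3) with hc
  have hc0 : 0 ≤ c := by positivity
  have key := card_le_sum_of_fiber s (fun p => (p.l₃, p.S, p.l₁))
    (upTo (r * lam) ×ˢ upTo (2 * r * lam) ×ˢ upTo (r * lam))
    (fun p hp => by
      have h := (hs p hp).1
      simp only [Finset.mem_product, mem_upTo]
      exact ⟨⟨int_pos_of_le_mul hr hl h.l₃ge, h.l₃le⟩, ⟨h.S_pos hr hl, h.S_le⟩,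
        ⟨int_pos_of_le_mul hr hl h.l₁ge, h.l₁le⟩⟩)
    (fun y => 1 + c * (Int.gcd y.2.1 y.2.2 : ℝ))
    (by
      rintro ⟨l₃, S, l₁⟩ - u hus hu
      rcases Finset.eq_empty_or_nonempty u with rfl | ⟨p₀, hp₀⟩
      · simp; positivity
      have mem : ∀ {p}, p ∈ u → p.l₃ = l₃ ∧ p.S = S ∧ p.l₁ = l₁ := by
        intro p hp
        simpa only [Prod.mk.injEq] using hu p hp
      have hS : 0 < S := (mem hp₀).2.1 ▸ (hs p₀ (hus hp₀)).1.S_pos hr hl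
      have hg : (0 : ℝ) < (Int.gcd S l₁ : ℝ) := by
        exact_mod_cast Int.gcd_pos_of_ne_zero_left _ hS.ne'
      have hSl : lam ≤ r * S := by
        have h := (hs p₀ (hus hp₀)).1
        have h1 := h.l₁ge
        have h2 : (0 : ℝ) < p₀.S - p₀.l₁ := pos_of_le_mul hr hl h.l₂ge
        rw [← (mem hp₀).2.1]
        nlinarith
      set w := r ^ 2 * κ ^ 4 * M / (lam ^ 2 * H ^ 2) with hw
      have hw0 : 0 ≤ w := by positivity
      set z := √((l₃ * (S - l₃) : ℝ) / (l₁ * (S - l₁)))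
      have sl : ∀ {p}, p ∈ u → |(p.d : ℝ) / p.d' - z| ≤ w := by
        intro p hp
        have := (hs p (hus hp)).1.slope hr hl hκ hH
        obtain ⟨g1, g2, g3⟩ := mem hp
        rwa [g1, g2, g3] at this
      have hσ : 0 < (j : ℝ) ^ 2 * lam / (r * (Int.gcd S l₁ : ℝ) * (κ ^ 2 * H ^ 2)) := by
        positivity
      have := card_le_one_add_of_separated u
        (fun p => (p.d : ℝ) / p.d') (lo := z - w) (W := 2 * w) hσ (by positivity)
        (fun q hq => by linarith [(abs_le.mp (sl hq)).1])
        (fun q hq => by linarith [(abs_le.mp (sl hq)).2])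
        (by
          intro p hp p' hp' hne
          have hB := hs p (hus hp)
          have hB' := hs p' (hus hp')
          obtain ⟨g1, g2, g3⟩ := mem hp
          obtain ⟨g1', g2', g3'⟩ := mem hp'
          have sep := hB.1.separated hB'.1 hr hl (int_pos_of_le_mul hκ hH hB.1.dge)
            (int_pos_of_le_mul hκ hH hB'.1.dge) (g3.trans g3'.symm) (g1.trans g1'.symm)
            (g2.trans g2'.symm) hB.2 hB'.2 hne
          rw [g2, g3] at sep
          have sep' : (j : ℝ) ^ 2 * S ≤
              |(p.d : ℝ) * p'.d' - p'.d * p.d'| * (Int.gcd S l₁ : ℝ) := by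
            exact_mod_cast sep
          have h3 : (0 : ℝ) < p.d' := pos_of_le_mul hκ hH hB.1.d'ge
          have h3' : (0 : ℝ) < p'.d' := pos_of_le_mul hκ hH hB'.1.d'ge
          have e1 : (p.d : ℝ) / p.d' - p'.d / p'.d' =
              (p.d * p'.d' - p'.d * p.d') / (p.d' * p'.d') := by
            field_simp
          rw [e1, abs_div, abs_of_pos (by positivity : (0 : ℝ) < p.d' * p'.d'),
            div_le_div_iff₀ (by positivity) (by positivity)]
          calc (j : ℝ) ^ 2 * lam * (p.d' * p'.d') ≤ (j : ℝ) ^ 2 * (r * S) * ((κ * H) * (κ * H)) := by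
                gcongr
                · exact hB.1.d'le
                · exact hB'.1.d'le
            _ = r * (j ^ 2 * S) * ((κ * H) * (κ * H)) := by ring
            _ ≤ r * (|(p.d : ℝ) * p'.d' - p'.d * p.d'| * (Int.gcd S l₁ : ℝ)) *
                ((κ * H) * (κ * H)) := by gcongr
            _ = _ := by ring)
      refine this.trans (le_of_eq ?_)
      simp only [hc, hw]
      field_simp)
  refine key.trans ?_
  simp only [Finset.sum_product]
  have hup : ((upTo (r * lam)).card : ℝ) ≤ r * lam := card_upTo (by positivity)
  have hup2 : ((upTo (2 * r * lam)).card : ℝ) ≤ 2 * r * lam := card_upTo (by positivity)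
  have inner : ∀ e ∈ upTo (2 * r * lam), ∑ b ∈ upTo (r * lam), (1 + c * (Int.gcd e b : ℝ)) ≤
      r * lam * (1 + c * T) := by
    intro e he
    rw [mem_upTo] at he
    have he0 : (1 : ℝ) ≤ e := by exact_mod_cast he.1
    rw [Finset.sum_add_distrib, ← Finset.mul_sum]
    have := sum_gcd_le hT (x := r * lam) (by positivity) (e := e) (by omega)
      (by rw [abs_of_pos (by linarith)]; linarith [he.2])
    simp only [Finset.sum_const, nsmul_eq_mul, mul_one]
    calc _ ≤ r * lam + c * (r * lam * T) := by gcongr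
      _ = _ := by ring
  calc _ ≤ ∑ _x ∈ upTo (r * lam), ∑ _e ∈ upTo (2 * r * lam), r * lam * (1 + c * T) := by
        gcongr with x _ e he
        exact inner e he
    _ = ((upTo (r * lam)).card : ℝ) * (((upTo (2 * r * lam)).card : ℝ) *
          (r * lam * (1 + c * T))) := by
        simp only [Finset.sum_const, nsmul_eq_mul]
    _ ≤ (r * lam) * ((2 * r * lam) * (r * lam * (1 + c * T))) := by
        have : 0 ≤ r * lam * (1 + c * T) := by positivity
        gcongr
    _ = _ := by
        rw [hc]; field_simp; ring

/-- Counting by the divisor bound. -/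
lemma SixGood.card_le_divisors {r lam κ H M T N : ℝ} (hr : 1 ≤ r) (hl : 0 < lam)
    (hκ : 1 ≤ κ) (hH : 0 < H) (hT : SubpolyBound T N) (hN : r * lam * (κ * H) ≤ N)
    {j : ℕ} (hj : 0 < j) (s : Finset Six)
    (hs : ∀ p ∈ s, SixGood r lam κ H M p ∧ p.content = j) :
    (s.card : ℝ) ≤ r ^ 2 * κ ^ 2 * T * lam ^ 2 * H ^ 2 / j ^ 2 := by
  have hκ0 : 0 < κ := by linarith
  have hr0 : 0 < r := by linarith
  have hT1 := hT.one_le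
  have hj0 : (0 : ℝ) < j := by exact_mod_cast hj
  have key := card_le_mul_of_fiber s (fun p => (p.l₁, p.l₃, p.d / (j : ℤ), p.d' / (j : ℤ)))
    (upTo (r * lam) ×ˢ upTo (r * lam) ×ˢ upTo (κ * H / j) ×ˢ upTo (κ * H / j))
    (fun p hp => by
      have h := (hs p hp).1
      have hdiv : ∀ x : ℤ, (j : ℤ) ∣ x → 0 < x → x ≤ κ * H →
          1 ≤ x / (j : ℤ) ∧ ((x / (j : ℤ) : ℤ) : ℝ) ≤ κ * H / j := by
        rintro x ⟨y, rfl⟩ hx hxH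
        rw [Int.mul_ediv_cancel_left _ (by omega)]
        refine ⟨pos_of_mul_pos_right hx (by omega), ?_⟩
        rw [le_div_iff₀ hj0]; push_cast at hxH; linarith
      have hcd := p.content_dvd
      rw [(hs p hp).2] at hcd
      simp only [Finset.mem_product, mem_upTo]
      exact ⟨⟨int_pos_of_le_mul hr hl h.l₁ge, h.l₁le⟩,
        ⟨int_pos_of_le_mul hr hl h.l₃ge, h.l₃le⟩,
        hdiv _ hcd.1 (int_pos_of_le_mul hκ hH h.dge) h.dle,
        hdiv _ hcd.2.1 (int_pos_of_le_mul hκ hH h.d'ge) h.d'le⟩)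
    T (by
      rintro ⟨l₁, l₃, x, y⟩ - u hus hu
      rcases Finset.eq_empty_or_nonempty u with rfl | ⟨p₀, hp₀⟩
      · simp; linarith
      have hj0' : (j : ℤ) ≠ 0 := by omega
      have mem : ∀ {p}, p ∈ u → p.l₁ = l₁ ∧ p.l₃ = l₃ ∧ p.d = j * x ∧ p.d' = j * y ∧
          ∃ z, 0 < z ∧ p.b = j * z ∧ p.S * z = l₃ * y - l₁ * x := by
        intro p hp
        have := hu p hp
        simp only [Prod.mk.injEq] at this
        obtain ⟨i1, i2, i3, i4⟩ := this
        obtain ⟨hdx, hdy, ⟨z, hz⟩⟩ := p.content_dvd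
        rw [(hs p (hus hp)).2] at hdx hdy hz
        have ex : p.d = j * x := by rw [← i3, Int.mul_ediv_cancel' hdx]
        have ey : p.d' = j * y := by rw [← i4, Int.mul_ediv_cancel' hdy]
        have hrel := (hs p (hus hp)).1.rel
        rw [ex, ey, hz, i1, i2] at hrel
        have hb := (hs p (hus hp)).1.b_pos
        rw [hz] at hb
        refine ⟨i1, i2, ex, ey, z, pos_of_mul_pos_right hb (by omega), hz, ?_⟩
        apply mul_left_cancel₀ hj0'
        linear_combination -hrel
      have hn : 0 < l₃ * y - l₁ * x := by
        obtain ⟨-, -, -, -, z, hz, -, hzz⟩ := mem hp₀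
        rw [← hzz]
        exact mul_pos ((hs p₀ (hus hp₀)).1.S_pos hr hl) hz
      apply card_le_of_dvd hT u (fun p => p.S) hn.ne'
      · have hg := (hs p₀ (hus hp₀)).1
        obtain ⟨i1, i2, i3, i4, -⟩ := mem hp₀
        rw [abs_of_pos (by exact_mod_cast hn)]
        have hx : 0 < x := by
          have := int_pos_of_le_mul hκ hH hg.dge
          rw [i3] at this; exact pos_of_mul_pos_right this (by omega)
        have hy0 : 0 < p₀.d' := int_pos_of_le_mul hκ hH hg.d'ge
        have hypos : 0 < y := by
          rw [i4] at hy0; exact pos_of_mul_pos_right hy0 (by omega)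
        have hy : y ≤ p₀.d' := by
          rw [i4]; nlinarith
        have hy0' : (0 : ℝ) < y := by exact_mod_cast hypos
        have hy' : (y : ℝ) ≤ κ * H := le_trans (by exact_mod_cast hy) hg.d'le
        have hl3 : (0 : ℝ) < l₃ := i2 ▸ pos_of_le_mul hr hl hg.l₃ge
        have hl1 : (0 : ℝ) < l₁ := i1 ▸ pos_of_le_mul hr hl hg.l₁ge
        have hl3' : (l₃ : ℝ) ≤ r * lam := i2 ▸ hg.l₃le
        have hx' : (0 : ℝ) < x := by exact_mod_cast hx
        push_cast
        calc (l₃ : ℝ) * y - l₁ * x ≤ l₃ * y := by linarith [mul_pos hl1 hx']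
          _ ≤ (r * lam) * (κ * H) := by gcongr
          _ ≤ N := hN
      · intro p hp; exact (hs p (hus hp)).1.S_pos hr hl
      · intro p hp
        obtain ⟨-, -, -, -, z, hz, -, hzz⟩ := mem hp
        exact ⟨z, hzz.symm⟩
      · intro p hp p' hp' hSS
        obtain ⟨i1, i2, i3, i4, z, hz, hb, hzz⟩ := mem hp
        obtain ⟨i1', i2', i3', i4', z', hz', hb', hzz'⟩ := mem hp'
        simp only at hSS
        have hS := (hs p (hus hp)).1.S_pos hr hl
        have ez : z = z' := by
          apply mul_left_cancel₀ hS.ne'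
          rw [hzz, hSS, hzz']
        exact Six.ext (i1.trans i1'.symm) (i2.trans i2'.symm) hSS (i3.trans i3'.symm)
          (i4.trans i4'.symm) (by rw [hb, hb', ez]))
  refine key.trans ?_
  simp only [Finset.card_product]
  push_cast
  have hup : ((upTo (r * lam)).card : ℝ) ≤ r * lam := card_upTo (by positivity)
  have hup2 : ((upTo (κ * H / j)).card : ℝ) ≤ κ * H / j := card_upTo (by positivity)
  calc _ ≤ (r * lam) * ((r * lam) * ((κ * H / j) * (κ * H / j))) * T := by gcongr
    _ = _ := by field_simp

lemma SixGood.card_le {r lam κ H c μ T N : ℝ} (hr : 1 ≤ r) (hl : 0 < lam)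
    (hκ : 1 ≤ κ) (hH : 0 < H) (hc : 0 ≤ c) (hμ : 0 < μ) (hT : SubpolyBound T N)
    (hN : 2 * r * lam ≤ N) (hN' : r * lam * (κ * H) ≤ N) (hN'' : κ * H ≤ N)
    (hlH : lam * H ^ 2 ≤ μ ^ 2)
    (s : Finset Six) (hs : ∀ p ∈ s, SixGood r lam κ H (c * lam ^ 2 * μ) p) :
    (s.card : ℝ) ≤ (4 * c + 2) * r ^ 6 * κ ^ 6 * T ^ 2 * lam ^ 2 * μ := by
  have hκ0 : 0 < κ := by linarith
  have hr0 : 0 < r := by linarith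
  have hT1 := hT.one_le
  have key := card_le_sum_of_fiber s (fun p => (p.content : ℤ)) (upTo (κ * H))
    (fun p hp => by
      have h := hs p hp
      have hd : 0 < p.d := int_pos_of_le_mul hκ hH h.dge
      have hdvd := p.content_dvd.1
      rw [mem_upTo]
      have hpos : 0 < (p.content : ℤ) := by
        rcases Nat.eq_zero_or_pos p.content with h0 | h0
        · rw [h0] at hdvd; simp at hdvd; omega
        · exact_mod_cast h0
      refine ⟨hpos, ?_⟩
      have := Int.le_of_dvd hd hdvd
      exact le_trans (by exact_mod_cast this) h.dle)
    (fun j => (4 * c + 2) * r ^ 6 * κ ^ 6 * T * lam ^ 2 * μ * (1 / (j : ℝ)))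
    (by
      intro j hj u hus hu
      rw [mem_upTo] at hj
      obtain ⟨n, rfl⟩ := Int.eq_ofNat_of_zero_le (by omega : 0 ≤ j)
      have hn : 0 < n := by omega
      have hn0 : (1 : ℝ) ≤ n := by exact_mod_cast hn
      have hu' : ∀ p ∈ u, SixGood r lam κ H (c * lam ^ 2 * μ) p ∧ p.content = n :=
        fun p hp => ⟨hs p (hus hp), by exact_mod_cast hu p hp⟩
      have b1 := SixGood.card_le_slopes hr hl hκ hH (by positivity) hT hN hn u hu'
      have b2 := SixGood.card_le_divisors hr hl hκ hH hT hN' hn u hu'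
      set Z : ℝ := 2 * r ^ 3 * κ ^ 2 * T * lam ^ 2 * μ / n with hZ
      have hZ0 : 0 ≤ Z := by positivity
      have hxy : (2 * r ^ 3 * lam ^ 3) * (r ^ 2 * κ ^ 2 * T * lam ^ 2 * H ^ 2 / n ^ 2) ≤ Z ^ 2 := by
        calc _ = (1 * r ^ 5 * κ ^ 2 * T) * (2 * lam ^ 4 * (lam * H ^ 2) / n ^ 2) := by ring
          _ ≤ (2 * r ^ 6 * κ ^ 4 * T ^ 2) * (2 * lam ^ 4 * μ ^ 2 / n ^ 2) := by
              have hT2 : T ≤ T ^ 2 := le_self_pow₀ hT1 (by norm_num)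
              gcongr <;> first | assumption | norm_num
          _ = Z ^ 2 := by rw [hZ]; field_simp
      have hmin : (u.card : ℝ) ≤ Z + 4 * r ^ 6 * κ ^ 6 * T * (c * lam ^ 2 * μ) / n ^ 2 := by
        have h0 : 0 ≤ 4 * r ^ 6 * κ ^ 6 * T * (c * lam ^ 2 * μ) / (n : ℝ) ^ 2 := by positivity
        rcases le_total (2 * r ^ 3 * lam ^ 3) Z with h | h
        · linarith
        · have hy : r ^ 2 * κ ^ 2 * T * lam ^ 2 * H ^ 2 / (n : ℝ) ^ 2 ≤ Z := by
            by_contra hcon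
            push Not at hcon
            have hZpos : 0 < Z := by positivity
            nlinarith
          linarith
      refine hmin.trans ?_
      have hn2 : (n : ℝ) ≤ n ^ 2 := le_self_pow₀ hn0 (by norm_num)
      calc Z + 4 * r ^ 6 * κ ^ 6 * T * (c * lam ^ 2 * μ) / n ^ 2
          ≤ Z + 4 * r ^ 6 * κ ^ 6 * T * (c * lam ^ 2 * μ) / n := by gcongr
        _ = (2 * r ^ 3 * κ ^ 2 + 4 * r ^ 6 * κ ^ 6 * c) * (T * lam ^ 2 * μ / n) := by
            rw [hZ]; ring
        _ ≤ (2 * r ^ 6 * κ ^ 6 + 4 * r ^ 6 * κ ^ 6 * c) * (T * lam ^ 2 * μ / n) := by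
            gcongr <;> first | assumption | norm_num
        _ = _ := by push_cast; ring)
  refine key.trans ?_
  rw [← Finset.mul_sum]
  have := sum_upTo_inv_le hT (x := κ * H) (by positivity) hN''
  calc _ ≤ (4 * c + 2) * r ^ 6 * κ ^ 6 * T * lam ^ 2 * μ * T := by gcongr
    _ = _ := by ring

lemma hasDerivAt_log_sqrt_add_sqrt {s u v : ℝ} (hu : 0 < s + u) (hv : 0 < s + v) :
    HasDerivAt (fun s : ℝ => Real.log (√(s + u) + √(s + v))) (1 / (2 * √(s + u) * √(s + v))) s := by
  have h1 : HasDerivAt (fun s : ℝ => √(s + u)) (1 / (2 * √(s + u))) s :=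
    ((hasDerivAt_id s).add_const u).sqrt hu.ne'
  have h2 : HasDerivAt (fun s : ℝ => √(s + v)) (1 / (2 * √(s + v))) s :=
    ((hasDerivAt_id s).add_const v).sqrt hv.ne'
  have p1 := Real.sqrt_pos.mpr hu
  have p2 := Real.sqrt_pos.mpr hv
  have h3 := (h1.fun_add h2).log (by positivity)
  convert h3 using 1
  field_simp
  ring

lemma log_ratio_growth {s₁ s₂ x₁ x₂ y₁ y₂ m : ℝ} (hs : s₁ ≤ s₂) (hx₁ : 0 < s₁ + x₁)
    (hx₂ : 0 < s₁ + x₂) (hy₁ : 0 < s₁ + y₁) (hy₂ : 0 < s₁ + y₂)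
    (hm : ∀ s, s₁ ≤ s → s ≤ s₂ →
      m ≤ 1 / (2 * √(s + x₁) * √(s + x₂)) - 1 / (2 * √(s + y₁) * √(s + y₂))) :
    m * (s₂ - s₁) ≤ (Real.log (√(s₂ + x₁) + √(s₂ + x₂)) - Real.log (√(s₂ + y₁) + √(s₂ + y₂))) -
      (Real.log (√(s₁ + x₁) + √(s₁ + x₂)) - Real.log (√(s₁ + y₁) + √(s₁ + y₂))) := by
  have hd : ∀ s, s₁ ≤ s → HasDerivAt (fun s : ℝ => Real.log (√(s + x₁) + √(s + x₂)) -
      Real.log (√(s + y₁) + √(s + y₂)))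
      (1 / (2 * √(s + x₁) * √(s + x₂)) - 1 / (2 * √(s + y₁) * √(s + y₂))) s := fun s h =>
    (hasDerivAt_log_sqrt_add_sqrt (by linarith) (by linarith)).fun_sub
      (hasDerivAt_log_sqrt_add_sqrt (by linarith) (by linarith))
  refine (convex_Icc s₁ s₂).mul_sub_le_image_sub_of_le_deriv
    (f := fun s : ℝ => Real.log (√(s + x₁) + √(s + x₂)) - Real.log (√(s + y₁) + √(s + y₂)))
    (fun s h => (hd s h.1).continuousAt.continuousWithinAt)
    (fun s h => (hd s (interior_subset h).1).differentiableAt.differentiableWithinAt)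
    (fun s h => ?_) s₁ (Set.left_mem_Icc.mpr hs) s₂ (Set.right_mem_Icc.mpr hs) hs
  rw [(hd s (interior_subset h).1).deriv]
  exact hm s (interior_subset h).1 (interior_subset h).2

/-- Along translates, the ratio of the sums of square roots grows. -/
lemma ratio_growth {r R κ A s₁ s₂ k₁ k₂ k₃ : ℝ} (hr : 1 ≤ r) (hR : 0 < R) (hκ : 1 ≤ κ)
    (hA : 0 < A) (hs : s₁ ≤ s₂) (h0 : R ^ 2 ≤ r ^ 2 * s₁) (hk₂ : 0 ≤ k₂)
    (hk₃ : 0 ≤ k₃) (h13 : A ≤ κ * (k₁ - k₃)) (hle₁ : s₂ + k₁ ≤ r ^ 2 * R ^ 2)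
    (hle₂ : s₂ + k₂ ≤ r ^ 2 * R ^ 2) :
    ((√(s₁ + k₃) + √s₁) / (√(s₁ + k₁) + √(s₁ + k₂))) ^ 2 * (1 + A / (4 * κ * r ^ 6 * R ^ 4) *
      (s₂ - s₁)) ≤ ((√(s₂ + k₃) + √s₂) / (√(s₂ + k₁) + √(s₂ + k₂))) ^ 2 := by
  have hκ0 : 0 < κ := by linarith
  have hr0 : 0 < r := by linarith
  have hk13 : 0 < k₁ - k₃ := pos_of_le_mul hκ hA h13
  have hs0 : 0 < s₁ := pos_of_le_mul (one_le_pow₀ hr) (by positivity) h0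
  set m := A / (4 * κ * r ^ 6 * R ^ 4) with hm
  have hm0 : 0 < m := by positivity
  have key := log_ratio_growth (x₁ := k₃) (x₂ := 0) (y₁ := k₁) (y₂ := k₂) (m := m) hs
    (by linarith) (by linarith) (by linarith) (by linarith) (by
      intro s h1 h2
      have up : ∀ k : ℝ, k ≤ r ^ 2 * R ^ 2 → √k ≤ r * R := fun k hk =>
        Real.sqrt_le_iff.mpr ⟨by positivity, by linarith [mul_pow r R 2]⟩
      have lo : ∀ k : ℝ, R ^ 2 ≤ r ^ 2 * k → R ≤ r * √k := fun k hk => by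
        have : √(r ^ 2 * k) = r * √k := by
          rw [Real.sqrt_mul (by positivity), Real.sqrt_sq hr0.le]
        rw [← this]; exact Real.le_sqrt_of_sq_le hk
      rw [add_zero]
      have a1 := up (s + k₁) (by linarith)
      have a2 := up (s + k₂) (by linarith)
      have a3 := up (s + k₃) (by linarith)
      have a4 := up s (by linarith)
      have b2 := lo (s + k₂) (by nlinarith [sq_nonneg r])
      have c1 : √(s + k₁) ^ 2 = s + k₁ := Real.sq_sqrt (by linarith)
      have c3 : √(s + k₃) ^ 2 = s + k₃ := Real.sq_sqrt (by linarith)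
      have d24 : √s ≤ √(s + k₂) := Real.sqrt_le_sqrt (by linarith)
      have p1 : 0 < √(s + k₁) := Real.sqrt_pos.mpr (by linarith)
      have p2 : 0 < √(s + k₂) := Real.sqrt_pos.mpr (by linarith)
      have p3 : 0 < √(s + k₃) := Real.sqrt_pos.mpr (by linarith)
      have p4 : 0 < √s := Real.sqrt_pos.mpr (by linarith)
      have d13 : √(s + k₃) < √(s + k₁) := Real.sqrt_lt_sqrt (by linarith) (by linarith)
      set t₁ := √(s + k₁)
      set t₂ := √(s + k₂)
      set t₃ := √(s + k₃)
      set t₄ := √s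
      have e1 : A ≤ κ * ((t₁ - t₃) * (2 * r * R)) := by
        calc A ≤ κ * (k₁ - k₃) := h13
          _ = κ * ((t₁ - t₃) * (t₁ + t₃)) := by congr 1; linear_combination c3 - c1
          _ ≤ _ := by gcongr; linarith
      have e2 : A ≤ 2 * κ * r ^ 2 * (t₁ * t₂ - t₃ * t₄) := by
        calc A ≤ κ * ((t₁ - t₃) * (2 * r * R)) := e1
          _ ≤ κ * ((t₁ - t₃) * (2 * r * (r * t₂))) := by
            have : 0 ≤ t₁ - t₃ := by linarith
            gcongr
          _ = 2 * κ * r ^ 2 * (t₁ * t₂ - t₃ * t₂) := by ring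
          _ ≤ _ := by gcongr
      have e3 : t₁ * t₂ * (t₃ * t₄) ≤ r ^ 4 * R ^ 4 := by
        calc t₁ * t₂ * (t₃ * t₄) ≤ (r * R) * (r * R) * ((r * R) * (r * R)) := by gcongr
          _ = _ := by ring
      have e4 : 1 / (2 * t₃ * t₄) - 1 / (2 * t₁ * t₂) =
          (t₁ * t₂ - t₃ * t₄) / (2 * (t₁ * t₂ * (t₃ * t₄))) := by field_simp
      have e5 : 0 ≤ t₁ * t₂ - t₃ * t₄ := by nlinarith
      rw [e4]
      calc m ≤ 2 * κ * r ^ 2 * (t₁ * t₂ - t₃ * t₄) / (4 * κ * r ^ 6 * R ^ 4) := by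
            rw [hm]; gcongr
        _ = (t₁ * t₂ - t₃ * t₄) / (2 * (r ^ 4 * R ^ 4)) := by field_simp; ring
        _ ≤ _ := by gcongr)
  simp only [add_zero] at key
  have q1 : 0 < √(s₁ + k₃) + √s₁ := by
    have := Real.sqrt_pos.mpr hs0; positivity
  have q2 : 0 < √(s₂ + k₃) + √s₂ := by
    have := Real.sqrt_pos.mpr (hs0.trans_le hs); positivity
  have q3 : 0 < √(s₁ + k₁) + √(s₁ + k₂) := by
    have := Real.sqrt_pos.mpr (by linarith : 0 < s₁ + k₂); positivity
  have q4 : 0 < √(s₂ + k₁) + √(s₂ + k₂) := by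
    have := Real.sqrt_pos.mpr (by linarith : 0 < s₂ + k₂); positivity
  rw [← Real.log_div q2.ne' q4.ne', ← Real.log_div q1.ne' q3.ne'] at key
  set ρ₁ := (√(s₁ + k₃) + √s₁) / (√(s₁ + k₁) + √(s₁ + k₂))
  set ρ₂ := (√(s₂ + k₃) + √s₂) / (√(s₂ + k₁) + √(s₂ + k₂))
  have hρ₁ : 0 < ρ₁ := by positivity
  have hρ₂ : 0 < ρ₂ := by positivity
  have hms : 0 ≤ m * (s₂ - s₁) := mul_nonneg hm0.le (by linarith)
  have h1 : ρ₁ * (1 + m * (s₂ - s₁)) ≤ ρ₂ := by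
    calc ρ₁ * (1 + m * (s₂ - s₁)) ≤ ρ₁ * Real.exp (m * (s₂ - s₁)) := by
          gcongr; linarith [Real.add_one_le_exp (m * (s₂ - s₁))]
      _ = Real.exp (Real.log ρ₁ + m * (s₂ - s₁)) := by
          rw [Real.exp_add, Real.exp_log hρ₁]
      _ ≤ Real.exp (Real.log ρ₂) := by gcongr; linarith
      _ = ρ₂ := Real.exp_log hρ₂
  calc ρ₁ ^ 2 * (1 + m * (s₂ - s₁)) ≤ ρ₁ ^ 2 * (1 + m * (s₂ - s₁)) ^ 2 := by
        gcongr; exact le_self_pow₀ (by linarith) (by norm_num)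
    _ = (ρ₁ * (1 + m * (s₂ - s₁))) ^ 2 := by ring
    _ ≤ ρ₂ ^ 2 := by gcongr

lemma RGood.ratio_sq {r R lam t₁ t₂ t₃ t₄ l₁ l₂ l₃ l₄ : ℝ}
    (h : RGood r R lam t₁ t₂ t₃ t₄ l₁ l₂ l₃ l₄) :
    |l₁ * l₂ * (t₁ ^ 2 - t₂ ^ 2) ^ 2 * ((t₃ + t₄) / (t₁ + t₂)) ^ 2 -
      l₃ * l₄ * (t₃ ^ 2 - t₄ ^ 2) ^ 2| ≤ 16 * r ^ 4 * R ^ 2 * lam ^ 2 := by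
  have hr := h.one_le
  have hR := h.R_pos
  have hl := h.lam_pos
  have p1 := h.t₁pos
  have p2 := h.t₂pos
  have p3 := h.t₃pos
  have p4 := h.t₄pos
  have e : l₁ * l₂ * (t₁ ^ 2 - t₂ ^ 2) ^ 2 * ((t₃ + t₄) / (t₁ + t₂)) ^ 2 -
      l₃ * l₄ * (t₃ ^ 2 - t₄ ^ 2) ^ 2 =
      (t₃ + t₄) ^ 2 * (l₁ * l₂ * (t₁ - t₂) ^ 2 - l₃ * l₄ * (t₃ - t₄) ^ 2) := by
    field_simp; ring
  rw [e, abs_mul, abs_of_nonneg (sq_nonneg _)]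
  calc _ ≤ (2 * r * R) ^ 2 * (4 * r ^ 2 * lam ^ 2) := by
        gcongr
        · linarith [h.t₃le, h.t₄le]
        · exact h.discr
    _ = _ := by ring

lemma Good.sqrt_sq {r R lam : ℝ} {q : Quad} (hr : 1 ≤ r) (hR : 0 < R) (h : Good r R lam q) :
    √(q.k₁ : ℝ) ^ 2 = q.k₁ ∧ √(q.k₂ : ℝ) ^ 2 = q.k₂ ∧ √(q.k₃ : ℝ) ^ 2 = q.k₃ ∧
      √(q.k₄ : ℝ) ^ 2 = q.k₄ := by
  have sq : ∀ k : ℤ, R ^ 2 ≤ r ^ 2 * k → √(k : ℝ) ^ 2 = k := fun k hk =>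
    Real.sq_sqrt (by exact_mod_cast (one_le_of_le_sq_mul hr hR hk).trans' zero_le_one)
  exact ⟨sq _ h.k₁ge, sq _ h.k₂ge, sq _ h.k₃ge, sq _ h.k₄ge⟩

/-- Forget the translation. -/
def Quad.toSix (q : Quad) : Six :=
  ⟨q.l₁, q.l₃, q.l₁ + q.l₂, q.k₁ - q.k₂, q.k₃ - q.k₄, q.k₂ - q.k₄⟩

lemma Box.translate_le {r R lam κ H A : ℝ} {q q' : Quad} (hr : 1 ≤ r) (hR : 0 < R) (hl : 0 < lam)
    (hκ : 1 ≤ κ) (hH : 0 < H) (hA : 0 < A) (h : Box r R lam κ H A q) (h' : Box r R lam κ H A q')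
    (he : q.toSix = q'.toSix) (hle : q.k₄ ≤ q'.k₄) :
    (q'.k₄ : ℝ) - q.k₄ ≤ 128 * r ^ 16 * κ ^ 3 * R ^ 6 / (H ^ 2 * A) := by
  have hκ0 : 0 < κ := by linarith
  have hr0 : 0 < r := by linarith
  simp only [Quad.toSix, Six.mk.injEq] at he
  obtain ⟨i1, i3, iS, id, id', ib⟩ := he
  have g := h.toGood.rgood hr hR hl
  have g' := h'.toGood.rgood hr hR hl
  obtain ⟨s1, s2, s3, s4⟩ := h.toGood.sqrt_sq hr hR
  obtain ⟨s1', s2', s3', s4'⟩ := h'.toGood.sqrt_sq hr hR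
  have G := g.ratio_sq
  have G' := g'.ratio_sq
  have i2 : q.l₂ = q'.l₂ := by omega
  have i4 : q.l₄ = q'.l₄ := by have := h.sum; have := h'.sum; omega
  rw [s1, s2, s3, s4] at G
  rw [s1', s2', s3', s4', ← i1, ← i2, ← i3, ← i4] at G'
  have c1 : (q'.k₁ : ℝ) - q'.k₂ = q.k₁ - q.k₂ := by exact_mod_cast id.symm
  have c3 : (q'.k₃ : ℝ) - q'.k₄ = q.k₃ - q.k₄ := by exact_mod_cast id'.symm
  have cb : (q'.k₂ : ℝ) - q'.k₄ = q.k₂ - q.k₄ := by exact_mod_cast ib.symm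
  rw [c1, c3] at G'
  have hk34 : (0 : ℝ) < q.k₃ - q.k₄ := pos_of_le_mul hκ hH h.k₃₄ge
  have hk24 : (0 : ℝ) < q.k₂ - q.k₄ := pos_of_le_mul hκ hA h.k₂₄ge
  have hk12 : (0 : ℝ) < q.k₁ - q.k₂ := pos_of_le_mul hκ hH h.k₁₂ge
  have gr := ratio_growth (r := r) (R := R) (κ := κ) (A := A) (s₁ := q.k₄) (s₂ := q'.k₄)
    (k₁ := q.k₁ - q.k₄) (k₂ := q.k₂ - q.k₄) (k₃ := q.k₃ - q.k₄) hr hR hκ hA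
    (by exact_mod_cast hle) h.k₄ge hk24.le hk34.le (by
      have := h.k₁₃ge
      have e : (q.k₁ : ℝ) - q.k₄ - (q.k₃ - q.k₄) = q.k₁ - q.k₃ := by ring
      rw [e]; exact this)
    (by have := h'.k₁le; linarith) (by have := h'.k₂le; linarith)
  have f1 : (q.k₄ : ℝ) + (q.k₁ - q.k₄) = q.k₁ := by ring
  have f2 : (q.k₄ : ℝ) + (q.k₂ - q.k₄) = q.k₂ := by ring
  have f3 : (q.k₄ : ℝ) + (q.k₃ - q.k₄) = q.k₃ := by ring
  have f1' : (q'.k₄ : ℝ) + (q.k₁ - q.k₄) = q'.k₁ := by linarith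
  have f2' : (q'.k₄ : ℝ) + (q.k₂ - q.k₄) = q'.k₂ := by linarith
  have f3' : (q'.k₄ : ℝ) + (q.k₃ - q.k₄) = q'.k₃ := by linarith
  rw [f1, f2, f3, f1', f2', f3'] at gr
  have hρ : 1 / r ^ 2 ≤ (√(q.k₃ : ℝ) + √(q.k₄ : ℝ)) / (√(q.k₁ : ℝ) + √(q.k₂ : ℝ)) := by
    rw [div_le_div_iff₀ (by positivity) (by linarith [g.t₁pos, g.t₂pos])]
    nlinarith [g.t₁le, g.t₂le, g.t₃ge, g.t₄ge]
  set ρ₁ := (√(q.k₃ : ℝ) + √(q.k₄ : ℝ)) / (√(q.k₁ : ℝ) + √(q.k₂ : ℝ))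
  set ρ₂ := (√(q'.k₃ : ℝ) + √(q'.k₄ : ℝ)) / (√(q'.k₁ : ℝ) + √(q'.k₂ : ℝ))
  set u : ℝ := q'.k₄ - q.k₄
  have hu : 0 ≤ u := by
    have : (q.k₄ : ℝ) ≤ q'.k₄ := by exact_mod_cast hle
    simp only [u]; linarith
  set m := A / (4 * κ * r ^ 6 * R ^ 4) with hm
  have hm0 : 0 < m := by positivity
  have hρ4 : 1 / r ^ 4 ≤ ρ₁ ^ 2 := by
    calc 1 / r ^ 4 = (1 / r ^ 2) ^ 2 := by field_simp
      _ ≤ ρ₁ ^ 2 := by gcongr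
  have w1 : m * u / r ^ 4 ≤ ρ₂ ^ 2 - ρ₁ ^ 2 := by
    calc m * u / r ^ 4 = 1 / r ^ 4 * (m * u) := by ring
      _ ≤ ρ₁ ^ 2 * (m * u) := by gcongr
      _ ≤ _ := by linarith
  have w2 : (q.l₁ * q.l₂ : ℝ) * (q.k₁ - q.k₂) ^ 2 * (ρ₂ ^ 2 - ρ₁ ^ 2) ≤
      32 * r ^ 4 * R ^ 2 * lam ^ 2 := by
    have a1 := (abs_le.mp G).1
    have a2 := (abs_le.mp G').2
    linarith
  have w3 : lam ^ 2 * H ^ 2 ≤ r ^ 2 * κ ^ 2 * ((q.l₁ * q.l₂ : ℝ) * (q.k₁ - q.k₂) ^ 2) := by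
    calc lam ^ 2 * H ^ 2 = (lam * lam) * (H * H) := by ring
      _ ≤ ((r * q.l₁) * (r * q.l₂)) * ((κ * (q.k₁ - q.k₂)) * (κ * (q.k₁ - q.k₂))) := by
        have := g.l₁pos
        have := g.l₂pos
        gcongr
        · exact g.l₁ge
        · exact g.l₂ge
        · exact h.k₁₂ge
        · exact h.k₁₂ge
      _ = _ := by ring
  have w4 : lam ^ 2 * (H ^ 2 * (m * u / r ^ 4)) ≤ lam ^ 2 * (32 * r ^ 6 * κ ^ 2 * R ^ 2) := by
    calc lam ^ 2 * (H ^ 2 * (m * u / r ^ 4)) = (lam ^ 2 * H ^ 2) * (m * u / r ^ 4) := by ring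
      _ ≤ (r ^ 2 * κ ^ 2 * ((q.l₁ * q.l₂ : ℝ) * (q.k₁ - q.k₂) ^ 2)) * (m * u / r ^ 4) := by gcongr
      _ = r ^ 2 * κ ^ 2 * ((q.l₁ * q.l₂ : ℝ) * (q.k₁ - q.k₂) ^ 2 * (m * u / r ^ 4)) := by ring
      _ ≤ r ^ 2 * κ ^ 2 * ((q.l₁ * q.l₂ : ℝ) * (q.k₁ - q.k₂) ^ 2 * (ρ₂ ^ 2 - ρ₁ ^ 2)) := by
        have := g.l₁pos
        have := g.l₂pos
        gcongr
      _ ≤ r ^ 2 * κ ^ 2 * (32 * r ^ 4 * R ^ 2 * lam ^ 2) := by gcongr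
      _ = _ := by ring
  have w5 := le_of_mul_le_mul_left w4 (by positivity)
  rw [le_div_iff₀ (by positivity)]
  have e : H ^ 2 * (m * u / r ^ 4) * (4 * κ * r ^ 10 * R ^ 4) = u * (H ^ 2 * A) := by
    rw [hm]; field_simp
  rw [← e]
  calc _ ≤ (32 * r ^ 6 * κ ^ 2 * R ^ 2) * (4 * κ * r ^ 10 * R ^ 4) := by gcongr
    _ = _ := by ring

lemma RGood.discr_sq {r R lam t₁ t₂ t₃ t₄ l₁ l₂ l₃ l₄ κ H A : ℝ}
    (g : RGood r R lam t₁ t₂ t₃ t₄ l₁ l₂ l₃ l₄) (hκ : 1 ≤ κ) (hH : 0 < H) (hA : 0 < A)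
    (h13 : |t₁ ^ 2 - t₃ ^ 2| ≤ κ * A) (h24 : |t₂ ^ 2 - t₄ ^ 2| ≤ κ * A)
    (h34 : |t₃ ^ 2 - t₄ ^ 2| ≤ κ * H) :
    |l₁ * l₂ * (t₁ ^ 2 - t₂ ^ 2) ^ 2 - l₃ * l₄ * (t₃ ^ 2 - t₄ ^ 2) ^ 2| ≤
      16 * r ^ 6 * κ ^ 3 * lam ^ 2 * (R ^ 2 + H ^ 2 * A / R ^ 2) := by
  have hr := g.one_le
  have hR := g.R_pos
  have hl := g.lam_pos
  have hκ0 : 0 < κ := by linarith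
  have hr0 : 0 < r := by linarith
  have b13 := (diff_bounds hr hR g.t₁ge g.t₁le g.t₃ge g.t₃le).2
  have b24 := (diff_bounds hr hR g.t₂ge g.t₂le g.t₄ge g.t₄le).2
  have b34 := (diff_bounds hr hR g.t₃ge g.t₃le g.t₄ge g.t₄le).2
  have D := g.discr
  have a1 := g.t₁le
  have a2 := g.t₂le
  have a3 := g.t₃le
  have a4 := g.t₄le
  have p1 := g.t₁pos
  have p2 := g.t₂pos
  have p3 := g.t₃pos
  have p4 := g.t₄pos
  have e : l₁ * l₂ * (t₁ ^ 2 - t₂ ^ 2) ^ 2 - l₃ * l₄ * (t₃ ^ 2 - t₄ ^ 2) ^ 2 =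
      (t₁ + t₂) ^ 2 * (l₁ * l₂ * (t₁ - t₂) ^ 2 - l₃ * l₄ * (t₃ - t₄) ^ 2) +
      (l₃ * l₄ * (t₃ - t₄) ^ 2) * ((t₁ + t₂ + t₃ + t₄) * ((t₁ - t₃) + (t₂ - t₄))) := by ring
  have x13 : |t₁ - t₃| ≤ r * κ * A / (2 * R) := by
    rw [le_div_iff₀ (by positivity)]
    linarith [mul_le_mul_of_nonneg_left h13 hr0.le]
  have x24 : |t₂ - t₄| ≤ r * κ * A / (2 * R) := by
    rw [le_div_iff₀ (by positivity)]
    linarith [mul_le_mul_of_nonneg_left h24 hr0.le]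
  have x34 : |t₃ - t₄| ≤ r * κ * H / (2 * R) := by
    rw [le_div_iff₀ (by positivity)]
    linarith [mul_le_mul_of_nonneg_left h34 hr0.le]
  have y1 : |(t₁ + t₂) ^ 2 * (l₁ * l₂ * (t₁ - t₂) ^ 2 - l₃ * l₄ * (t₃ - t₄) ^ 2)| ≤
      16 * r ^ 4 * R ^ 2 * lam ^ 2 := by
    rw [abs_mul, abs_of_nonneg (sq_nonneg _)]
    calc _ ≤ (2 * r * R) ^ 2 * (4 * r ^ 2 * lam ^ 2) := by gcongr; linarith
      _ = _ := by ring
  have h3 := g.l₃pos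
  have h4 := g.l₄pos
  have z1 : |l₃ * l₄ * (t₃ - t₄) ^ 2| ≤ (r * lam) * (r * lam) * (r * κ * H / (2 * R)) ^ 2 := by
    rw [abs_mul, abs_of_pos (mul_pos h3 h4), abs_pow]
    gcongr
    · exact g.l₃le
    · exact g.l₄le
  have z2 : |(t₁ + t₂ + t₃ + t₄) * ((t₁ - t₃) + (t₂ - t₄))| ≤
      (4 * (r * R)) * (r * κ * A / R) := by
    rw [abs_mul, abs_of_pos (by positivity : 0 < t₁ + t₂ + t₃ + t₄)]
    have z : |(t₁ - t₃) + (t₂ - t₄)| ≤ r * κ * A / R := by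
      calc _ ≤ |t₁ - t₃| + |t₂ - t₄| := abs_add_le _ _
        _ ≤ r * κ * A / (2 * R) + r * κ * A / (2 * R) := by gcongr
        _ = _ := by field_simp; ring
    gcongr
    linarith
  have y2 : |(l₃ * l₄ * (t₃ - t₄) ^ 2) * ((t₁ + t₂ + t₃ + t₄) * ((t₁ - t₃) + (t₂ - t₄)))| ≤
      r ^ 6 * κ ^ 3 * lam ^ 2 * (H ^ 2 * A / R ^ 2) := by
    rw [abs_mul]
    calc _ ≤ (r * lam) * (r * lam) * (r * κ * H / (2 * R)) ^ 2 *
          ((4 * (r * R)) * (r * κ * A / R)) :=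
          mul_le_mul z1 z2 (abs_nonneg _) (by positivity)
      _ = _ := by field_simp; ring
  have hr46 : 16 * r ^ 4 * R ^ 2 * lam ^ 2 ≤ 16 * r ^ 6 * κ ^ 3 * lam ^ 2 * R ^ 2 := by
    calc 16 * r ^ 4 * R ^ 2 * lam ^ 2 = 16 * r ^ 4 * 1 * (lam ^ 2 * R ^ 2) := by ring
      _ ≤ 16 * r ^ 6 * κ ^ 3 * (lam ^ 2 * R ^ 2) := by
        gcongr
        · norm_num
        · exact one_le_pow₀ hκ
      _ = _ := by ring
  have hz : 0 ≤ r ^ 6 * κ ^ 3 * lam ^ 2 * (H ^ 2 * A / R ^ 2) := by positivity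
  rw [e]
  refine (abs_add_le _ _).trans ((add_le_add y1 y2).trans ?_)
  linarith

lemma Box.sixGood {r R lam κ H A : ℝ} {q : Quad} (hr : 1 ≤ r) (hR : 0 < R) (hl : 0 < lam)
    (hκ : 1 ≤ κ) (hH : 0 < H) (hA : 0 < A) (h : Box r R lam κ H A q) :
    SixGood r lam κ H (16 * r ^ 6 * κ ^ 3 * lam ^ 2 * (R ^ 2 + H ^ 2 * A / R ^ 2)) q.toSix := by
  have hκ0 : 0 < κ := by linarith
  have hr0 : 0 < r := by linarith
  have g := h.toGood.rgood hr hR hl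
  have hS : (q.l₁ : ℝ) + q.l₂ = q.l₃ + q.l₄ := by exact_mod_cast h.sum
  have hx2 : ((q.l₁ + q.l₂ : ℤ) : ℝ) - q.l₁ = q.l₂ := by push_cast; ring
  have hx4 : ((q.l₁ + q.l₂ : ℤ) : ℝ) - q.l₃ = q.l₄ := by push_cast; linarith
  refine ⟨h.l₁ge, h.l₁le, h.l₃ge, h.l₃le, ?_, ?_, ?_, ?_, ?_, ?_, ?_, ?_, h.weight_rel, ?_⟩
  · simp only [Quad.toSix]; rw [hx2]; exact h.l₂ge
  · simp only [Quad.toSix]; rw [hx4]; exact h.l₄ge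
  · simp only [Quad.toSix]; push_cast; linarith [h.l₁le, h.l₂le]
  · simp only [Quad.toSix]; push_cast; exact h.k₁₂ge
  · simp only [Quad.toSix]; push_cast; exact h.k₁₂le
  · simp only [Quad.toSix]; push_cast; exact h.k₃₄ge
  · simp only [Quad.toSix]; push_cast; exact h.k₃₄le
  · exact int_pos_of_le_mul hκ hA (by simp only [Quad.toSix]; push_cast; exact h.k₂₄ge)
  simp only [Quad.toSix]
  rw [hx2, hx4]
  push_cast
  obtain ⟨s1, s2, s3, s4⟩ := h.toGood.sqrt_sq hr hR
  rw [← s1, ← s2, ← s3, ← s4]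
  refine g.discr_sq hκ hH hA ?_ ?_ ?_
  · rw [s1, s3, abs_of_pos (pos_of_le_mul hκ hA h.k₁₃ge)]; exact h.k₁₃le
  · rw [s2, s4, abs_of_pos (pos_of_le_mul hκ hA h.k₂₄ge)]; exact h.k₂₄le
  · rw [s3, s4, abs_of_pos (pos_of_le_mul hκ hH h.k₃₄ge)]; exact h.k₃₄le

section
open Classical

/-- Counting shape by shape. -/
lemma card_le_of_fixed_shape {r R lam κ H A T N : ℝ} (hr : 1 ≤ r) (hR : 0 < R) (hl : 0 < lam)
    (hκ : 1 ≤ κ) (hH : 0 < H) (hA : 0 < A) (hT : SubpolyBound T N)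
    (hN : 2 * r * lam ≤ N) (hN' : r * lam * (κ * H) ≤ N) (hN'' : κ * H ≤ N)
    (hAH : A ≤ κ * H) (hHR : H ≤ κ * R ^ 2) (hAl : lam ≤ A)
    (s : Finset Quad) (hs : ∀ q ∈ s, Box r R lam κ H A q) :
    (s.card : ℝ) ≤ 33924 * r ^ 28 * κ ^ 13 * T ^ 2 * R ^ 4 * lam ^ 2 := by
  have hκ0 : 0 < κ := by linarith
  have hr0 : 0 < r := by linarith
  have hT1 := hT.one_le
  set μ := R ^ 2 + H ^ 2 * A / R ^ 2 with hμ
  have hμ0 : 0 < μ := by positivity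
  have hlH : lam * H ^ 2 ≤ μ ^ 2 := by
    have e : R ^ 2 * (H ^ 2 * A / R ^ 2) = H ^ 2 * A := by field_simp
    have : lam * H ^ 2 ≤ A * H ^ 2 := by gcongr
    have h0 : 0 ≤ H ^ 2 * A := by positivity
    nlinarith [sq_nonneg (R ^ 2 - H ^ 2 * A / R ^ 2)]
  have six := SixGood.card_le (c := 16 * r ^ 6 * κ ^ 3) hr hl hκ hH (by positivity) hμ0 hT hN hN' hN''
    hlH (s.image Quad.toSix) (by
      intro p hp
      obtain ⟨q, hq, rfl⟩ := Finset.mem_image.mp hp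
      exact (hs q hq).sixGood hr hR hl hκ hH hA)
  have key := card_le_mul_of_fiber s Quad.toSix (s.image Quad.toSix)
    (fun q hq => Finset.mem_image_of_mem _ hq) (514 * r ^ 16 * κ ^ 4 * R ^ 4 / μ) (by
      intro y _ u hus hu
      rcases Finset.eq_empty_or_nonempty u with rfl | hne
      · simp; positivity
      have inj : ∀ q ∈ u, ∀ q' ∈ u, q.k₄ = q'.k₄ → q = q' := by
        intro q hq q' hq' h4
        have he : q.toSix = q'.toSix := (hu q hq).trans (hu q' hq').symm
        simp only [Quad.toSix, Six.mk.injEq] at he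
        obtain ⟨i1, i3, iS, id, id', ib⟩ := he
        have := (hs q (hus hq)).sum
        have := (hs q' (hus hq')).sum
        apply Quad.ext <;> omega
      have c1 : (u.card : ℝ) ≤ r ^ 2 * R ^ 2 := by
        refine le_trans ?_ (card_upTo (by positivity))
        have := Finset.card_le_card_of_injOn (s := u) (t := upTo (r ^ 2 * R ^ 2)) Quad.k₄
          (fun q hq => mem_upTo.mpr
            ⟨one_le_of_le_sq_mul hr hR (hs q (hus hq)).k₄ge, (hs q (hus hq)).k₄le⟩)
          (fun q hq q' hq' h => inj q hq q' hq' h)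
        exact_mod_cast this
      obtain ⟨q₀, hq₀, hmin⟩ := Finset.exists_min_image u Quad.k₄ hne
      set Z := 128 * r ^ 16 * κ ^ 3 * R ^ 6 / (H ^ 2 * A) with hZ
      have c2 : (u.card : ℝ) ≤ 1 + Z / 1 := by
        apply card_le_one_add_of_separated u (fun q => (q.k₄ : ℝ)) (lo := q₀.k₄) one_pos
          (by positivity)
        · intro q hq; exact_mod_cast hmin q hq
        · intro q hq
          have := (hs q₀ (hus hq₀)).translate_le hr hR hl hκ hH hA (hs q (hus hq))
            ((hu q₀ hq₀).trans (hu q hq).symm) (hmin q hq)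
          linarith
        · intro q hq q' hq' hne
          have : q.k₄ - q'.k₄ ≠ 0 := fun h => hne (inj q hq q' hq' (by omega))
          exact_mod_cast Int.one_le_abs this
      rw [div_one] at c2
      rw [le_div_iff₀ hμ0]
      have r1 : r ^ 2 ≤ r ^ 16 := pow_le_pow_right₀ hr (by norm_num)
      have k1 : 1 ≤ κ ^ 4 := one_le_pow₀ hκ
      rcases le_total (H ^ 2 * A / R ^ 2) (R ^ 2) with hc | hc
      · calc (u.card : ℝ) * μ ≤ (r ^ 2 * R ^ 2) * (2 * R ^ 2) := by
              gcongr; rw [hμ]; linarith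
          _ = 2 * r ^ 2 * 1 * R ^ 4 := by ring
          _ ≤ 514 * r ^ 16 * κ ^ 4 * R ^ 4 := by gcongr; norm_num
      · have hHA : H ^ 2 * A ≤ κ ^ 4 * R ^ 6 := by
          calc H ^ 2 * A ≤ H ^ 2 * (κ * H) := by gcongr
            _ = κ * H ^ 3 := by ring
            _ ≤ κ * (κ * R ^ 2) ^ 3 := by gcongr
            _ = _ := by ring
        have h1 : 1 ≤ κ ^ 4 * R ^ 6 / (H ^ 2 * A) := by rwa [one_le_div (by positivity)]
        calc (u.card : ℝ) * μ ≤ (κ ^ 4 * R ^ 6 / (H ^ 2 * A) + Z) * (2 * (H ^ 2 * A / R ^ 2)) := by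
              gcongr
              · linarith
              · rw [hμ]; linarith
          _ = (2 * 1 * κ ^ 4 + 256 * r ^ 16 * κ ^ 3) * R ^ 4 := by
              rw [hZ]; field_simp; ring
          _ ≤ (2 * r ^ 16 * κ ^ 4 + 256 * r ^ 16 * κ ^ 4) * R ^ 4 := by
              gcongr
              · exact one_le_pow₀ hr
              · norm_num
          _ ≤ _ := by
              have : 0 ≤ r ^ 16 * κ ^ 4 * R ^ 4 := by positivity
              linarith)
  calc (s.card : ℝ) ≤ _ := key
    _ ≤ ((4 * (16 * r ^ 6 * κ ^ 3) + 2) * r ^ 6 * κ ^ 6 * T ^ 2 * lam ^ 2 * μ) *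
        (514 * r ^ 16 * κ ^ 4 * R ^ 4 / μ) := by gcongr
    _ = 514 * (64 * r ^ 6 * κ ^ 3 + 2 * 1 * 1) * (r ^ 22 * κ ^ 10 * T ^ 2 * R ^ 4 * lam ^ 2) := by
        field_simp; ring
    _ ≤ 514 * (64 * r ^ 6 * κ ^ 3 + 2 * r ^ 6 * κ ^ 3) *
        (r ^ 22 * κ ^ 10 * T ^ 2 * R ^ 4 * lam ^ 2) := by
        gcongr
        · exact one_le_pow₀ hr
        · exact one_le_pow₀ hκ
    _ = _ := by ring

lemma card_primitive_box_le {r R lam κ H A T N : ℝ} (hr : 1 ≤ r) (hR : 0 < R) (hl : 0 < lam)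
    (hκ : 1 ≤ κ) (hH : 0 < H) (hA : 0 < A) (hT : SubpolyBound T N)
    (hN : 2 * r * lam ≤ N) (hN' : r * lam * (κ * H) ≤ N) (hN'' : κ * H ≤ N)
    (hAH : A ≤ κ * H) (hHR : H ≤ κ * R ^ 2)
    (s : Finset Quad) (hs : ∀ q ∈ s, Box r R lam κ H A q ∧ q.Primitive) :
    (s.card : ℝ) ≤ 33924 * r ^ 28 * κ ^ 13 * T ^ 2 * R ^ 4 * lam ^ 2 := by
  have hT1 := hT.one_le
  rcases le_total A lam with h | h
  · refine (card_le_of_fixed_nodes hr hR hl hκ hH hA hT hN'' hAH hHR h s hs).trans ?_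
    have : T ≤ T ^ 2 := le_self_pow₀ hT1 (by norm_num)
    gcongr <;> first | assumption | norm_num
  · exact card_le_of_fixed_shape hr hR hl hκ hH hA hT hN hN' hN'' hAH hHR h s
      (fun q hq => (hs q hq).1)

end

/-- The normalization of a quadruple by its symmetries. -/
structure Quad.Ordered (q : Quad) : Prop where
  k₂₁ : q.k₂ ≤ q.k₁
  k₄₃ : q.k₄ ≤ q.k₃
  k₃₁ : q.k₃ ≤ q.k₁

/-- The two pairs of nodes are far apart. -/
def Quad.Wide (X : ℝ) (q : Quad) : Prop :=
  X < max ((q.k₁ : ℝ) - q.k₃) |(q.k₂ : ℝ) - q.k₄|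

lemma Good.l_pos {r R lam : ℝ} {q : Quad} (hr : 1 ≤ r) (hl : 0 < lam) (h : Good r R lam q) :
    0 < q.l₁ ∧ 0 < q.l₂ ∧ 0 < q.l₃ ∧ 0 < q.l₄ :=
  ⟨int_pos_of_le_mul hr hl h.l₁ge, int_pos_of_le_mul hr hl h.l₂ge,
    int_pos_of_le_mul hr hl h.l₃ge, int_pos_of_le_mul hr hl h.l₄ge⟩

lemma Good.hull {r R lam : ℝ} {q : Quad} (hr : 1 ≤ r) (hl : 0 < lam) (h : Good r R lam q)
    (ho : q.Ordered) : q.k₂ ≤ q.k₃ ∧ q.k₄ ≤ q.k₁ := by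
  obtain ⟨p1, p2, p3, p4⟩ := h.l_pos hr hl
  have := ho.k₂₁
  have := ho.k₄₃
  have hs := h.sum
  have hm := h.mom
  refine ⟨?_, ho.k₄₃.trans ho.k₃₁⟩
  by_contra hc
  push Not at hc
  have e1 : q.l₃ * q.k₃ + q.l₄ * q.k₄ ≤ (q.l₁ + q.l₂) * q.k₃ := by rw [hs]; nlinarith
  nlinarith

lemma Good.wide_spacing {r R lam : ℝ} {q : Quad} (hr : 1 ≤ r) (hR : 0 < R) (hl : 0 < lam)
    (h : Good r R lam q) (ho : q.Ordered) (hw : q.Wide (6 * r ^ 3 * R)) :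
    (q.k₁ : ℝ) - q.k₂ ≤ 2 * r ^ 4 * (q.k₃ - q.k₄) ∧
    (q.k₃ : ℝ) - q.k₄ ≤ 2 * r ^ 4 * (q.k₁ - q.k₂) ∧
    0 < q.k₁ - q.k₃ ∧ 0 < q.k₂ - q.k₄ ∧
    (q.k₁ : ℝ) - q.k₃ ≤ 4 * r ^ 6 * (q.k₂ - q.k₄) ∧
    (q.k₂ : ℝ) - q.k₄ ≤ 4 * r ^ 6 * (q.k₁ - q.k₃) ∧
    (q.k₁ : ℝ) - q.k₃ ≤ max ((q.k₁ : ℝ) - q.k₂) (q.k₃ - q.k₄) ∧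
    (q.k₂ : ℝ) - q.k₄ ≤ max ((q.k₁ : ℝ) - q.k₂) (q.k₃ - q.k₄) := by
  have hr0 : 0 < r := by linarith
  obtain ⟨h23, h41⟩ := h.hull hr hl ho
  have o21 : (q.k₂ : ℝ) ≤ q.k₁ := by exact_mod_cast ho.k₂₁
  have o43 : (q.k₄ : ℝ) ≤ q.k₃ := by exact_mod_cast ho.k₄₃
  have o31 : (q.k₃ : ℝ) ≤ q.k₁ := by exact_mod_cast ho.k₃₁
  have o23 : (q.k₂ : ℝ) ≤ q.k₃ := by exact_mod_cast h23
  have o41 : (q.k₄ : ℝ) ≤ q.k₁ := by exact_mod_cast h41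
  have g := h.rgood hr hR hl
  obtain ⟨s1, s2, s3, s4⟩ := h.sqrt_sq hr hR
  have m13 : (q.k₁ : ℝ) - q.k₃ ≤ max ((q.k₁ : ℝ) - q.k₂) (q.k₃ - q.k₄) :=
    le_max_of_le_left (by linarith)
  have m24 : (q.k₂ : ℝ) - q.k₄ ≤ max ((q.k₁ : ℝ) - q.k₂) (q.k₃ - q.k₄) :=
    le_max_of_le_right (by linarith)
  have m42 : (q.k₄ : ℝ) - q.k₂ ≤ max ((q.k₁ : ℝ) - q.k₂) (q.k₃ - q.k₄) :=
    le_max_of_le_left (by linarith)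
  have mabs : |(q.k₂ : ℝ) - q.k₄| ≤ max ((q.k₁ : ℝ) - q.k₂) (q.k₃ - q.k₄) :=
    abs_le'.mpr ⟨m24, by linarith⟩
  have big : 6 * r ^ 3 * R < max ((q.k₁ : ℝ) - q.k₂) (q.k₃ - q.k₄) :=
    lt_of_lt_of_le hw (max_le m13 mabs)
  have t21 := Real.sqrt_le_sqrt o21
  have t43 := Real.sqrt_le_sqrt o43
  have t31 := Real.sqrt_le_sqrt o31
  obtain ⟨u12, v12⟩ := RGood.diff_bounds hr hR g.t₁ge g.t₁le g.t₂ge g.t₂le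
  obtain ⟨u34, v34⟩ := RGood.diff_bounds hr hR g.t₃ge g.t₃le g.t₄ge g.t₄le
  obtain ⟨u13, v13⟩ := RGood.diff_bounds hr hR g.t₁ge g.t₁le g.t₃ge g.t₃le
  obtain ⟨u24, v24⟩ := RGood.diff_bounds hr hR g.t₂ge g.t₂le g.t₄ge g.t₄le
  rw [s1, s2, abs_of_nonneg (sub_nonneg.mpr o21), abs_of_nonneg (sub_nonneg.mpr t21)] at u12 v12
  rw [s3, s4, abs_of_nonneg (sub_nonneg.mpr o43), abs_of_nonneg (sub_nonneg.mpr t43)] at u34 v34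
  rw [s1, s3, abs_of_nonneg (sub_nonneg.mpr o31), abs_of_nonneg (sub_nonneg.mpr t31)] at u13 v13
  rw [s2, s4] at u24 v24
  set t₁ := √(q.k₁ : ℝ)
  set t₂ := √(q.k₂ : ℝ)
  set t₃ := √(q.k₃ : ℝ)
  set t₄ := √(q.k₄ : ℝ)
  have h2rR : 0 < 2 * r * R := by positivity
  have conv : ∀ {x y : ℝ}, y ≤ 2 * r * R * x → 6 * r ^ 3 * R < y → 3 * r ^ 2 ≤ x := by
    intro x y h1 h2
    have : 2 * r * R * (3 * r ^ 2) ≤ 2 * r * R * x := by linarith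
    exact le_of_mul_le_mul_left this h2rR
  have B1 : 3 * r ^ 2 ≤ max (t₁ - t₂) (t₃ - t₄) := by
    rcases lt_max_iff.mp big with hb | hb
    · exact le_max_of_le_left (conv u12 hb)
    · exact le_max_of_le_right (conv u34 hb)
  have B2 : 3 * r ^ 2 ≤ max (t₁ - t₃) |t₂ - t₄| := by
    rcases lt_max_iff.mp hw with hb | hb
    · exact le_max_of_le_left (conv u13 hb)
    · exact le_max_of_le_right (conv u24 hb)
  have D1 := g.spacing_le t21 t43 B1
  have D2 := g.swap.spacing_le t43 t21 (by rwa [max_comm])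
  obtain ⟨q1, q2, q3, q4⟩ := g.main_range t21 t43 t31 B1 B2
  have e24 : t₂ ^ 2 - t₄ ^ 2 = (t₂ - t₄) * (t₂ + t₄) := by ring
  have hk24 : (0 : ℝ) < q.k₂ - q.k₄ := by
    rw [← s2, ← s4, e24]; exact mul_pos q2 (by linarith [g.t₂pos, g.t₄pos])
  have hk13 : (0 : ℝ) < q.k₁ - q.k₃ := by
    have : t₁ ^ 2 - t₃ ^ 2 = (t₁ - t₃) * (t₁ + t₃) := by ring
    rw [← s1, ← s3, this]; exact mul_pos q1 (by linarith [g.t₁pos, g.t₃pos])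
  rw [abs_of_pos q2, abs_of_pos hk24] at u24 v24
  have tr : ∀ {x y x' y' n : ℝ}, 0 ≤ n → x' ≤ 2 * r * R * x → x ≤ n * y → 2 * R * y ≤ r * y' →
      x' ≤ r ^ 2 * n * y' := by
    intro x y x' y' n hn h1 h2 h3
    calc x' ≤ 2 * r * R * x := h1
      _ ≤ 2 * r * R * (n * y) := by gcongr
      _ = r * n * (2 * R * y) := by ring
      _ ≤ r * n * (r * y') := by gcongr
      _ = _ := by ring
  refine ⟨?_, ?_, by exact_mod_cast hk13, by exact_mod_cast hk24, ?_, ?_, m13, m24⟩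
  · have := tr (by positivity) u12 D1 v34; linarith
  · have := tr (by positivity) u34 D2 v12; linarith
  · have := tr (by positivity) u13 q3 v24; linarith
  · have := tr (by positivity) u24 q4 v13; linarith

lemma two_pow_log_bounds {x : ℤ} (hx : 0 < x) :
    (2 : ℝ) ^ Nat.log 2 x.toNat ≤ x ∧ (x : ℝ) ≤ 2 * 2 ^ Nat.log 2 x.toNat := by
  have h1 : 2 ^ Nat.log 2 x.toNat ≤ x.toNat := Nat.pow_log_le_self 2 (by omega)
  have h2 : x.toNat < 2 ^ (Nat.log 2 x.toNat).succ := Nat.lt_pow_succ_log_self (by norm_num) _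
  have e : ((x.toNat : ℤ) : ℝ) = x := by rw [Int.toNat_of_nonneg hx.le]
  have e' : ((x.toNat : ℕ) : ℝ) = x := by exact_mod_cast e
  rw [← e']
  constructor
  · exact_mod_cast h1
  · have : (x.toNat : ℝ) ≤ 2 ^ (Nat.log 2 x.toNat).succ := by exact_mod_cast h2.le
    rw [pow_succ] at this; linarith

lemma Good.wide_box {r R lam : ℝ} {q : Quad} (hr : 1 ≤ r) (hR : 0 < R) (hl : 0 < lam)
    (h : Good r R lam q) (ho : q.Ordered) (hw : q.Wide (6 * r ^ 3 * R)) :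
    let H : ℝ := 2 ^ Nat.log 2 (q.k₁ - q.k₂).toNat
    let A : ℝ := 2 ^ Nat.log 2 (q.k₁ - q.k₃).toNat
    Box r R lam (16 * r ^ 6) H A q ∧ A ≤ 16 * r ^ 6 * H ∧ H ≤ 16 * r ^ 6 * R ^ 2 := by
  intro H A
  obtain ⟨w1, w2, w3, w4, w5, w6, w7, w8⟩ := h.wide_spacing hr hR hl ho hw
  have w3' : (0 : ℝ) < q.k₁ - q.k₃ := by exact_mod_cast w3
  have w4' : (0 : ℝ) < q.k₂ - q.k₄ := by exact_mod_cast w4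
  have hr4 : 1 ≤ r ^ 4 := one_le_pow₀ hr
  have hr6 : r ^ 4 ≤ r ^ 6 := pow_le_pow_right₀ hr (by norm_num)
  have hr2 : r ^ 2 ≤ r ^ 6 := pow_le_pow_right₀ hr (by norm_num)
  have hd : 0 < q.k₁ - q.k₂ := by
    rcases lt_or_ge 0 (q.k₁ - q.k₂) with hc | hc
    · exact hc
    · have hc' : (q.k₁ : ℝ) - q.k₂ ≤ 0 := by exact_mod_cast hc
      have : (q.k₃ : ℝ) - q.k₄ ≤ 0 := by nlinarith
      have := max_le hc' this
      linarith
  obtain ⟨H1, H2⟩ := two_pow_log_bounds hd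
  obtain ⟨A1, A2⟩ := two_pow_log_bounds w3
  change H ≤ _ at H1
  change _ ≤ 2 * H at H2
  change A ≤ _ at A1
  change _ ≤ 2 * A at A2
  push_cast at H1 H2 A1 A2
  have hH : 0 < H := by positivity
  have hA : 0 < A := by positivity
  have hmax : max ((q.k₁ : ℝ) - q.k₂) (q.k₃ - q.k₄) ≤ 2 * r ^ 4 * (q.k₁ - q.k₂) :=
    max_le (by nlinarith) w2
  have hmaxH : max ((q.k₁ : ℝ) - q.k₂) (q.k₃ - q.k₄) ≤ 4 * r ^ 4 * H := by
    refine hmax.trans ?_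
    calc _ ≤ 2 * r ^ 4 * (2 * H) := by gcongr
      _ = _ := by ring
  have hk2 : (0 : ℝ) < q.k₂ := by exact_mod_cast one_le_of_le_sq_mul hr hR h.k₂ge
  have r4H : r ^ 4 * H ≤ r ^ 6 * H := by gcongr
  have r1H : H ≤ r ^ 4 * H := by nlinarith
  have r6A : A ≤ r ^ 6 * A := by nlinarith
  refine ⟨⟨h, ?_, ?_, ?_, ?_, ?_, ?_, ?_, ?_, ?_, ?_⟩, ?_, ?_⟩
  · nlinarith
  · linarith
  · nlinarith
  · linarith [le_max_right ((q.k₁ : ℝ) - q.k₂) (q.k₃ - q.k₄)]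
  · nlinarith
  · linarith
  · nlinarith
  · linarith
  · nlinarith
  · nlinarith
  · linarith
  · have : r ^ 2 * R ^ 2 ≤ r ^ 6 * R ^ 2 := by gcongr
    have h0 : 0 ≤ r ^ 6 * R ^ 2 := by positivity
    linarith [h.k₁le]

section
open Classical

lemma card_wide_primitive_le {r R lam T N : ℝ} (hr : 1 ≤ r) (hR : 1 ≤ R) (hl : 0 < lam)
    (hlR : lam ≤ R ^ 2) (hT : SubpolyBound T N) (hN : 512 * r ^ 13 * R ^ 4 ≤ N)
    (s : Finset Quad)
    (hs : ∀ q ∈ s, Good r R lam q ∧ q.Ordered ∧ q.Wide (6 * r ^ 3 * R) ∧ q.Primitive) :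
    (s.card : ℝ) ≤ 33924 * r ^ 28 * (16 * r ^ 6) ^ 13 * T ^ 4 * R ^ 4 * lam ^ 2 := by
  have hr0 : 0 < r := by linarith
  have hR0 : 0 < R := by linarith
  have hT1 := hT.one_le
  have hκ : 1 ≤ 16 * r ^ 6 := by linarith [one_le_pow₀ (n := 6) hr]
  have hR24 : R ^ 2 ≤ R ^ 4 := pow_le_pow_right₀ hR (by norm_num)
  have hN1 : r ^ 2 * R ^ 2 ≤ N := by
    calc r ^ 2 * R ^ 2 ≤ r ^ 13 * R ^ 4 := by gcongr <;> first | assumption | norm_num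
      _ ≤ 512 * r ^ 13 * R ^ 4 := by
        have : 0 ≤ r ^ 13 * R ^ 4 := by positivity
        linarith
      _ ≤ N := hN
  set m := ⌊r ^ 2 * R ^ 2⌋₊
  have hm : (m : ℝ) ≤ N := (Nat.floor_le (by positivity)).trans hN1
  have hlogm := hT.log m hm
  have kle : ∀ {q : Quad}, Good r R lam q → ∀ k : ℤ, 0 < k → (q.k₁ - k).toNat ≤ m := by
    intro q hq k hk
    apply Nat.le_floor
    have h1 := hq.k₁le
    rcases le_total 0 (q.k₁ - k) with hc | hc
    · have e : (((q.k₁ - k).toNat : ℤ) : ℝ) = ((q.k₁ - k : ℤ) : ℝ) := by rw [Int.toNat_of_nonneg hc]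
      have e' : (((q.k₁ - k).toNat : ℕ) : ℝ) = ((q.k₁ - k : ℤ) : ℝ) := by exact_mod_cast e
      rw [e']
      have : (0 : ℝ) < k := by exact_mod_cast hk
      push_cast; linarith
    · rw [Int.toNat_of_nonpos hc]; simp; positivity
  have key := card_le_mul_of_fiber s
    (fun q => (Nat.log 2 (q.k₁ - q.k₂).toNat, Nat.log 2 (q.k₁ - q.k₃).toNat))
    (Finset.range (Nat.log 2 m + 1) ×ˢ Finset.range (Nat.log 2 m + 1))
    (fun q hq => by
      have h := (hs q hq).1
      simp only [Finset.mem_product, Finset.mem_range, Nat.lt_succ_iff]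
      exact ⟨Nat.log_mono_right (kle h _ (one_le_of_le_sq_mul hr hR0 h.k₂ge)),
        Nat.log_mono_right (kle h _ (one_le_of_le_sq_mul hr hR0 h.k₃ge))⟩)
    (33924 * r ^ 28 * (16 * r ^ 6) ^ 13 * T ^ 2 * R ^ 4 * lam ^ 2)
    (by
      rintro ⟨i, j⟩ - u hus hu
      rcases Finset.eq_empty_or_nonempty u with rfl | ⟨q₀, hq₀⟩
      · simp; positivity
      have hb : ∀ q ∈ u, Box r R lam (16 * r ^ 6) (2 ^ i) (2 ^ j) q ∧
          (2 : ℝ) ^ j ≤ 16 * r ^ 6 * 2 ^ i ∧ (2 : ℝ) ^ i ≤ 16 * r ^ 6 * R ^ 2 := by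
        intro q hq
        have h := hs q (hus hq)
        have hbox := h.1.wide_box hr hR0 hl h.2.1 h.2.2.1
        have := hu q hq
        simp only [Prod.mk.injEq] at this
        simp only [this.1, this.2] at hbox
        exact hbox
      obtain ⟨-, hAH, hHR⟩ := hb q₀ hq₀
      have hκH : 16 * r ^ 6 * 2 ^ i ≤ 256 * r ^ 12 * R ^ 2 := by
        calc 16 * r ^ 6 * 2 ^ i ≤ 16 * r ^ 6 * (16 * r ^ 6 * R ^ 2) := by gcongr
          _ = _ := by ring
      refine card_primitive_box_le hr hR0 hl hκ (by positivity) (by positivity) hT ?_ ?_ ?_ hAH hHR u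
        (fun q hq => ⟨(hb q hq).1, (hs q (hus hq)).2.2.2⟩)
      · calc 2 * r * lam ≤ 2 * r * R ^ 2 := by gcongr
          _ = 2 * r ^ 1 * R ^ 2 := by ring
          _ ≤ 512 * r ^ 13 * R ^ 4 := by gcongr <;> first | assumption | norm_num
          _ ≤ N := hN
      · calc r * lam * (16 * r ^ 6 * 2 ^ i) ≤ r * R ^ 2 * (256 * r ^ 12 * R ^ 2) := by gcongr
          _ = 256 * r ^ 13 * R ^ 4 := by ring
          _ ≤ 512 * r ^ 13 * R ^ 4 := by gcongr; norm_num
          _ ≤ N := hN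
      · calc 16 * r ^ 6 * 2 ^ i ≤ 256 * r ^ 12 * R ^ 2 := hκH
          _ ≤ 512 * r ^ 13 * R ^ 4 := by gcongr <;> first | assumption | norm_num
          _ ≤ N := hN)
  refine key.trans ?_
  rw [Finset.card_product, Finset.card_range]
  push_cast
  calc _ ≤ (T * T) * (33924 * r ^ 28 * (16 * r ^ 6) ^ 13 * T ^ 2 * R ^ 4 * lam ^ 2) := by
        gcongr
    _ = _ := by ring

/-- The greatest common divisor of the weights. -/
def Quad.content (q : Quad) : ℕ := Int.gcd (Int.gcd q.l₁ q.l₂) (Int.gcd q.l₃ q.l₄)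

lemma Quad.content_dvd (q : Quad) : (q.content : ℤ) ∣ q.l₁ ∧ (q.content : ℤ) ∣ q.l₂ ∧
    (q.content : ℤ) ∣ q.l₃ ∧ (q.content : ℤ) ∣ q.l₄ :=
  ⟨(Int.gcd_dvd_left _ _).trans (Int.gcd_dvd_left _ _),
    (Int.gcd_dvd_left _ _).trans (Int.gcd_dvd_right _ _),
    (Int.gcd_dvd_right _ _).trans (Int.gcd_dvd_left _ _),
    (Int.gcd_dvd_right _ _).trans (Int.gcd_dvd_right _ _)⟩

lemma Quad.content_bezout (q : Quad) : ∃ c₁ c₂ c₃ c₄ : ℤ,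
    (q.content : ℤ) = c₁ * q.l₁ + c₂ * q.l₂ + c₃ * q.l₃ + c₄ * q.l₄ := by
  refine ⟨q.l₁.gcdA q.l₂ * Int.gcdA (Int.gcd q.l₁ q.l₂) (Int.gcd q.l₃ q.l₄),
    q.l₁.gcdB q.l₂ * Int.gcdA (Int.gcd q.l₁ q.l₂) (Int.gcd q.l₃ q.l₄),
    q.l₃.gcdA q.l₄ * Int.gcdB (Int.gcd q.l₁ q.l₂) (Int.gcd q.l₃ q.l₄),
    q.l₃.gcdB q.l₄ * Int.gcdB (Int.gcd q.l₁ q.l₂) (Int.gcd q.l₃ q.l₄), ?_⟩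
  have h1 := Int.gcd_eq_gcd_ab q.l₁ q.l₂
  have h2 := Int.gcd_eq_gcd_ab q.l₃ q.l₄
  have h3 := Int.gcd_eq_gcd_ab (Int.gcd q.l₁ q.l₂) (Int.gcd q.l₃ q.l₄)
  rw [content, h3]
  linear_combination Int.gcdA (Int.gcd q.l₁ q.l₂) (Int.gcd q.l₃ q.l₄) * h1 +
    Int.gcdB (Int.gcd q.l₁ q.l₂) (Int.gcd q.l₃ q.l₄) * h2

/-- Divide the weights by `j`. -/
def Quad.divWeights (j : ℕ) (q : Quad) : Quad :=
  ⟨q.k₁, q.k₂, q.k₃, q.k₄, q.l₁ / j, q.l₂ / j, q.l₃ / j, q.l₄ / j⟩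

lemma Good.divWeights {r R lam : ℝ} {q : Quad} {j : ℕ} (hj : 0 < j) (h : Good r R lam q)
    (hc : q.content = j) : Good r R (lam / j) (q.divWeights j) ∧ (q.divWeights j).Primitive := by
  obtain ⟨⟨x₁, h1⟩, ⟨x₂, h2⟩, ⟨x₃, h3⟩, ⟨x₄, h4⟩⟩ := q.content_dvd
  obtain ⟨c₁, c₂, c₃, c₄, hb⟩ := q.content_bezout
  rw [hc] at h1 h2 h3 h4 hb
  have hj' : (j : ℤ) ≠ 0 := by omega
  have hjR : (0 : ℝ) < j := by exact_mod_cast hj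
  have e1 : q.l₁ / j = x₁ := by rw [h1, Int.mul_ediv_cancel_left _ hj']
  have e2 : q.l₂ / j = x₂ := by rw [h2, Int.mul_ediv_cancel_left _ hj']
  have e3 : q.l₃ / j = x₃ := by rw [h3, Int.mul_ediv_cancel_left _ hj']
  have e4 : q.l₄ / j = x₄ := by rw [h4, Int.mul_ediv_cancel_left _ hj']
  have lo : ∀ {x l : ℤ}, l = j * x → lam ≤ r * l → lam / j ≤ r * x := by
    rintro x l rfl hx
    rw [div_le_iff₀ hjR]; push_cast at hx; linarith
  have hi : ∀ {x l : ℤ}, l = j * x → l ≤ r * lam → x ≤ r * (lam / j) := by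
    rintro x l rfl hx
    rw [← mul_div_assoc, le_div_iff₀ hjR]; push_cast at hx; linarith
  constructor
  · refine ⟨h.k₁ge, h.k₁le, h.k₂ge, h.k₂le, h.k₃ge, h.k₃le, h.k₄ge, h.k₄le, ?_, ?_, ?_, ?_, ?_, ?_,
      ?_, ?_, ?_, ?_, ?_⟩ <;> simp only [Quad.divWeights, e1, e2, e3, e4]
    · exact lo h1 h.l₁ge
    · exact hi h1 h.l₁le
    · exact lo h2 h.l₂ge
    · exact hi h2 h.l₂le
    · exact lo h3 h.l₃ge
    · exact hi h3 h.l₃le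
    · exact lo h4 h.l₄ge
    · exact hi h4 h.l₄le
    · apply mul_left_cancel₀ hj'
      have := h.sum
      rw [h1, h2, h3, h4] at this
      linarith
    · apply mul_left_cancel₀ hj'
      have := h.mom
      rw [h1, h2, h3, h4] at this
      linarith
    · have := h.root
      rw [h1, h2, h3, h4] at this
      push_cast at this
      rw [le_div_iff₀ hjR]
      have e : (j : ℝ) * x₁ * √(q.k₁ : ℝ) + j * x₂ * √(q.k₂ : ℝ) - j * x₃ * √(q.k₃ : ℝ) -
          j * x₄ * √(q.k₄ : ℝ) =
          j * (x₁ * √(q.k₁ : ℝ) + x₂ * √(q.k₂ : ℝ) - x₃ * √(q.k₃ : ℝ) - x₄ * √(q.k₄ : ℝ)) := by ring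
      rw [e, abs_mul, abs_of_pos hjR] at this
      linarith
  · refine ⟨c₁, c₂, c₃, c₄, ?_⟩
    simp only [Quad.divWeights, e1, e2, e3, e4]
    rw [h1, h2, h3, h4] at hb
    apply mul_left_cancel₀ hj'
    linear_combination -hb

lemma Quad.divWeights_injOn {j : ℕ} {q q' : Quad} (h : q.content = j) (h' : q'.content = j)
    (he : q.divWeights j = q'.divWeights j) : q = q' := by
  obtain ⟨d1, d2, d3, d4⟩ := q.content_dvd
  obtain ⟨d1', d2', d3', d4'⟩ := q'.content_dvd
  rw [h] at d1 d2 d3 d4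
  rw [h'] at d1' d2' d3' d4'
  simp only [divWeights, Quad.mk.injEq] at he
  obtain ⟨i1, i2, i3, i4, j1, j2, j3, j4⟩ := he
  exact Quad.ext i1 i2 i3 i4 ((Int.ediv_left_inj d1 d1').mp j1) ((Int.ediv_left_inj d2 d2').mp j2)
    ((Int.ediv_left_inj d3 d3').mp j3) ((Int.ediv_left_inj d4 d4').mp j4)

lemma card_wide_le {r R L T N : ℝ} (hr : 1 ≤ r) (hR : 1 ≤ R) (hL : 0 < L)
    (hLR : L ≤ R ^ 2) (hT : SubpolyBound T N) (hN : 512 * r ^ 13 * R ^ 4 ≤ N)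
    (s : Finset Quad) (hs : ∀ q ∈ s, Good r R L q ∧ q.Ordered ∧ q.Wide (6 * r ^ 3 * R)) :
    (s.card : ℝ) ≤ 33924 * r ^ 28 * (16 * r ^ 6) ^ 13 * T ^ 5 * R ^ 4 * L ^ 2 := by
  have hr0 : 0 < r := by linarith
  have hT1 := hT.one_le
  have key := card_le_sum_of_fiber s (fun q => (q.content : ℤ)) (upTo (r * L))
    (fun q hq => by
      have h := (hs q hq).1
      have hl := (h.l_pos hr hL).1
      have hdvd := q.content_dvd.1
      rw [mem_upTo]
      have hpos : 0 < (q.content : ℤ) := by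
        rcases Nat.eq_zero_or_pos q.content with h0 | h0
        · rw [h0] at hdvd; simp at hdvd; omega
        · exact_mod_cast h0
      refine ⟨hpos, ?_⟩
      have := Int.le_of_dvd hl hdvd
      exact le_trans (by exact_mod_cast this) h.l₁le)
    (fun j => 33924 * r ^ 28 * (16 * r ^ 6) ^ 13 * T ^ 4 * R ^ 4 * L ^ 2 * (1 / (j : ℝ)))
    (by
      intro j hj u hus hu
      rw [mem_upTo] at hj
      obtain ⟨n, rfl⟩ := Int.eq_ofNat_of_zero_le (by omega : 0 ≤ j)
      have hn : 0 < n := by omega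
      have hn0 : (1 : ℝ) ≤ n := by exact_mod_cast hn
      have hcn : ∀ q ∈ u, q.content = n := fun q hq => by exact_mod_cast hu q hq
      have hcard : (u.image (Quad.divWeights n)).card = u.card :=
        Finset.card_image_of_injOn fun q hq q' hq' he =>
          Quad.divWeights_injOn (hcn q hq) (hcn q' hq') he
      have := card_wide_primitive_le (lam := L / n) hr hR (by positivity)
        ((div_le_self hL.le hn0).trans hLR) hT hN (u.image (Quad.divWeights n)) (by
          intro p hp
          obtain ⟨q, hq, rfl⟩ := Finset.mem_image.mp hp
          obtain ⟨h1, h2, h3⟩ := hs q (hus hq)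
          obtain ⟨g1, g2⟩ := h1.divWeights hn (hcn q hq)
          exact ⟨g1, ⟨h2.k₂₁, h2.k₄₃, h2.k₃₁⟩, h3, g2⟩)
      rw [hcard] at this
      refine this.trans ?_
      rw [div_pow, Int.cast_natCast, mul_assoc _ (L ^ 2)]
      have h1 : (n : ℝ) ≤ n ^ 2 := le_self_pow₀ hn0 (by norm_num)
      have h2 : L ^ 2 / (n : ℝ) ^ 2 ≤ L ^ 2 * (1 / n) := by
        rw [mul_one_div]; gcongr
      gcongr)
  refine key.trans ?_
  rw [← Finset.mul_sum]
  have := sum_upTo_inv_le hT (x := r * L) (by positivity) (by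
    calc r * L ≤ r * R ^ 2 := by gcongr
      _ = 1 * r ^ 1 * R ^ 2 := by ring
      _ ≤ 512 * r ^ 13 * R ^ 4 := by gcongr <;> first | assumption | norm_num
      _ ≤ N := hN)
  calc _ ≤ 33924 * r ^ 28 * (16 * r ^ 6) ^ 13 * T ^ 4 * R ^ 4 * L ^ 2 * T := by gcongr
    _ = _ := by ring

end

section
open Classical

lemma card_diagonal_le {r R L : ℝ} (hr : 1 ≤ r) (hR : 1 ≤ R) (hL : 0 < L)
    (s : Finset Quad)
    (hs : ∀ q ∈ s, Good r R L q ∧ q.l₁ = q.l₃ ∧ q.k₁ = q.k₃) :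
    (s.card : ℝ) ≤ r ^ 6 * R ^ 4 * L ^ 2 := by
  have hr0 : 0 < r := by linarith
  have hR0 : 0 < R := by linarith
  have hc := Finset.card_le_card_of_injOn (s := s)
    (t := upTo (r ^ 2 * R ^ 2) ×ˢ upTo (r ^ 2 * R ^ 2) ×ˢ upTo (r * L) ×ˢ upTo (r * L))
    (fun q => (q.k₁, q.k₂, q.l₁, q.l₂))
    (fun q hq => by
      have h := (hs q hq).1
      obtain ⟨p1, p2, -, -⟩ := h.l_pos hr hL
      simp only [Finset.mem_coe, Finset.mem_product, mem_upTo]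
      exact ⟨⟨one_le_of_le_sq_mul hr hR0 h.k₁ge, h.k₁le⟩,
        ⟨one_le_of_le_sq_mul hr hR0 h.k₂ge, h.k₂le⟩, ⟨p1, h.l₁le⟩, ⟨p2, h.l₂le⟩⟩)
    (fun q hq q' hq' he => by
      simp only [Prod.mk.injEq] at he
      obtain ⟨e1, e2, e3, e4⟩ := he
      have h24 : ∀ q ∈ s, q.l₂ = q.l₄ ∧ q.k₂ = q.k₄ := by
        intro q hq
        obtain ⟨h, h13, k13⟩ := hs q hq
        have hl : q.l₂ = q.l₄ := by have := h.sum; omega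
        refine ⟨hl, ?_⟩
        have := h.mom
        rw [h13, k13, ← hl] at this
        exact mul_left_cancel₀ (h.l_pos hr hL).2.1.ne' (by linarith)
      obtain ⟨-, a1, a2⟩ := hs q hq
      obtain ⟨-, b1, b2⟩ := hs q' hq'
      obtain ⟨a3, a4⟩ := h24 q hq
      obtain ⟨b3, b4⟩ := h24 q' hq'
      apply Quad.ext <;> omega)
  simp only [Finset.card_product] at hc
  rw [← Nat.cast_le (α := ℝ)] at hc
  push_cast at hc
  have hk : ((upTo (r ^ 2 * R ^ 2)).card : ℝ) ≤ r ^ 2 * R ^ 2 := card_upTo (by positivity)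
  have hl : ((upTo (r * L)).card : ℝ) ≤ r * L := card_upTo (by positivity)
  calc (s.card : ℝ) ≤ _ := hc
    _ ≤ (r ^ 2 * R ^ 2) * ((r ^ 2 * R ^ 2) * ((r * L) * (r * L))) := by gcongr
    _ = _ := by ring

lemma card_equal_weights_le {r R L T N : ℝ} (hr : 1 ≤ r) (hR : 1 ≤ R) (hL : 1 ≤ L)
    (hLR : L ≤ R ^ 2) (hT : SubpolyBound T N) (hN : 512 * r ^ 13 * R ^ 4 ≤ N)
    (s : Finset Quad)
    (hs : ∀ q ∈ s, Good r R L q ∧ q.Ordered ∧ q.l₁ = q.l₃ ∧ q.k₃ < q.k₁) :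
    (s.card : ℝ) ≤ 9 * r ^ 7 * T ^ 2 * R ^ 4 * L ^ 2 := by
  have hr0 : 0 < r := by linarith
  have hR0 : 0 < R := by linarith
  have hL0 : 0 < L := by linarith
  have hT1 := hT.one_le
  have hR24 : R ^ 2 ≤ R ^ 4 := pow_le_pow_right₀ hR (by norm_num)
  have base : ∀ q ∈ s, q.l₂ = q.l₄ ∧ q.l₁ * (q.k₁ - q.k₃) = q.l₂ * (q.k₄ - q.k₂) := by
    intro q hq
    obtain ⟨h, -, h13, -⟩ := hs q hq
    have hl : q.l₂ = q.l₄ := by have := h.sum; omega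
    refine ⟨hl, ?_⟩
    have := h.mom
    rw [← h13, ← hl] at this
    linarith
  have key := card_le_sum_of_fiber s
    (fun q => (q.k₁, q.l₁, q.k₁ - q.k₃))
    (upTo (r ^ 2 * R ^ 2) ×ˢ upTo (r * L) ×ˢ upTo (r ^ 2 * R ^ 2))
    (fun q hq => by
      obtain ⟨h, -, -, hlt⟩ := hs q hq
      simp only [Finset.mem_product, mem_upTo]
      refine ⟨⟨one_le_of_le_sq_mul hr hR0 h.k₁ge, h.k₁le⟩, ⟨(h.l_pos hr hL0).1, h.l₁le⟩,
        by omega, ?_⟩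
      have : (1 : ℝ) ≤ q.k₃ := by exact_mod_cast one_le_of_le_sq_mul hr hR0 h.k₃ge
      push_cast; linarith [h.k₁le])
    (fun y => (1 + 8 * r ^ 4 * R ^ 2 * (1 / (y.2.2 : ℝ))) * T)
    (by
      rintro ⟨k, l, a⟩ hy u hus hu
      simp only [Finset.mem_product, mem_upTo] at hy
      obtain ⟨⟨hk, hk'⟩, ⟨hl, hl'⟩, ha, ha'⟩ := hy
      have ha0 : (0 : ℝ) < a := by exact_mod_cast ha
      have mem : ∀ q ∈ u, q.k₁ = k ∧ q.l₁ = l ∧ q.k₁ - q.k₃ = a := by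
        intro q hq
        simpa only [Prod.mk.injEq] using hu q hq
      have inner := card_le_mul_of_fiber u (fun q => q.k₁ - q.k₂ + 1)
        (upTo (1 + 8 * r ^ 4 * R ^ 2 * (1 / (a : ℝ))))
        (fun q hq => by
          obtain ⟨h, ho, h13, hlt⟩ := hs q (hus hq)
          have h21 := ho.k₂₁
          have g := h.rgood hr hR0 hL0
          have e21 : (q.k₂ : ℝ) ≤ q.k₁ := by exact_mod_cast ho.k₂₁
          have e43 : (q.k₄ : ℝ) ≤ q.k₃ := by exact_mod_cast ho.k₄₃
          have e31 : (q.k₃ : ℝ) ≤ q.k₁ := by exact_mod_cast ho.k₃₁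
          have D := g.degenerate (by exact_mod_cast h13) (Real.sqrt_le_sqrt e21)
            (Real.sqrt_le_sqrt e43) (Real.sqrt_le_sqrt e31)
          obtain ⟨s1, s2, s3, s4⟩ := h.sqrt_sq hr hR0
          rw [s1, s2, s3] at D
          have hka : (q.k₁ : ℝ) - q.k₃ = a := by exact_mod_cast (mem q hq).2.2
          rw [hka] at D
          rw [mem_upTo]
          refine ⟨by omega, ?_⟩
          push_cast
          have : (q.k₁ : ℝ) - q.k₂ ≤ 8 * r ^ 4 * R ^ 2 * (1 / (a : ℝ)) := by
            rw [mul_one_div, le_div_iff₀ ha0]; linarith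
          linarith) T
        (by
          intro y _ w hwu hw
          have hn : l * a ≠ 0 := by positivity
          apply card_le_of_dvd hT w (fun q => q.l₂) hn
          · have h1 : (0 : ℝ) < l := by exact_mod_cast hl
            push_cast
            rw [abs_of_pos (by positivity)]
            calc (l : ℝ) * a ≤ (r * R ^ 2) * (r ^ 2 * R ^ 2) := by
                  gcongr
                  exact hl'.trans (by gcongr)
              _ = 1 * r ^ 3 * R ^ 4 := by ring
              _ ≤ 512 * r ^ 13 * R ^ 4 := by gcongr <;> first | assumption | norm_num
              _ ≤ N := hN
          · intro q hq; exact ((hs q (hus (hwu hq))).1.l_pos hr hL0).2.1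
          · intro q hq
            obtain ⟨i1, i2, i3⟩ := mem q (hwu hq)
            refine ⟨q.k₄ - q.k₂, ?_⟩
            rw [← (base q (hus (hwu hq))).2, i2, i3]
          · intro q hq q' hq' he
            have he' : q.l₂ = q'.l₂ := he
            obtain ⟨i1, i2, i3⟩ := mem q (hwu hq)
            obtain ⟨i1', i2', i3'⟩ := mem q' (hwu hq')
            obtain ⟨b1, b2⟩ := base q (hus (hwu hq))
            obtain ⟨b1', b2'⟩ := base q' (hus (hwu hq'))
            have w1 := hw q hq
            have w2 := hw q' hq'
            have m1 := (hs q (hus (hwu hq))).2.2.1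
            have m2 := (hs q' (hus (hwu hq'))).2.2.1
            rw [i2, i3] at b2
            rw [i2', i3'] at b2'
            have h4 : q.k₄ - q.k₂ = q'.k₄ - q'.k₂ := by
              apply mul_left_cancel₀ ((hs q (hus (hwu hq))).1.l_pos hr hL0).2.1.ne'
              rw [← b2, he', ← b2']
            apply Quad.ext <;> omega)
      refine inner.trans ?_
      gcongr
      exact card_upTo (by positivity))
  refine key.trans ?_
  simp only [Finset.sum_product]
  have hk : ((upTo (r ^ 2 * R ^ 2)).card : ℝ) ≤ r ^ 2 * R ^ 2 := card_upTo (by positivity)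
  have hl : ((upTo (r * L)).card : ℝ) ≤ r * L := card_upTo (by positivity)
  have hharm := sum_upTo_inv_le hT (x := r ^ 2 * R ^ 2) (by positivity) (by
    calc r ^ 2 * R ^ 2 = 1 * r ^ 2 * R ^ 2 := by ring
      _ ≤ 512 * r ^ 13 * R ^ 4 := by gcongr <;> first | assumption | norm_num
      _ ≤ N := hN)
  have inner : ∑ a ∈ upTo (r ^ 2 * R ^ 2), (1 + 8 * r ^ 4 * R ^ 2 * (1 / (a : ℝ))) * T ≤
      9 * r ^ 4 * R ^ 2 * T ^ 2 := by
    rw [← Finset.sum_mul, Finset.sum_add_distrib, ← Finset.mul_sum]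
    simp only [Finset.sum_const, nsmul_eq_mul, mul_one]
    calc _ ≤ (r ^ 2 * R ^ 2 + 8 * r ^ 4 * R ^ 2 * T) * T := by gcongr
      _ = (r ^ 2 * 1 + 8 * r ^ 4 * T) * (R ^ 2 * T) := by ring
      _ ≤ (r ^ 4 * T + 8 * r ^ 4 * T) * (R ^ 2 * T) := by
        gcongr <;> first | assumption | norm_num
      _ = _ := by ring
  calc _ ≤ ∑ _x ∈ upTo (r ^ 2 * R ^ 2), ∑ _y ∈ upTo (r * L), 9 * r ^ 4 * R ^ 2 * T ^ 2 := by
        gcongr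
    _ = ((upTo (r ^ 2 * R ^ 2)).card : ℝ) * (((upTo (r * L)).card : ℝ) *
          (9 * r ^ 4 * R ^ 2 * T ^ 2)) := by
        simp only [Finset.sum_const, nsmul_eq_mul]
    _ ≤ (r ^ 2 * R ^ 2) * ((r * L) * (9 * r ^ 4 * R ^ 2 * T ^ 2)) := by gcongr
    _ = 9 * r ^ 7 * T ^ 2 * R ^ 4 * L ^ 1 := by ring
    _ ≤ _ := by gcongr; norm_num

lemma card_equal_nodes_le {r R L : ℝ} (hr : 1 ≤ r) (hR : 1 ≤ R) (hL : 0 < L)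
    (hLR : L ≤ R ^ 2) (s : Finset Quad)
    (hs : ∀ q ∈ s, Good r R L q ∧ q.k₂ = q.k₁ ∧ q.k₃ = q.k₁ ∧ q.k₄ = q.k₁) :
    (s.card : ℝ) ≤ r ^ 5 * R ^ 4 * L ^ 2 := by
  have hr0 : 0 < r := by linarith
  have hR0 : 0 < R := by linarith
  have hc := Finset.card_le_card_of_injOn (s := s)
    (t := upTo (r ^ 2 * R ^ 2) ×ˢ upTo (r * L) ×ˢ upTo (r * L) ×ˢ upTo (r * L))
    (fun q => (q.k₁, q.l₁, q.l₂, q.l₃))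
    (fun q hq => by
      have h := (hs q hq).1
      obtain ⟨p1, p2, p3, -⟩ := h.l_pos hr hL
      simp only [Finset.mem_coe, Finset.mem_product, mem_upTo]
      exact ⟨⟨one_le_of_le_sq_mul hr hR0 h.k₁ge, h.k₁le⟩,
        ⟨p1, h.l₁le⟩, ⟨p2, h.l₂le⟩, ⟨p3, h.l₃le⟩⟩)
    (fun q hq q' hq' he => by
      simp only [Prod.mk.injEq] at he
      obtain ⟨e1, e2, e3, e4⟩ := he
      obtain ⟨a0, a1, a2, a3⟩ := hs q hq
      obtain ⟨b0, b1, b2, b3⟩ := hs q' hq'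
      have := a0.sum
      have := b0.sum
      apply Quad.ext <;> omega)
  simp only [Finset.card_product] at hc
  rw [← Nat.cast_le (α := ℝ)] at hc
  push_cast at hc
  have hk : ((upTo (r ^ 2 * R ^ 2)).card : ℝ) ≤ r ^ 2 * R ^ 2 := card_upTo (by positivity)
  have hl : ((upTo (r * L)).card : ℝ) ≤ r * L := card_upTo (by positivity)
  calc (s.card : ℝ) ≤ _ := hc
    _ ≤ (r ^ 2 * R ^ 2) * ((r * L) * ((r * L) * (r * L))) := by gcongr
    _ = r ^ 5 * R ^ 2 * L ^ 2 * L := by ring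
    _ ≤ r ^ 5 * R ^ 2 * L ^ 2 * R ^ 2 := by gcongr
    _ = _ := by ring

lemma card_symm_Icc_le {y : ℝ} (hy : 1 ≤ y) :
    ((Finset.Icc (-⌊y⌋) ⌊y⌋).card : ℝ) ≤ 3 * y := by
  have h0 : 0 ≤ ⌊y⌋ := Int.floor_nonneg.mpr (by linarith)
  rw [Int.card_Icc]
  have e : ((⌊y⌋ + 1 - -⌊y⌋).toNat : ℤ) = ⌊y⌋ + 1 - -⌊y⌋ := Int.toNat_of_nonneg (by omega)
  have e' : ((⌊y⌋ + 1 - -⌊y⌋).toNat : ℝ) = ⌊y⌋ + 1 - -⌊y⌋ := by exact_mod_cast e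
  rw [e']
  linarith [Int.floor_le y]

lemma mem_symm_Icc {y : ℝ} {n : ℤ} : n ∈ Finset.Icc (-⌊y⌋) ⌊y⌋ ↔ |(n : ℝ)| ≤ y := by
  rw [Finset.mem_Icc, neg_le, Int.le_floor, Int.le_floor, abs_le']
  push_cast
  tauto

lemma card_narrow_le {r R L T N : ℝ} (hr : 1 ≤ r) (hR : 1 ≤ R) (hL : 0 < L)
    (hLR : L ≤ R ^ 2) (hT : SubpolyBound T N) (hN : 512 * r ^ 13 * R ^ 4 ≤ N)
    (s : Finset Quad)
    (hs : ∀ q ∈ s, Good r R L q ∧ q.Ordered ∧ ¬ q.Wide (6 * r ^ 3 * R) ∧ q.l₁ ≠ q.l₃ ∧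
      ¬ (q.k₂ = q.k₁ ∧ q.k₃ = q.k₁ ∧ q.k₄ = q.k₁)) :
    (s.card : ℝ) ≤ 324 * r ^ 10 * T * R ^ 4 * L ^ 2 := by
  have hr0 : 0 < r := by linarith
  have hR0 : 0 < R := by linarith
  have hT1 := hT.one_le
  set X := 6 * r ^ 3 * R with hX
  have hX1 : 1 ≤ X := by
    have : 1 ≤ r ^ 3 := one_le_pow₀ hr
    rw [hX]; nlinarith
  have narrow : ∀ q ∈ s, |((q.k₁ - q.k₃ : ℤ) : ℝ)| ≤ X ∧ |((q.k₂ - q.k₄ : ℤ) : ℝ)| ≤ X := by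
    intro q hq
    obtain ⟨h, ho, hw, -⟩ := hs q hq
    simp only [Quad.Wide, not_lt, max_le_iff] at hw
    push_cast
    have : (q.k₃ : ℝ) ≤ q.k₁ := by exact_mod_cast ho.k₃₁
    rw [abs_of_nonneg (by linarith : (0 : ℝ) ≤ q.k₁ - q.k₃)]
    exact hw
  have epos : ∀ q ∈ s, 0 < q.k₁ - q.k₄ := by
    intro q hq
    obtain ⟨h, ho, -, -, hne⟩ := hs q hq
    have h1 := ho.k₄₃
    have h2 := ho.k₃₁
    rcases lt_or_ge 0 (q.k₁ - q.k₄) with hc | hc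
    · exact hc
    exfalso
    have h4 : q.k₄ = q.k₁ := by omega
    have h3 : q.k₃ = q.k₁ := by omega
    have := h.node_rel
    rw [h4, h3] at this
    have hb : q.l₂ * (q.k₂ - q.k₁) = 0 := by linarith
    have := (mul_eq_zero.mp hb).resolve_left (h.l_pos hr hL).2.1.ne'
    exact hne ⟨by omega, h3, h4⟩
  have key := card_le_mul_of_fiber s
    (fun q => (q.k₁, q.l₂, q.l₃, q.k₁ - q.k₃, q.k₂ - q.k₄))
    (upTo (r ^ 2 * R ^ 2) ×ˢ upTo (r * L) ×ˢ upTo (r * L) ×ˢ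
      Finset.Icc (-⌊X⌋) ⌊X⌋ ×ˢ Finset.Icc (-⌊X⌋) ⌊X⌋)
    (fun q hq => by
      have h := (hs q hq).1
      obtain ⟨-, p2, p3, -⟩ := h.l_pos hr hL
      simp only [Finset.mem_product, mem_upTo, mem_symm_Icc]
      exact ⟨⟨one_le_of_le_sq_mul hr hR0 h.k₁ge, h.k₁le⟩, ⟨p2, h.l₂le⟩, ⟨p3, h.l₃le⟩,
        (narrow q hq).1, (narrow q hq).2⟩)
    T (by
      rintro ⟨k, l₂, l₃, a, b⟩ hy u hus hu
      simp only [Finset.mem_product, mem_upTo, mem_symm_Icc] at hy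
      obtain ⟨-, ⟨hl2, hl2'⟩, ⟨hl3, hl3'⟩, ha, hb⟩ := hy
      rcases Finset.eq_empty_or_nonempty u with rfl | ⟨q₀, hq₀⟩
      · simp; linarith
      have mem : ∀ q ∈ u, q.k₁ = k ∧ q.l₂ = l₂ ∧ q.l₃ = l₃ ∧ q.k₁ - q.k₃ = a ∧
          q.k₂ - q.k₄ = b ∧ (q.l₁ - q.l₃) * (q.k₁ - q.k₄) = -(l₃ * a + l₂ * b) := by
        intro q hq
        have := hu q hq
        simp only [Prod.mk.injEq] at this
        obtain ⟨i1, i2, i3, i4, i5⟩ := this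
        refine ⟨i1, i2, i3, i4, i5, ?_⟩
        rw [← i2, ← i3, ← i4, ← i5]
        exact (hs q (hus hq)).1.node_rel
      have hn : l₃ * a + l₂ * b ≠ 0 := by
        intro h0
        have := (mem q₀ hq₀).2.2.2.2.2
        rw [h0, neg_zero] at this
        rcases mul_eq_zero.mp this with h | h
        · exact (hs q₀ (hus hq₀)).2.2.2.1 (by omega)
        · exact (epos q₀ (hus hq₀)).ne' h
      apply card_le_of_dvd hT u (fun q => q.k₁ - q.k₄) hn
      · push_cast
        have h2 : |(l₂ : ℝ)| ≤ r * L := by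
          rw [abs_of_pos (by exact_mod_cast hl2)]; exact hl2'
        have h3 : |(l₃ : ℝ)| ≤ r * L := by
          rw [abs_of_pos (by exact_mod_cast hl3)]; exact hl3'
        calc |(l₃ : ℝ) * a + l₂ * b| ≤ |(l₃ : ℝ)| * |(a : ℝ)| + |(l₂ : ℝ)| * |(b : ℝ)| := by
              rw [← abs_mul, ← abs_mul]; exact abs_add_le _ _
          _ ≤ (r * R ^ 2) * X + (r * R ^ 2) * X := by
              have : r * L ≤ r * R ^ 2 := by gcongr
              gcongr <;> linarith
          _ = 12 * r ^ 4 * R ^ 3 := by rw [hX]; ring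
          _ ≤ 512 * r ^ 13 * R ^ 4 := by gcongr <;> first | assumption | norm_num
          _ ≤ N := hN
      · intro q hq; exact epos q (hus hq)
      · intro q hq
        refine ⟨-(q.l₁ - q.l₃), ?_⟩
        linear_combination (mem q hq).2.2.2.2.2
      · intro q hq q' hq' he
        have he' : q.k₁ - q.k₄ = q'.k₁ - q'.k₄ := he
        obtain ⟨i1, i2, i3, i4, i5, i6⟩ := mem q hq
        obtain ⟨j1, j2, j3, j4, j5, j6⟩ := mem q' hq'
        have h1 : q.l₁ - q.l₃ = q'.l₁ - q'.l₃ := by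
          apply mul_right_cancel₀ (epos q (hus hq)).ne'
          rw [i6, he', j6]
        have := (hs q (hus hq)).1.sum
        have := (hs q' (hus hq')).1.sum
        apply Quad.ext <;> omega)
  refine key.trans ?_
  simp only [Finset.card_product]
  push_cast
  have hk : ((upTo (r ^ 2 * R ^ 2)).card : ℝ) ≤ r ^ 2 * R ^ 2 := card_upTo (by positivity)
  have hl : ((upTo (r * L)).card : ℝ) ≤ r * L := card_upTo (by positivity)
  have hs' := card_symm_Icc_le hX1
  calc _ ≤ (r ^ 2 * R ^ 2) * ((r * L) * ((r * L) * ((3 * X) * (3 * X)))) * T := by gcongr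
    _ = _ := by rw [hX]; ring

lemma card_split {s : Finset Quad} (P : Quad → Prop) {A B : ℝ}
    (hA : ∀ u ⊆ s, (∀ q ∈ u, P q) → (u.card : ℝ) ≤ A)
    (hB : ∀ u ⊆ s, (∀ q ∈ u, ¬ P q) → (u.card : ℝ) ≤ B) : (s.card : ℝ) ≤ A + B := by
  rw [← Finset.card_filter_add_card_filter_not (s := s) P]
  push_cast
  exact add_le_add (hA _ (Finset.filter_subset _ _) fun q hq => (Finset.mem_filter.mp hq).2)
    (hB _ (Finset.filter_subset _ _) fun q hq => (Finset.mem_filter.mp hq).2)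

/-- The constant in the count of quadruples. -/
def countConst (r : ℝ) : ℝ :=
  8 * (r ^ 6 + 9 * r ^ 7 + r ^ 5 + 324 * r ^ 10 + 33924 * r ^ 28 * (16 * r ^ 6) ^ 13)

lemma card_ordered_le {r R L T N : ℝ} (hr : 1 ≤ r) (hR : 1 ≤ R) (hL : 1 ≤ L)
    (hLR : L ≤ R ^ 2) (hT : SubpolyBound T N) (hN : 512 * r ^ 13 * R ^ 4 ≤ N)
    (s : Finset Quad) (hs : ∀ q ∈ s, Good r R L q ∧ q.Ordered) :
    (s.card : ℝ) ≤ countConst r / 8 * T ^ 5 * R ^ 4 * L ^ 2 := by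
  have hr0 : 0 < r := by linarith
  have hR0 : 0 < R := by linarith
  have hL0 : 0 < L := by linarith
  have hT1 := hT.one_le
  have tot := card_split (s := s) (fun q => q.Wide (6 * r ^ 3 * R))
    (fun u hu h => card_wide_le hr hR hL0 hLR hT hN u
      fun q hq => ⟨(hs q (hu hq)).1, (hs q (hu hq)).2, h q hq⟩)
    (fun u hu h1 => card_split (fun q => q.l₁ = q.l₃ ∧ q.k₁ = q.k₃)
      (fun v hv h => card_diagonal_le hr hR hL0 v fun q hq => ⟨(hs q (hu (hv hq))).1, h q hq⟩)
      (fun v hv h2 => card_split (fun q => q.l₁ = q.l₃)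
        (fun w hw h => card_equal_weights_le hr hR hL hLR hT hN w fun q hq => by
          obtain ⟨g1, g2⟩ := hs q (hu (hv (hw hq)))
          exact ⟨g1, g2, h q hq, lt_of_le_of_ne g2.k₃₁ fun he => h2 q (hw hq) ⟨h q hq, he.symm⟩⟩)
        (fun w hw h3 => card_split (fun q => q.k₂ = q.k₁ ∧ q.k₃ = q.k₁ ∧ q.k₄ = q.k₁)
          (fun x hx h => card_equal_nodes_le hr hR hL0 hLR x
            fun q hq => ⟨(hs q (hu (hv (hw (hx hq))))).1, h q hq⟩)
          (fun x hx h => card_narrow_le hr hR hL0 hLR hT hN x fun q hq => by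
            obtain ⟨g1, g2⟩ := hs q (hu (hv (hw (hx hq))))
            exact ⟨g1, g2, h1 q (hv (hw (hx hq))), h3 q (hx hq), h q hq⟩))))
  refine tot.trans ?_
  have hT5 : 1 ≤ T ^ 5 := one_le_pow₀ hT1
  have hT2 : T ^ 2 ≤ T ^ 5 := pow_le_pow_right₀ hT1 (by norm_num)
  have hT15 : T ≤ T ^ 5 := le_self_pow₀ hT1 (by norm_num)
  calc _ = (33924 * r ^ 28 * (16 * r ^ 6) ^ 13 * T ^ 5 + (r ^ 6 * 1 + (9 * r ^ 7 * T ^ 2 +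
        (r ^ 5 * 1 + 324 * r ^ 10 * T)))) * (R ^ 4 * L ^ 2) := by ring
    _ ≤ (33924 * r ^ 28 * (16 * r ^ 6) ^ 13 * T ^ 5 + (r ^ 6 * T ^ 5 + (9 * r ^ 7 * T ^ 5 +
        (r ^ 5 * T ^ 5 + 324 * r ^ 10 * T ^ 5)))) * (R ^ 4 * L ^ 2) := by gcongr
    _ = _ := by rw [countConst]; ring

/-- Reduction to a half of a set along an involution. -/
lemma card_le_two_mul {φ : Quad → Quad} {P O : Quad → Prop} {B : ℝ} (hφ : Function.Injective φ)
    (hP : ∀ q, P q → P (φ q)) (hO : ∀ q, O q ∨ O (φ q))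
    (hB : ∀ s : Finset Quad, (∀ q ∈ s, P q ∧ O q) → (s.card : ℝ) ≤ B)
    (s : Finset Quad) (hs : ∀ q ∈ s, P q) : (s.card : ℝ) ≤ 2 * B := by
  rw [two_mul]
  refine card_split O (fun u hu h => hB u fun q hq => ⟨hs q (hu hq), h q hq⟩) fun u hu h => ?_
  have := hB (u.image φ) (fun p hp => by
    obtain ⟨q, hq, rfl⟩ := Finset.mem_image.mp hp
    exact ⟨hP q (hs q (hu hq)), (hO q).resolve_left (h q hq)⟩)
  rwa [Finset.card_image_of_injective _ hφ] at this

/-- The fourth-moment count. -/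
theorem card_good_le {r R L T N : ℝ} (hr : 1 ≤ r) (hR : 1 ≤ R) (hL : 1 ≤ L)
    (hLR : L ≤ R ^ 2) (hT : SubpolyBound T N) (hN : 512 * r ^ 13 * R ^ 4 ≤ N)
    (s : Finset Quad) (hs : ∀ q ∈ s, Good r R L q) :
    (s.card : ℝ) ≤ countConst r * T ^ 5 * R ^ 4 * L ^ 2 := by
  have b1 := card_ordered_le hr hR hL hLR hT hN
  have b2 := card_le_two_mul (φ := fun q => ⟨q.k₃, q.k₄, q.k₁, q.k₂, q.l₃, q.l₄, q.l₁, q.l₂⟩)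
    (P := fun q => Good r R L q ∧ q.k₂ ≤ q.k₁ ∧ q.k₄ ≤ q.k₃) (O := fun q => q.k₃ ≤ q.k₁)
    (by
      intro q q' h
      simp only [Quad.mk.injEq] at h
      apply Quad.ext <;> tauto)
    (by
      rintro q ⟨h, h1, h2⟩
      refine ⟨⟨h.k₃ge, h.k₃le, h.k₄ge, h.k₄le, h.k₁ge, h.k₁le, h.k₂ge, h.k₂le, h.l₃ge, h.l₃le,
        h.l₄ge, h.l₄le, h.l₁ge, h.l₁le, h.l₂ge, h.l₂le, h.sum.symm, h.mom.symm, ?_⟩, h2, h1⟩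
      convert h.root using 2
      rw [← abs_neg]; congr 1; ring)
    (fun q => le_total _ _)
    (fun s hs => b1 s (fun q hq => ⟨(hs q hq).1.1, (hs q hq).1.2.1, (hs q hq).1.2.2, (hs q hq).2⟩))
  have b3 := card_le_two_mul (φ := fun q => ⟨q.k₁, q.k₂, q.k₄, q.k₃, q.l₁, q.l₂, q.l₄, q.l₃⟩)
    (P := fun q => Good r R L q ∧ q.k₂ ≤ q.k₁) (O := fun q => q.k₄ ≤ q.k₃)
    (by
      intro q q' h
      simp only [Quad.mk.injEq] at h
      apply Quad.ext <;> tauto)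
    (by
      rintro q ⟨h, h1⟩
      refine ⟨⟨h.k₁ge, h.k₁le, h.k₂ge, h.k₂le, h.k₄ge, h.k₄le, h.k₃ge, h.k₃le, h.l₁ge, h.l₁le,
        h.l₂ge, h.l₂le, h.l₄ge, h.l₄le, h.l₃ge, h.l₃le, h.sum.trans (add_comm _ _),
        h.mom.trans (add_comm _ _), ?_⟩, h1⟩
      convert h.root using 2
      congr 1; ring)
    (fun q => le_total _ _)
    (fun s hs => b2 s (fun q hq => ⟨(hs q hq).1.1, (hs q hq).1.2, (hs q hq).2⟩))
  have b4 := card_le_two_mul (φ := fun q => ⟨q.k₂, q.k₁, q.k₃, q.k₄, q.l₂, q.l₁, q.l₃, q.l₄⟩)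
    (P := fun q => Good r R L q) (O := fun q => q.k₂ ≤ q.k₁)
    (by
      intro q q' h
      simp only [Quad.mk.injEq] at h
      apply Quad.ext <;> tauto)
    (by
      rintro q h
      refine ⟨h.k₂ge, h.k₂le, h.k₁ge, h.k₁le, h.k₃ge, h.k₃le, h.k₄ge, h.k₄le, h.l₂ge, h.l₂le,
        h.l₁ge, h.l₁le, h.l₃ge, h.l₃le, h.l₄ge, h.l₄le, (add_comm _ _).trans h.sum,
        (add_comm _ _).trans h.mom, ?_⟩
      convert h.root using 2
      congr 1; ring)
    (fun q => le_total _ _) b3 s hs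
  refine b4.trans (le_of_eq ?_)
  ring

end
section Orthogonality
open ComplexConjugate ProbabilityTheory

theorem e_add (x y : ℝ) : e (x + y) = e x * e y := by
  rw [e, e, e, ← Complex.exp_add]; congr 1; push_cast; ring

theorem conj_e (x : ℝ) : conj (e x) = e (-x) := by
  rw [e, e, ← Complex.exp_conj]; congr 1
  simp only [map_mul, Complex.conj_ofReal, Complex.conj_I, map_ofNat]
  push_cast; ring

theorem norm_e (x : ℝ) : ‖e x‖ = 1 := by
  rw [e, show (2 * Real.pi * Complex.I * x : ℂ) = ((2 * Real.pi * x : ℝ) : ℂ) * Complex.I by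
    push_cast; ring]
  exact Complex.norm_exp_ofReal_mul_I _

theorem continuous_e : Continuous e := by
  unfold e; fun_prop

/-- The phase `ξ ⬝ x` of frequency `ξ` at the point `x`. -/
def phase (ξ x : ℝ × ℝ × ℝ) : ℝ := ξ.1 * x.1 + ξ.2.1 * x.2.1 + ξ.2.2 * x.2.2

theorem continuous_phase (ξ : ℝ × ℝ × ℝ) : Continuous (phase ξ) := by
  unfold phase; fun_prop

/-- The exponential sum with coefficients `b` and frequencies `φ` over `J`. -/
def trigSum {ι : Type*} (J : Finset ι) (b : ι → ℂ) (φ : ι → ℝ × ℝ × ℝ) (x : ℝ × ℝ × ℝ) : ℂ :=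
  ∑ j ∈ J, b j * e (phase (φ j) x)

theorem continuous_trigSum {ι : Type*} (J : Finset ι) (b : ι → ℂ) (φ : ι → ℝ × ℝ × ℝ) :
    Continuous (trigSum J b φ) := by
  unfold trigSum
  exact continuous_finsetSum _ fun j _ =>
    continuous_const.mul (continuous_e.comp (continuous_phase _))

theorem norm_trigSum_le {ι : Type*} (J : Finset ι) (b : ι → ℂ) (φ : ι → ℝ × ℝ × ℝ)
    (x : ℝ × ℝ × ℝ) : ‖trigSum J b φ x‖ ≤ ∑ j ∈ J, ‖b j‖ := by
  refine (norm_sum_le _ _).trans (Finset.sum_le_sum fun j _ => ?_)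
  rw [norm_mul, norm_e, mul_one]

theorem integrable_norm_trigSum_pow {ι : Type*} (J : Finset ι) (b : ι → ℂ)
    (φ : ι → ℝ × ℝ × ℝ) (n : ℕ) (ν : Measure (ℝ × ℝ × ℝ)) [IsFiniteMeasure ν] :
    Integrable (fun x => ‖trigSum J b φ x‖ ^ n) ν := by
  refine Integrable.of_bound ((continuous_trigSum J b φ).norm.pow n).aestronglyMeasurable
    ((∑ j ∈ J, ‖b j‖) ^ n) (Filter.Eventually.of_forall fun x => ?_)
  rw [norm_pow, norm_norm]
  gcongr
  exact norm_trigSum_le J b φ x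

theorem integrable_e_phase (ξ : ℝ × ℝ × ℝ) (ν : Measure (ℝ × ℝ × ℝ)) [IsFiniteMeasure ν] :
    Integrable (fun x => e (phase ξ x)) ν :=
  Integrable.of_bound (continuous_e.comp (continuous_phase ξ)).aestronglyMeasurable 1
    (Filter.Eventually.of_forall fun _ => (norm_e _).le)

theorem integral_norm_trigSum_sq {ι : Type*} (J : Finset ι) (b : ι → ℂ)
    (φ : ι → ℝ × ℝ × ℝ) (ν : Measure (ℝ × ℝ × ℝ)) [IsFiniteMeasure ν] :
    ((∫ x, ‖trigSum J b φ x‖ ^ 2 ∂ν : ℝ) : ℂ) =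
      ∑ i ∈ J, ∑ j ∈ J, b i * conj (b j) * ∫ x, e (phase (φ i - φ j) x) ∂ν := by
  rw [← integral_complex_ofReal]
  have h : ∀ x, ((‖trigSum J b φ x‖ ^ 2 : ℝ) : ℂ) =
      ∑ i ∈ J, ∑ j ∈ J, b i * conj (b j) * e (phase (φ i - φ j) x) := by
    intro x
    push_cast
    rw [← Complex.mul_conj', trigSum, map_sum, Finset.sum_mul_sum]
    refine Finset.sum_congr rfl fun i _ => Finset.sum_congr rfl fun j _ => ?_
    rw [map_mul, conj_e,
      show phase (φ i - φ j) x = phase (φ i) x + -phase (φ j) x by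
        simp only [phase, Prod.fst_sub, Prod.snd_sub]; ring, e_add]
    ring
  simp_rw [h]
  rw [integral_finsetSum _ fun i _ => integrable_finsetSum _ fun j _ =>
    (integrable_e_phase _ ν).const_mul _]
  refine Finset.sum_congr rfl fun i _ => ?_
  rw [integral_finsetSum _ fun j _ => (integrable_e_phase _ ν).const_mul _]
  exact Finset.sum_congr rfl fun j _ => integral_const_mul _ _

/-- Lebesgue measure on `[-W, W]`. -/
def interval (W : ℝ) : Measure ℝ := volume.restrict (Set.Icc (-W) W)

instance (W : ℝ) : IsFiniteMeasure (interval W) := by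
  unfold interval; infer_instance

theorem box_eq (A₁ A₂ A₃ : ℝ) :
    box A₁ A₂ A₃ = Set.Icc (-A₁) A₁ ×ˢ Set.Icc (-A₂) A₂ ×ˢ Set.Icc (-A₃) A₃ := by
  ext x
  simp only [box, Set.mem_ofPred_eq, Set.mem_prod, Set.mem_Icc, abs_le]

theorem restrict_box (A₁ A₂ A₃ : ℝ) :
    volume.restrict (box A₁ A₂ A₃) =
      (interval A₁).prod ((interval A₂).prod (interval A₃)) := by
  rw [interval, interval, interval, Measure.prod_restrict, Measure.prod_restrict, box_eq]
  rfl

theorem interval_real_univ {W : ℝ} (hW : 0 ≤ W) : (interval W).real Set.univ = 2 * W := by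
  rw [interval, measureReal_restrict_apply_univ, measureReal_def, Real.volume_Icc,
    ENNReal.toReal_ofReal (by linarith)]
  ring

theorem volume_real_box {W : ℝ} (hW : 0 ≤ W) : volume.real (box 1 1 W) = 8 * W := by
  rw [← measureReal_restrict_apply_univ, restrict_box, ← Set.univ_prod_univ,
    measureReal_prod_prod, ← Set.univ_prod_univ, measureReal_prod_prod, interval_real_univ hW,
    interval_real_univ zero_le_one]
  ring

theorem integral_e_phase_prod (ξ : ℝ × ℝ × ℝ) (μ₁ μ₂ μ₃ : Measure ℝ) [SFinite μ₁] [SFinite μ₂]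
    [SFinite μ₃] :
    ∫ x, e (phase ξ x) ∂(μ₁.prod (μ₂.prod μ₃)) =
      (∫ t, e (ξ.1 * t) ∂μ₁) * ((∫ t, e (ξ.2.1 * t) ∂μ₂) * ∫ t, e (ξ.2.2 * t) ∂μ₃) := by
  rw [← integral_prod_mul (fun t => e (ξ.2.1 * t)) (fun t => e (ξ.2.2 * t)),
    ← integral_prod_mul (fun t => e (ξ.1 * t))
      (fun z : ℝ × ℝ => e (ξ.2.1 * z.1) * e (ξ.2.2 * z.2))]
  refine integral_congr_ae (Filter.Eventually.of_forall fun x => ?_)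
  simp only [phase, add_assoc, e_add]

theorem integral_e_int_mul (n : ℤ) :
    ∫ t, e ((n : ℝ) * t) ∂(interval 1) = if n = 0 then 2 else 0 := by
  split_ifs with h
  · subst h
    have : ∀ t : ℝ, e (((0 : ℤ) : ℝ) * t) = 1 := fun t => by simp [e]
    simp_rw [this]
    rw [integral_const, interval_real_univ zero_le_one]
    norm_num
  · rw [interval, integral_Icc_eq_integral_Ioc, ← intervalIntegral.integral_of_le (by norm_num)]
    have hc : (2 * Real.pi * Complex.I * n : ℂ) ≠ 0 := by
      simp [Real.pi_ne_zero, Complex.I_ne_zero, h]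
    have he : ∀ t : ℝ, e ((n : ℝ) * t) = Complex.exp ((2 * Real.pi * Complex.I * n : ℂ) * t) := by
      intro t; rw [e]; congr 1; push_cast; ring
    simp_rw [he]
    rw [integral_exp_mul_complex hc, div_eq_zero_iff]
    left
    rw [sub_eq_zero, Complex.exp_eq_exp_iff_exists_int]
    exact ⟨2 * n, by push_cast; ring⟩

theorem integral_e_gaussianReal (v : NNReal) (γ : ℝ) :
    ∫ t, e (γ * t) ∂(gaussianReal 0 v) = (Real.exp (-(2 * Real.pi ^ 2 * v * γ ^ 2)) : ℝ) := by
  have h := charFun_gaussianReal (μ := 0) (v := v) (2 * Real.pi * γ)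
  rw [charFun_apply_real] at h
  have he : ∀ t : ℝ, e (γ * t) =
      Complex.exp (((2 * Real.pi * γ : ℝ) : ℂ) * t * Complex.I) := by
    intro t; rw [e]; congr 1; push_cast; ring
  simp_rw [he]
  rw [h, Complex.ofReal_exp]
  congr 1; push_cast; ring

/-- The ratio of the length of an interval of radius `W` to the central Gaussian density. -/
def gaussConst : ℝ := √(2 * Real.pi) * Real.exp (1 / 2)

theorem gaussConst_pos : 0 < gaussConst := by
  unfold gaussConst; positivity

theorem interval_le_gaussianReal {W : ℝ} (hW : 0 < W) :
    interval W ≤ ENNReal.ofReal (gaussConst * W) • gaussianReal 0 (Real.toNNReal (W ^ 2)) := by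
  have hv : Real.toNNReal (W ^ 2) ≠ 0 := by
    rw [Ne, Real.toNNReal_eq_zero, not_le]; positivity
  rw [gaussianReal_of_var_ne_zero _ hv, interval, ← withDensity_smul _ (measurable_gaussianPDF _ _)]
  rw [← withDensity_indicator_one measurableSet_Icc]
  refine withDensity_mono (Filter.Eventually.of_forall fun x => ?_)
  by_cases hx : x ∈ Set.Icc (-W) W
  · rw [Set.indicator_of_mem hx, Pi.one_apply, Pi.smul_apply, smul_eq_mul, gaussianPDF,
      ← ENNReal.ofReal_mul (by have := gaussConst_pos; positivity), ENNReal.one_le_ofReal,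
      gaussianPDFReal, Real.coe_toNNReal _ (sq_nonneg W), Real.sqrt_mul (by positivity),
      Real.sqrt_sq hW.le, sub_zero, gaussConst]
    have h1 : x ^ 2 ≤ W ^ 2 := sq_le_sq' hx.1 hx.2
    have h2 : -(1 / 2) ≤ -x ^ 2 / (2 * W ^ 2) := by
      rw [neg_div, neg_le_neg_iff, div_le_iff₀ (by positivity)]; linarith
    have h3 : 0 < √(2 * Real.pi) := by positivity
    have : √(2 * Real.pi) * Real.exp (1 / 2) * W *
        ((√(2 * Real.pi) * W)⁻¹ * Real.exp (-x ^ 2 / (2 * W ^ 2))) =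
        Real.exp (1 / 2) * Real.exp (-x ^ 2 / (2 * W ^ 2)) := by
      field_simp
    rw [this, ← Real.exp_add]
    exact Real.one_le_exp (by linarith)
  · rw [Set.indicator_of_notMem hx]; exact zero_le

theorem integral_box_norm_trigSum_sq_le {ι : Type*} (J : Finset ι) (b : ι → ℂ)
    (hb : ∀ j ∈ J, ‖b j‖ ≤ 1) (p q : ι → ℤ) (γ : ι → ℝ) {W : ℝ} (hW : 0 < W) :
    ∫ x in box 1 1 W, ‖trigSum J b (fun j => ((p j : ℝ), (q j : ℝ), γ j)) x‖ ^ 2 ≤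
      gaussConst * W * (4 * ∑ i ∈ J, ∑ j ∈ J, if (p i, q i) = (p j, q j) then
        Real.exp (-(2 * Real.pi ^ 2 * (W * γ i - W * γ j) ^ 2)) else 0) := by
  set φ : ι → ℝ × ℝ × ℝ := fun j => ((p j : ℝ), (q j : ℝ), γ j) with hφ
  set g : Measure ℝ := gaussianReal 0 (Real.toNNReal (W ^ 2)) with hg
  set ν := (interval 1).prod ((interval 1).prod g) with hν
  have hle : volume.restrict (box 1 1 W) ≤ ENNReal.ofReal (gaussConst * W) • ν := by
    rw [restrict_box, hν, ← Measure.prod_smul_right, ← Measure.prod_smul_right]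
    exact Measure.prod_mono le_rfl (Measure.prod_mono le_rfl (interval_le_gaussianReal hW))
  have h0 : 0 ≤ gaussConst * W := by have := gaussConst_pos; positivity
  have hfin : IsFiniteMeasure (ENNReal.ofReal (gaussConst * W) • ν) :=
    Measure.smul_finite _ ENNReal.ofReal_ne_top
  refine (integral_mono_measure hle (Filter.Eventually.of_forall fun x => by positivity)
    (integrable_norm_trigSum_pow J b φ 2 _)).trans ?_
  rw [integral_smul_measure, ENNReal.toReal_ofReal h0, smul_eq_mul]
  refine mul_le_mul_of_nonneg_left ?_ h0
  have h1 := integral_norm_trigSum_sq J b φ ν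
  have h2 : ∫ x, ‖trigSum J b φ x‖ ^ 2 ∂ν =
      ‖∑ i ∈ J, ∑ j ∈ J, b i * conj (b j) * ∫ x, e (phase (φ i - φ j) x) ∂ν‖ := by
    rw [← h1, Complex.norm_real, Real.norm_of_nonneg]
    exact integral_nonneg fun x => by positivity
  rw [h2, Finset.mul_sum]
  refine (norm_sum_le _ _).trans (Finset.sum_le_sum fun i hi => ?_)
  rw [Finset.mul_sum]
  refine (norm_sum_le _ _).trans (Finset.sum_le_sum fun j hj => ?_)
  have h3 : ∫ x, e (phase (φ i - φ j) x) ∂ν = (4 * (if (p i, q i) = (p j, q j) then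
        Real.exp (-(2 * Real.pi ^ 2 * (W * γ i - W * γ j) ^ 2)) else 0) : ℝ) := by
    rw [hν, integral_e_phase_prod]
    simp only [hφ, Prod.fst_sub, Prod.snd_sub, ← Int.cast_sub]
    rw [integral_e_int_mul, integral_e_int_mul, hg, integral_e_gaussianReal,
      Real.coe_toNNReal _ (sq_nonneg W)]
    simp only [sub_eq_zero, Prod.mk.injEq]
    have : 2 * Real.pi ^ 2 * W ^ 2 * (γ i - γ j) ^ 2 =
        2 * Real.pi ^ 2 * (W * γ i - W * γ j) ^ 2 := by ring
    rw [this]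
    by_cases hp : p i = p j <;> by_cases hq : q i = q j <;> simp [hp, hq]
    ring
  rw [h3, norm_mul, norm_mul, RCLike.norm_conj, Complex.norm_real, Real.norm_of_nonneg]
  · refine mul_le_of_le_one_left ?_ (mul_le_one₀ (hb i hi) (norm_nonneg _) (hb j hj))
    split_ifs <;> positivity
  · split_ifs <;> positivity

theorem integral_box_norm_trigSum_sq {ι : Type*} [DecidableEq ι] (J : Finset ι)
    (p q : ι → ℤ) (γ : ι → ℝ)
    (hinj : ∀ i ∈ J, ∀ j ∈ J, p i = p j → q i = q j → i = j) {W : ℝ} (hW : 0 ≤ W) :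
    ∫ x in box 1 1 W, ‖trigSum J (fun _ => 1) (fun j => ((p j : ℝ), (q j : ℝ), γ j)) x‖ ^ 2 =
      8 * W * J.card := by
  have h := integral_norm_trigSum_sq J (fun _ => 1) (fun j => ((p j : ℝ), (q j : ℝ), γ j))
    ((interval 1).prod ((interval 1).prod (interval W)))
  rw [restrict_box]
  rw [← Complex.ofReal_inj, h]
  have : ∀ i ∈ J, ∀ j ∈ J, (1 : ℂ) * conj (1 : ℂ) * ∫ x, e (phase (((p i : ℝ), (q i : ℝ), γ i) -
      ((p j : ℝ), (q j : ℝ), γ j)) x) ∂((interval 1).prod ((interval 1).prod (interval W))) =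
      if j = i then (8 * W : ℂ) else 0 := by
    intro i hi j hj
    rw [integral_e_phase_prod]
    simp only [Prod.fst_sub, Prod.snd_sub, ← Int.cast_sub]
    rw [integral_e_int_mul, integral_e_int_mul]
    by_cases hji : j = i
    · subst hji
      have he : ∀ t : ℝ, e ((γ j - γ j) * t) = 1 := fun t => by simp [e]
      simp_rw [he]
      rw [integral_const, interval_real_univ hW]
      simp only [sub_self, if_true, map_one, Complex.real_smul]
      push_cast
      ring
    · rw [if_neg hji]
      by_cases h1 : p i = p j
      · have h2 : q i ≠ q j := fun h2 => hji (hinj i hi j hj h1 h2).symm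
        simp [sub_eq_zero, h2]
      · simp [sub_eq_zero, h1]
  rw [Finset.sum_congr rfl fun i hi => Finset.sum_congr rfl fun j hj => this i hi j hj]
  simp only [Finset.sum_ite_eq', Finset.sum_ite_mem, Finset.inter_self, Finset.sum_const]
  simp [mul_comm]

end Orthogonality

theorem card_shift_le {ι β : Type*} [DecidableEq β] (J : Finset ι) (y : ι → β) {s : β → β}
    (hs : Function.Injective s) :
    ((J ×ˢ J).filter fun u => y u.1 = s (y u.2)).card ≤
      ((J ×ˢ J).filter fun u => y u.1 = y u.2).card := by
  set f : β → ℕ := fun z => (J.filter fun j => y j = z).card with hf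
  have count : ∀ t : β → β, ((J ×ˢ J).filter fun u => y u.1 = t (y u.2)).card =
      ∑ z ∈ J.image y, f z * f (t z) := by
    intro t
    rw [Finset.card_filter, Finset.sum_product_right]
    simp_rw [← Finset.card_filter]
    rw [Finset.sum_comp (fun z => f (t z)) y]
    rfl
  have h1 := count s
  have h2 := count id
  simp only [id] at h2
  rw [h1, h2]
  have h3 : ∑ z ∈ J.image y, f (s z) ^ 2 ≤ ∑ z ∈ J.image y, f z ^ 2 := by
    rw [← Finset.sum_image (f := fun z => f z ^ 2) (g := s) fun a _ b _ h => hs h]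
    refine Finset.sum_le_sum_of_ne_zero fun z _ hz => ?_
    have : f z ≠ 0 := fun h => hz (by rw [h]; rfl)
    obtain ⟨j, hj⟩ := Finset.card_ne_zero.mp this
    rw [Finset.mem_filter] at hj
    exact Finset.mem_image.mpr ⟨j, hj⟩
  have h4 : 2 * ∑ z ∈ J.image y, f z * f (s z) ≤
      ∑ z ∈ J.image y, f z ^ 2 + ∑ z ∈ J.image y, f (s z) ^ 2 := by
    rw [Finset.mul_sum, ← Finset.sum_add_distrib]
    refine Finset.sum_le_sum fun z _ => ?_
    rw [← mul_assoc]
    exact two_mul_le_add_sq (f z) (f (s z))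
  have h5 : ∑ z ∈ J.image y, f z * f z = ∑ z ∈ J.image y, f z ^ 2 :=
    Finset.sum_congr rfl fun z _ => (sq _).symm
  omega

theorem sum_weight_le {ι β : Type*} [DecidableEq β] (J : Finset ι) (y : ι → β) (m : ι → ℤ) {w : ℤ → ℝ}
    (hw : ∀ n, 0 ≤ w n) (hsum : Summable w) :
    ∑ i ∈ J, ∑ j ∈ J, (if y i = y j then w (m i - m j) else 0) ≤
      (∑' n, w n) * ((J ×ˢ J).filter fun u => (y u.1, m u.1) = (y u.2, m u.2)).card := by
  rw [← Finset.sum_product' J J fun i j => if y i = y j then w (m i - m j) else 0,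
    ← Finset.sum_filter]
  set P := (J ×ˢ J).filter fun u => y u.1 = y u.2
  set D := ((J ×ˢ J).filter fun u => (y u.1, m u.1) = (y u.2, m u.2)).card with hD
  set t := P.image fun u => m u.1 - m u.2
  rw [← Finset.sum_fiberwise_of_maps_to (t := t) (g := fun u => m u.1 - m u.2)
    fun u hu => Finset.mem_image_of_mem _ hu]
  have hn : ∀ n ∈ t, ∑ u ∈ P with m u.1 - m u.2 = n, w (m u.1 - m u.2) ≤ w n * D := by
    intro n _
    rw [Finset.sum_congr rfl fun u hu => by rw [(Finset.mem_filter.mp hu).2], Finset.sum_const,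
      nsmul_eq_mul, mul_comm]
    refine mul_le_mul_of_nonneg_left ?_ (hw n)
    have h := card_shift_le J (fun j => (y j, m j)) (s := fun z => (z.1, z.2 + n))
      (fun a b hab => by
        simp only [Prod.mk.injEq, add_left_inj] at hab
        exact Prod.ext hab.1 hab.2)
    refine Nat.cast_le.mpr (le_trans (Finset.card_le_card fun u hu => ?_) h)
    obtain ⟨hu1, hu2⟩ := Finset.mem_filter.mp hu
    obtain ⟨hu3, hu4⟩ := Finset.mem_filter.mp hu1
    refine Finset.mem_filter.mpr ⟨hu3, ?_⟩
    simp only [hu4, Prod.mk.injEq, true_and]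
    omega
  refine (Finset.sum_le_sum hn).trans ?_
  rw [← Finset.sum_mul]
  gcongr
  exact hsum.sum_le_tsum t fun n _ => hw n

/-- A summable majorant of the Gaussian weight of a pair whose phases have floors `n` apart. -/
def binWeight (n : ℤ) : ℝ := Real.exp (2 - |(n : ℝ)|)

theorem summable_binWeight : Summable binWeight := by
  have h : Summable fun n : ℕ => Real.exp (2 - (n : ℝ)) := by
    have := (Real.summable_exp_neg_nat).mul_left (Real.exp 2)
    simpa only [← Real.exp_add, ← sub_eq_add_neg] using this
  rw [summable_int_iff_summable_nat_and_neg]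
  constructor <;> simpa [binWeight] using h

theorem gaussian_le_binWeight (x y : ℝ) :
    Real.exp (-(2 * Real.pi ^ 2 * (x - y) ^ 2)) ≤ binWeight (⌊x⌋ - ⌊y⌋) := by
  rw [binWeight, Real.exp_le_exp]
  have h1 := Int.floor_le x
  have h2 := Int.lt_floor_add_one x
  have h3 := Int.floor_le y
  have h4 := Int.lt_floor_add_one y
  have h5 : |((⌊x⌋ - ⌊y⌋ : ℤ) : ℝ)| ≤ |x - y| + 1 := by
    push_cast
    have := neg_abs_le (x - y)
    have := le_abs_self (x - y)
    exact abs_le.mpr ⟨by linarith, by linarith⟩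
  have h6 : (x - y) ^ 2 ≤ 2 * Real.pi ^ 2 * (x - y) ^ 2 := by
    have : 1 ≤ 2 * Real.pi ^ 2 := by nlinarith [Real.pi_gt_three]
    exact le_mul_of_one_le_left (sq_nonneg _) this
  nlinarith [sq_abs (x - y), sq_nonneg (|x - y| - 1 / 2)]

theorem integral_box_norm_trigSum_sq_le_card {ι : Type*} (J : Finset ι) (b : ι → ℂ)
    (hb : ∀ j ∈ J, ‖b j‖ ≤ 1) (p q : ι → ℤ) (γ : ι → ℝ) {W : ℝ} (hW : 0 < W) :
    ∫ x in box 1 1 W, ‖trigSum J b (fun j => ((p j : ℝ), (q j : ℝ), γ j)) x‖ ^ 2 ≤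
      gaussConst * W * (4 * ((∑' n, binWeight n) * ((J ×ˢ J).filter fun u =>
        p u.1 = p u.2 ∧ q u.1 = q u.2 ∧ |W * γ u.1 - W * γ u.2| ≤ 1).card)) := by
  refine (integral_box_norm_trigSum_sq_le J b hb p q γ hW).trans ?_
  have h0 := gaussConst_pos
  have hw : ∀ n, 0 ≤ binWeight n := fun n => (Real.exp_pos _).le
  gcongr
  refine le_trans (Finset.sum_le_sum fun i _ => Finset.sum_le_sum fun j _ => ?_)
    ((sum_weight_le J (fun j => (p j, q j)) (fun j => ⌊W * γ j⌋) hw summable_binWeight).trans ?_)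
  · split_ifs
    · exact gaussian_le_binWeight _ _
    · exact le_rfl
  · refine mul_le_mul_of_nonneg_left (Nat.cast_le.mpr (Finset.card_le_card fun u hu => ?_))
      (tsum_nonneg hw)
    obtain ⟨hu1, hu2⟩ := Finset.mem_filter.mp hu
    simp only [Prod.mk.injEq] at hu2
    exact Finset.mem_filter.mpr ⟨hu1, hu2.1.1, hu2.1.2,
      (Int.abs_sub_lt_one_of_floor_eq_floor hu2.2).le⟩

theorem trigSum_sq {ι : Type*} (J : Finset ι) (b : ι → ℂ) (φ : ι → ℝ × ℝ × ℝ)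
    (x : ℝ × ℝ × ℝ) :
    trigSum J b φ x ^ 2 =
      trigSum (J ×ˢ J) (fun u => b u.1 * b u.2) (fun u => φ u.1 + φ u.2) x := by
  rw [sq, trigSum, trigSum, Finset.sum_mul_sum, Finset.sum_product]
  refine Finset.sum_congr rfl fun i _ => Finset.sum_congr rfl fun j _ => ?_
  rw [show phase (φ i + φ j) x = phase (φ i) x + phase (φ j) x by
    simp only [phase, Prod.fst_add, Prod.snd_add]; ring, e_add]
  ring

theorem expSum_eq_trigSum (c C : ℝ) (K L : ℕ) (a : ℕ → ℕ → ℂ) :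
    expSum c C K L a = trigSum (sim c C K ×ˢ sim c C L) (fun u => a u.1 u.2) (fun u =>
      (((u.2 : ℤ) : ℝ), ((u.1 * u.2 : ℤ) : ℝ), (u.2 : ℝ) * √(u.1 : ℝ))) := by
  funext x
  rw [expSum, trigSum, Finset.sum_product]
  simp [phase]

theorem norm_expSum_pow_four (c C : ℝ) (K L : ℕ) (a : ℕ → ℕ → ℂ) (x : ℝ × ℝ × ℝ) :
    ‖expSum c C K L a x‖ ^ 4 =
      ‖trigSum ((sim c C K ×ˢ sim c C L) ×ˢ (sim c C K ×ˢ sim c C L))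
        (fun u => a u.1.1 u.1.2 * a u.2.1 u.2.2)
        (fun u => (((u.1.2 + u.2.2 : ℤ) : ℝ), ((u.1.1 * u.1.2 + u.2.1 * u.2.2 : ℤ) : ℝ),
          (u.1.2 : ℝ) * √(u.1.1 : ℝ) + (u.2.2 : ℝ) * √(u.2.1 : ℝ))) x‖ ^ 2 := by
  rw [show ‖expSum c C K L a x‖ ^ 4 = ‖expSum c C K L a x ^ 2‖ ^ 2 by rw [norm_pow]; ring,
    expSum_eq_trigSum, trigSum_sq]
  simp only [Prod.mk_add_mk, Int.cast_add]

/-- The quadruple of points `(kᵢ, lᵢ)` as an element of `Quad`. -/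
def toQuad (u : ((ℕ × ℕ) × ℕ × ℕ) × (ℕ × ℕ) × ℕ × ℕ) : Quad :=
  ⟨u.1.1.1, u.1.2.1, u.2.1.1, u.2.2.1, u.1.1.2, u.1.2.2, u.2.1.2, u.2.2.2⟩

theorem toQuad_injective : Function.Injective toQuad := by
  rintro ⟨⟨⟨a, b⟩, c, d⟩, ⟨e, f⟩, g, h⟩ ⟨⟨⟨a', b'⟩, c', d'⟩, ⟨e', f'⟩, g', h'⟩ H
  simpa [toQuad, and_assoc, and_comm, and_left_comm] using H

theorem integral_norm_expSum_pow_four_le {c C : ℝ} (hc : 0 < c) (hc1 : c ≤ 1) (hC1 : 1 ≤ C)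
    {K L : ℕ} {η : ℝ} (h : Admissible K L η) {T : ℝ}
    (hT : SubpolyBound T (512 * (C / c) ^ 13 * (K : ℝ) ^ 2)) {a : ℕ → ℕ → ℂ}
    (ha : ∀ k ∈ sim c C K, ∀ l ∈ sim c C L, ‖a k l‖ ≤ 1) {W : ℝ}
    (hW : W = 1 / (η * L * √(K : ℝ))) :
    ∫ x in box 1 1 W, ‖expSum c C K L a x‖ ^ 4 ≤ gaussConst * W *
      (4 * ((∑' n, binWeight n) * (countConst (C / c) * T ^ 5 * (K : ℝ) ^ 2 * (L : ℝ) ^ 2))) := by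
  obtain ⟨hη, hL, hLK, hK1, hK2⟩ := h
  have hL1 : (1 : ℝ) ≤ L := by exact_mod_cast hL
  have hLK' : (L : ℝ) ≤ K := by exact_mod_cast hLK.le
  have hK : (1 : ℝ) ≤ K := hL1.trans hLK'
  have hC0 : 0 ≤ C := by linarith
  have hR : 1 ≤ √(K : ℝ) := Real.one_le_sqrt.mpr hK
  have hRsq : √(K : ℝ) ^ 2 = K := Real.sq_sqrt (by linarith)
  have hW0 : 0 < W := by rw [hW]; positivity
  have hr : 1 ≤ C / c := (one_le_div hc).mpr (by linarith)
  have hrc : C / c * c = C := by field_simp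
  have hrC : C ≤ C / c := by rw [le_div_iff₀ hc]; nlinarith
  have hηK : η * K ≤ 1 := by rwa [le_div_iff₀ hη, mul_comm] at hK1
  simp_rw [norm_expSum_pow_four]
  have hb : ∀ u ∈ (sim c C K ×ˢ sim c C L) ×ˢ (sim c C K ×ˢ sim c C L),
      ‖a u.1.1 u.1.2 * a u.2.1 u.2.2‖ ≤ 1 := by
    intro u hu
    obtain ⟨h1, h2⟩ := Finset.mem_product.mp hu
    obtain ⟨h3, h4⟩ := Finset.mem_product.mp h1
    obtain ⟨h5, h6⟩ := Finset.mem_product.mp h2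
    rw [norm_mul]
    exact mul_le_one₀ (ha _ h3 _ h4) (norm_nonneg _) (ha _ h5 _ h6)
  have hmain := integral_box_norm_trigSum_sq_le_card
    ((sim c C K ×ˢ sim c C L) ×ˢ (sim c C K ×ˢ sim c C L))
    (fun u => a u.1.1 u.1.2 * a u.2.1 u.2.2) hb
    (fun u => (u.1.2 + u.2.2 : ℤ)) (fun u => (u.1.1 * u.1.2 + u.2.1 * u.2.2 : ℤ))
    (fun u => (u.1.2 : ℝ) * √(u.1.1 : ℝ) + (u.2.2 : ℝ) * √(u.2.1 : ℝ)) hW0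
  refine hmain.trans ?_
  have hg := gaussConst_pos
  have hS : 0 ≤ ∑' n, binWeight n := tsum_nonneg fun n => (Real.exp_pos _).le
  gcongr
  rw [← Finset.card_map ⟨toQuad, toQuad_injective⟩]
  have hcount := card_good_le hr hR hL1 (by rwa [hRsq]) hT
    (by rw [show √(K : ℝ) ^ 4 = (√(K : ℝ) ^ 2) ^ 2 by ring, hRsq])
  rw [show √(K : ℝ) ^ 4 = (√(K : ℝ) ^ 2) ^ 2 by ring, hRsq] at hcount
  refine hcount _ fun q hq => ?_
  obtain ⟨u, hu, rfl⟩ := Finset.mem_map.mp hq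
  obtain ⟨⟨⟨k₁, l₁⟩, k₂, l₂⟩, ⟨k₃, l₃⟩, k₄, l₄⟩ := u
  simp only [Finset.mem_filter, Finset.mem_product, mem_sim hC0] at hu
  obtain ⟨⟨⟨⟨hk₁, hl₁⟩, hk₂, hl₂⟩, ⟨hk₃, hl₃⟩, hk₄, hl₄⟩, hsum, hmom, hroot⟩ := hu
  have klow : ∀ k : ℕ, c * K ≤ k → (K : ℝ) ≤ (C / c) ^ 2 * k := by
    intro k hk
    calc (K : ℝ) ≤ (C / c) * C * K := by
          refine le_mul_of_one_le_left (by linarith) (one_le_mul_of_one_le_of_one_le hr hC1)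
      _ = (C / c) ^ 2 * (c * K) := by rw [← hrc]; field_simp
      _ ≤ _ := by gcongr
  have khigh : ∀ k : ℕ, (k : ℝ) ≤ C * K → (k : ℝ) ≤ (C / c) ^ 2 * K := by
    intro k hk
    refine hk.trans ?_
    gcongr
    nlinarith
  have llow : ∀ l : ℕ, c * L ≤ l → (L : ℝ) ≤ C / c * l := by
    intro l hl
    calc (L : ℝ) ≤ C * L := le_mul_of_one_le_left (by linarith) hC1
      _ = C / c * (c * L) := by rw [← mul_assoc, hrc]
      _ ≤ _ := by gcongr
  have lhigh : ∀ l : ℕ, (l : ℝ) ≤ C * L → (l : ℝ) ≤ C / c * L := by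
    intro l hl
    refine hl.trans ?_
    gcongr
  rw [← mul_sub, abs_mul, abs_of_pos hW0, hW, one_div_mul_eq_div, div_le_one (by positivity)]
    at hroot
  refine ⟨?_, ?_, ?_, ?_, ?_, ?_, ?_, ?_, ?_, ?_, ?_, ?_, ?_, ?_, ?_, ?_, hsum, ?_, ?_⟩ <;>
    simp only [Function.Embedding.coeFn_mk, toQuad, hRsq, Int.cast_natCast]
  · exact klow _ hk₁.1
  · exact khigh _ hk₁.2
  · exact klow _ hk₂.1
  · exact khigh _ hk₂.2
  · exact klow _ hk₃.1
  · exact khigh _ hk₃.2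
  · exact klow _ hk₄.1
  · exact khigh _ hk₄.2
  · exact llow _ hl₁.1
  · exact lhigh _ hl₁.2
  · exact llow _ hl₂.1
  · exact lhigh _ hl₂.2
  · exact llow _ hl₃.1
  · exact lhigh _ hl₃.2
  · exact llow _ hl₄.1
  · exact lhigh _ hl₄.2
  · linarith
  · calc _ ≤ η * L * √(K : ℝ) * √(K : ℝ) := by
          gcongr
          refine le_trans (le_of_eq ?_) hroot
          congr 1; ring
      _ = η * √(K : ℝ) ^ 2 * L := by ring
      _ ≤ L := by rw [hRsq]; exact mul_le_of_le_one_left (by linarith) hηK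

theorem G_four_eq {c C : ℝ} {K L : ℕ} {η W : ℝ} (hW : W = 1 / (η * L * √(K : ℝ))) (hW0 : 0 ≤ W)
    (a : ℕ → ℕ → ℂ) :
    G 4 c C K L η a =
      ((8 * W)⁻¹ * ∫ x in box 1 1 W, ‖expSum c C K L a x‖ ^ 4) ^ (1 / 4 : ℝ) := by
  rw [G, avgNorm, ← hW, setAverage_eq, volume_real_box hW0, smul_eq_mul]
  simp_rw [Real.rpow_ofNat]

theorem G_four_le {c C : ℝ} (hc : 0 < c) (hc1 : c ≤ 1) (hC1 : 1 ≤ C) {ε : ℝ} (hε : 0 < ε) :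
    ∃ M : ℝ, 0 < M ∧ ∀ (K L : ℕ) (η : ℝ), Admissible K L η → ∀ a : ℕ → ℕ → ℂ,
      (∀ k ∈ sim c C K, ∀ l ∈ sim c C L, ‖a k l‖ ≤ 1) →
        G 4 c C K L η a ≤ M * (K : ℝ) ^ ((1 : ℝ) / 2 + ε) * (L : ℝ) ^ ((1 : ℝ) / 2) := by
  have hr : 1 ≤ C / c := (one_le_div hc).mpr (by linarith)
  obtain ⟨C₁, hC₁, hT⟩ := exists_subpolyBound (ε := 4 * ε / 5) (by positivity)
    (B := 512 * (C / c) ^ 13) (one_le_mul_of_one_le_of_one_le (by norm_num) (one_le_pow₀ hr))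
  obtain ⟨A, hA⟩ : ∃ A : ℝ,
      A = gaussConst / 2 * ((∑' n, binWeight n) * (countConst (C / c) * C₁ ^ 5)) := ⟨_, rfl⟩
  have hS : 0 < ∑' n, binWeight n :=
    summable_binWeight.tsum_pos (fun n => (Real.exp_pos _).le) 0 (Real.exp_pos _)
  have hg := gaussConst_pos
  have hcc : 0 < countConst (C / c) := by
    unfold countConst; positivity
  have hA0 : 0 < A := by rw [hA]; positivity
  refine ⟨A ^ (1 / 4 : ℝ), by positivity, fun K L η h a ha => ?_⟩
  have hη := h.1
  have hL1 : (1 : ℝ) ≤ L := by exact_mod_cast h.2.1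
  have hK : (1 : ℝ) ≤ K := hL1.trans (by exact_mod_cast h.2.2.1.le)
  obtain ⟨W, hW⟩ : ∃ W : ℝ, W = 1 / (η * L * √(K : ℝ)) := ⟨_, rfl⟩
  have hW0 : 0 < W := by rw [hW]; positivity
  have hI := integral_norm_expSum_pow_four_le hc hc1 hC1 h (hT K hK) ha hW
  rw [G_four_eq hW hW0.le]
  have hKε : ((K : ℝ) ^ (4 * ε / 5)) ^ 5 = (K : ℝ) ^ (4 * ε) := by
    rw [← Real.rpow_mul_natCast (by linarith)]; congr 1; push_cast; ring
  calc _ ≤ (A * ((K : ℝ) ^ (4 * ε) * K ^ 2 * L ^ 2)) ^ (1 / 4 : ℝ) := by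
        refine Real.rpow_le_rpow ?_ ?_ (by norm_num)
        · exact mul_nonneg (by positivity) (integral_nonneg fun x => by positivity)
        · refine (mul_le_mul_of_nonneg_left hI (by positivity)).trans (le_of_eq ?_)
          rw [mul_pow, hKε, hA]
          field_simp
          ring
    _ = _ := by
        have hK0 : (0 : ℝ) < K := by linarith
        rw [Real.mul_rpow hA0.le (by positivity), Real.mul_rpow (by positivity) (by positivity),
          Real.mul_rpow (by positivity) (by positivity), ← Real.rpow_mul hK0.le,
          ← Real.rpow_natCast_mul hK0.le, ← Real.rpow_natCast_mul (by linarith),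
          ← Real.rpow_add hK0, mul_assoc (A ^ (1 / 4 : ℝ))]
        congr 3 <;> norm_num <;> ring

theorem le_card_sim {c C : ℝ} (hc : 0 < c) (hc1 : c ≤ 1) (hC1 : 1 ≤ C) (N : ℕ) (hN : 1 ≤ N) :
    (C - c) / 2 * N ≤ (sim c C N).card := by
  have hN1 : (1 : ℝ) ≤ N := by exact_mod_cast hN
  have h1 : (1 : ℝ) ≤ (sim c C N).card := by
    have : 0 < (sim c C N).card :=
      Finset.card_pos.mpr ⟨N, (mem_sim (by linarith)).mpr ⟨by nlinarith, by nlinarith⟩⟩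
    exact_mod_cast this
  have h2 : (C - c) * N - 1 ≤ (sim c C N).card := by
    rw [sim, Nat.card_Icc]
    have h3 := Nat.lt_floor_add_one (C * N)
    have h4 := Nat.ceil_lt_add_one (show 0 ≤ c * N by positivity)
    have h5 : ((⌊C * N⌋₊ + 1 : ℕ) : ℝ) - ⌈c * N⌉₊ ≤ ((⌊C * N⌋₊ + 1 - ⌈c * N⌉₊ : ℕ) : ℝ) := by
      rw [sub_le_iff_le_add]
      exact_mod_cast (by omega : ⌊C * N⌋₊ + 1 ≤ ⌊C * N⌋₊ + 1 - ⌈c * N⌉₊ + ⌈c * N⌉₊)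
    push_cast at h5
    linarith
  linarith

theorem integral_norm_expSum_one_sq {c C : ℝ} (hc : 0 < c) (hC : 0 ≤ C) {K L : ℕ} (hL : 1 ≤ L)
    {W : ℝ} (hW : 0 ≤ W) :
    ∫ x in box 1 1 W, ‖expSum c C K L (fun _ _ => 1) x‖ ^ 2 =
      8 * W * ((sim c C K).card * (sim c C L).card) := by
  rw [expSum_eq_trigSum]
  have hinj : ∀ u ∈ sim c C K ×ˢ sim c C L, ∀ v ∈ sim c C K ×ˢ sim c C L,
      (u.2 : ℤ) = v.2 → (u.1 * u.2 : ℤ) = v.1 * v.2 → u = v := by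
    rintro ⟨k, l⟩ hu ⟨k', l'⟩ _ h1 h2
    simp only [Nat.cast_inj] at h1
    subst h1
    have hl : (0 : ℝ) < l := by
      have h3 := ((mem_sim hC).mp (Finset.mem_product.mp hu).2).1
      have : (1 : ℝ) ≤ L := by exact_mod_cast hL
      exact lt_of_lt_of_le (by positivity) h3
    have hl' : l ≠ 0 := by rintro rfl; simp at hl
    simp only at h2
    norm_cast at h2
    rw [Nat.eq_of_mul_eq_mul_right (Nat.pos_of_ne_zero hl') h2]
  rw [integral_box_norm_trigSum_sq (sim c C K ×ˢ sim c C L) (fun u => (u.2 : ℤ))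
    (fun u => (u.1 * u.2 : ℤ)) (fun u => (u.2 : ℝ) * √(u.1 : ℝ)) hinj hW, Finset.card_product,
    Nat.cast_mul]

theorem le_G_four {c C : ℝ} (hc : 0 < c) (hc1 : c ≤ 1) (hC1 : 1 ≤ C) (hcC : c < C) {K L : ℕ}
    {η : ℝ} (h : Admissible K L η) :
    (C - c) / 2 * (K : ℝ) ^ ((1 : ℝ) / 2) * (L : ℝ) ^ ((1 : ℝ) / 2) ≤
      G 4 c C K L η (fun _ _ => 1) := by
  have hη := h.1
  have hL1 : (1 : ℝ) ≤ L := by exact_mod_cast h.2.1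
  have hK : (1 : ℝ) ≤ K := hL1.trans (by exact_mod_cast h.2.2.1.le)
  obtain ⟨W, hW⟩ : ∃ W : ℝ, W = 1 / (η * L * √(K : ℝ)) := ⟨_, rfl⟩
  have hW0 : 0 < W := by rw [hW]; positivity
  rw [G_four_eq hW hW0.le]
  set f := expSum c C K L (fun _ _ => 1) with hf
  set m : ℝ := (sim c C K).card * (sim c C L).card with hm
  have hI := integral_norm_expSum_one_sq hc (by linarith) (K := K) h.2.1 hW0.le (C := C)
  rw [← hf, ← hm] at hI
  have hfin : IsFiniteMeasure (volume.restrict (box 1 1 W)) := by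
    rw [restrict_box]; infer_instance
  have hint : ∀ n : ℕ, Integrable (fun x => ‖f x‖ ^ n) (volume.restrict (box 1 1 W)) := by
    intro n; rw [hf, expSum_eq_trigSum]; exact integrable_norm_trigSum_pow _ _ _ _ _
  have hvar : 0 ≤ ∫ x in box 1 1 W, (‖f x‖ ^ 2 - m) ^ 2 :=
    integral_nonneg fun x => sq_nonneg _
  have hexp : ∫ x in box 1 1 W, (‖f x‖ ^ 2 - m) ^ 2 =
      (∫ x in box 1 1 W, ‖f x‖ ^ 4) - 2 * m * (8 * W * m) + 8 * W * m ^ 2 := by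
    have : ∀ x, (‖f x‖ ^ 2 - m) ^ 2 = ‖f x‖ ^ 4 - 2 * m * ‖f x‖ ^ 2 + m ^ 2 := fun x => by ring
    simp_rw [this]
    rw [integral_add (f := fun x => ‖f x‖ ^ 4 - 2 * m * ‖f x‖ ^ 2) ((hint 4).sub ((hint 2).const_mul _)) (integrable_const _),
      integral_sub (hint 4) ((hint 2).const_mul _), integral_const_mul, hI, integral_const,
      measureReal_restrict_apply_univ, volume_real_box hW0.le, smul_eq_mul]
  have hfour : m ^ 2 ≤ (8 * W)⁻¹ * ∫ x in box 1 1 W, ‖f x‖ ^ 4 := by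
    rw [le_inv_mul_iff₀ (by positivity)]
    nlinarith
  have hcard : ((C - c) / 2) ^ 2 * (K * L) ≤ m := by
    have h1 := le_card_sim hc hc1 hC1 K (h.2.1.trans h.2.2.1.le)
    have h2 := le_card_sim hc hc1 hC1 L h.2.1
    have : 0 ≤ (C - c) / 2 := by linarith
    calc _ = ((C - c) / 2 * K) * ((C - c) / 2 * L) := by ring
      _ ≤ _ := by rw [hm]; gcongr
  have hd : 0 ≤ (C - c) / 2 := by linarith
  have key : ((C - c) / 2 * (K : ℝ) ^ ((1 : ℝ) / 2) * (L : ℝ) ^ ((1 : ℝ) / 2)) ^ 4 ≤ m ^ 2 := by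
    rw [← Real.sqrt_eq_rpow, ← Real.sqrt_eq_rpow]
    calc _ = (((C - c) / 2) ^ 2 * (√(K : ℝ) ^ 2 * √(L : ℝ) ^ 2)) ^ 2 := by ring
      _ = (((C - c) / 2) ^ 2 * (K * L)) ^ 2 := by
          rw [Real.sq_sqrt (by linarith), Real.sq_sqrt (by linarith)]
      _ ≤ _ := by gcongr
  calc _ = (((C - c) / 2 * (K : ℝ) ^ ((1 : ℝ) / 2) * (L : ℝ) ^ ((1 : ℝ) / 2)) ^ 4) ^
        (1 / 4 : ℝ) := by
        rw [← Real.rpow_natCast_mul (by positivity)]; norm_num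
    _ ≤ _ := Real.rpow_le_rpow (by positivity) (key.trans hfour) (by norm_num)

end FirstSpacing
end

/-- For every choice `c`, `C` of the implicit constants in `k ∼ K`, `l ∼ L`: the upper bound for
`G_4`, uniform in the coefficients, and its sharpness up to `K^ε` (all coefficients equal to 1). -/
theorem corollary3p6 (c C : ℝ) (hc : 0 < c) (hc1 : c ≤ 1) (hC1 : 1 ≤ C) (hcC : c < C) :
    (∀ ε : ℝ, 0 < ε → ∃ M : ℝ, 0 < M ∧
      ∀ (K L : ℕ) (η : ℝ), FirstSpacing.Admissible K L η →
        ∀ a : ℕ → ℕ → ℂ,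
          (∀ k ∈ FirstSpacing.sim c C K, ∀ l ∈ FirstSpacing.sim c C L, ‖a k l‖ ≤ 1) →
          FirstSpacing.G 4 c C K L η a ≤
            M * (K : ℝ) ^ ((1 : ℝ) / 2 + ε) * (L : ℝ) ^ ((1 : ℝ) / 2)) ∧
    (∃ m : ℝ, 0 < m ∧
      ∀ (K L : ℕ) (η : ℝ), FirstSpacing.Admissible K L η →
        m * (K : ℝ) ^ ((1 : ℝ) / 2) * (L : ℝ) ^ ((1 : ℝ) / 2) ≤
          FirstSpacing.G 4 c C K L η (fun _ _ => 1)) := by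
  exact ⟨fun ε hε => FirstSpacing.G_four_le hc hc1 hC1 hε, (C - c) / 2, by linarith,
    fun K L η h => FirstSpacing.le_G_four hc hc1 hC1 hcC h⟩
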